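/- **Theorem (consistency of the Time-Aware PC algorithm).** *Setting.* Let $\boldsymbol X_t=(X_{t1},\dots,X_{tp})$, $t\ge 1$, be a strictly stationary $\mathbb R^p$-valued time series, and for $i,j\in\{1,\dots,p\}$ let $\mathcal F_a^b$ be the $\sigma$-field generated by $\{X_{ti},X_{tj}:a\le t\le b\}$. Put $$\xi_{ij}(k)=\sup_{l\ge1}\ \sup_{U\in L_2(\mathcal F_1^l),\,W\in L_2(\mathcal F_{l+k}^\infty)}\frac{|\mathrm{cov}(U,W)|}{\sqrt{\mathrm{var}\,U}\sqrt{\mathrm{var}\,W}},\qquad \alpha_{ij}(k)=\sup_{l\ge1}\ \sup_{A\in\mathcal F_1^l,\,B\in\mathcal F_{l+k}^\infty}|P(A\cap B)-P(A)P(B)| .$$ Assume either (A.1)–(A.3): for all $i,j$, $\xi_{ij}(k)\to0$ as $k\to\infty$, $\mathbb E X_{ti}^4<\infty$ for all $t$, $\sum_{k\ge1}\xi_{ij}(k)<\infty$, and there are positive integers $s_n\to\infty$ with $s_n=o(n^{1/2})$ and $n^{1/2}\xi_{ij}(s_n)\to0$ for all $i,j$; or (A.1)*–(A.3)*: for all $i,j$,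 $\alpha_{ij}(k)\to0$, for some $\delta>2$ both $\mathbb E|X_{ti}|^{2\delta}<\infty$ for all $t,i$ and $\sum_{k\ge1}\alpha_{ij}(k)^{1-2/\delta}<\infty$ for all $i,j$, and there are positive integers $s_n\to\infty$ with $s_n=o(n^{1/2})$ and $n^{1/2}\alpha_{ij}(s_n)\to0$ for all $i,j$. Let $\tau,r\ge1$ and $\boldsymbol\chi_t=(\boldsymbol X_{1+(t-1)r},\dots,\boldsymbol X_{\tau+(t-1)r})$, with components indexed by $\boldsymbol V=\{1,\dots,p\}\times\{1,\dots,\tau\}$. Assume (B.1): the law of $\boldsymbol\chi_t$ is faithful to a DAG $\boldsymbol G$ on $\boldsymbol V$, i.e. for all pairwise disjoint $A,B,C\subseteq\boldsymbol V$, $A$ and $B$ are conditionally independent given $C$ if and only if $C$ d-separates $A$ and $B$ in $\boldsymbol G$. Two DAGs are Markov equivalent if the same distributions are faithful to them; $\boldsymbol G_{CPDAG}$ has an edge $(a,b)$ if and only if $a\to b$ in some DAG Markov equivalent to $\boldsymbol G$ (an undirected edge consists of both $(a,b)$ and $(b,a)$). The rolled graph of a graph on $\boldsymbol V$ has an edge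 from $u$ to $v$ if and only if there is an edge from $(u,t_1)$ to $(v,t_2)$ for some $t_1\le t_2$; $\boldsymbol G_{CPDAG,R}$ is the rolled graph of $\boldsymbol G_{CPDAG}$. *Algorithm.* Given statistics $\hat\mu_m(i,j|\boldsymbol k)$ computed from $\boldsymbol\chi_1,\dots,\boldsymbol\chi_m$ and a threshold $\gamma$, the PC algorithm accepts "$i\perp j\mid\boldsymbol k$" if and only if $|\hat\mu_m(i,j|\boldsymbol k)|\le\gamma$. It starts from the complete undirected graph. For $\ell=0,1,\dots$ it deletes an edge $i-j$, and saves $S(i,j)=S(j,i)=\boldsymbol k$, whenever the test accepts $i\perp j\mid\boldsymbol k$ for some $\boldsymbol k\subseteq adj(i)\setminus\{j\}$ with $|\boldsymbol k|=\ell$ (current adjacencies), until no such deletion is possible; it stops after the first level $\ell$ with $|adj(i)\setminus\{j\}|\le\ell$ for all adjacent $i,j$. Then each $i-c-j$ with $i\ne j$ non-adjacent and $c\notin S(i,j)$ is oriented as $i\to c\leftarrow j$. Finally, as long as possible, an undirected edge $i-j$ is oriented as $i\to j$ if (1) $h\to i$ with $h,j$ non-adjacent, or (2) $i\to c\to j$,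 or (3) $i-c\to j$ and $i-d\to j$ with $c\neq d$ non-adjacent, or (4) $i-c\to d\to j$ with $c,j$ non-adjacent. The Time-Aware PC algorithm outputs the rolled graph of the output of PC. Let $N_n\to\infty$ be positive integers, e.g. $N_n=n-\tau+1$. Let $\hat{\boldsymbol G}_{CPDAG,n}$ be the output of PC based on $\boldsymbol\chi_1,\dots,\boldsymbol\chi_{N_n}$ and $\hat{\boldsymbol G}_{CPDAG,R,n}$ its rolled graph. *Claim.* In each of the following cases, as $n\to\infty$, $$P(\hat{\boldsymbol G}_{CPDAG,n}=\boldsymbol G_{CPDAG})\to1\quad\text{and}\quad P(\hat{\boldsymbol G}_{CPDAG,R,n}=\boldsymbol G_{CPDAG,R})\to1,$$ where the event is that the algorithm terminates with this output, and that it does so whatever the order of its selections. Here $\gamma$ is any number with $0<\gamma<|\mu(i,j|\boldsymbol k)|$ for all $i\neq j$ and $\boldsymbol k\subseteq\boldsymbol V\setminus\{i,j\}$ with $\mu(i,j|\boldsymbol k)\ne0$. 1. $(\boldsymbol X_t)$ is a Gaussian process, $\boldsymbol\chi_1$ has a non-singular covariance matrix, $\mu(i,j|\boldsymbol k)=\frac12\log\frac{1+\rho}{1-\rho}$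 with $\rho=\rho_{i,j|\boldsymbol k}$ the partial correlation of the components $i,j$ of $\boldsymbol\chi_1$ given $\boldsymbol k$, and $\hat\mu_m(i,j|\boldsymbol k)$ is the same function of the sample covariance matrix of $\boldsymbol\chi_1,\dots,\boldsymbol\chi_m$. 2. The same $\mu$ and $\hat\mu_m$, with non-singular covariance matrix; instead of Gaussianity it is only assumed that, for all $i\ne j$ and $\boldsymbol k\subseteq\boldsymbol V\setminus\{i,j\}$, $\mu(i,j|\boldsymbol k)=0$ if and only if the components $i,j$ of $\boldsymbol\chi_1$ are conditionally independent given $\boldsymbol k$. 3. The algorithm uses any consistent test: $\mu$ is any function with $\mu(i,j|\boldsymbol k)=0$ if and only if the components $i,j$ of $\boldsymbol\chi_1$ are conditionally independent given $\boldsymbol k$, and $\hat\mu_m(i,j|\boldsymbol k)\to\mu(i,j|\boldsymbol k)$ in probability as $m\to\infty$, for all $i\ne j$ and $\boldsymbol k\subseteq\boldsymbol V\setminus\{i,j\}$. -/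

import Mathlib

open MeasureTheory ProbabilityTheory Filter Topology

noncomputable section

namespace TimeAwarePC

/-! ### Directed graphs, d-separation, faithfulness, CPDAG

A graph on the node set `V` is its edge relation `E : V → V → Prop`.  The edge `u → v` is directed
if `E u v` and not `E v u`; the edge `u - v` is undirected if both `E u v` and `E v u`. -/

section Graphs

variable {V : Type*}

/-- Two nodes are adjacent if there is an edge between them, of whatever direction. -/
def Adj (E : V → V → Prop) (u v : V) : Prop := E u v ∨ E v u

/-- A DAG has no directed cycles (in particular no loops and no undirected edges). -/
def IsDAG (E : V → V → Prop) : Prop := ∀ v, ¬ Relation.TransGen E v v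

/-- `π` is a path (a sequence of distinct, successively adjacent nodes) from `v` to `w`. -/
def IsPath (E : V → V → Prop) (v w : V) (π : List V) : Prop :=
  π.Nodup ∧ π.IsChain (Adj E) ∧ π.head? = some v ∧ π.getLast? = some w

/-- `v` and `w` are d-connected given `C`: there is a path between them all of whose colliders are
ancestors of `C` (every node being an ancestor of itself) and none of whose interior non-colliders
is in `C`. -/
def DConnected (E : V → V → Prop) (C : Finset V) (v w : V) : Prop :=
  ∃ π : List V, IsPath E v w π ∧
    ∀ a b c, [a, b, c] <:+: π →
      ((E a b ∧ E c b) → ∃ d ∈ C, Relation.ReflTransGen E b d) ∧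
      (¬ (E a b ∧ E c b) → b ∉ C)

/-- `C` d-separates `A` and `B`. -/
def DSeparates (E : V → V → Prop) (A B C : Finset V) : Prop :=
  ∀ v ∈ A, ∀ w ∈ B, ¬ DConnected E C v w

variable [Fintype V]

/-- `X_A ⫫ X_B | X_C` for a random vector `X = (X_v)_{v ∈ V}` with law `P`. -/
def CondIndep (P : Measure (V → ℝ)) [IsFiniteMeasure P] (A B C : Finset V) : Prop :=
  CondIndepFun (MeasurableSpace.comap (fun x : V → ℝ => C.restrict x) inferInstance)
    (Finset.measurable_restrict C).comap_le
    (fun x : V → ℝ => A.restrict x) (fun x : V → ℝ => B.restrict x) P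

/-- `P` has the directed Markov property with respect to the graph, and is faithful to it. -/
def Faithful (P : Measure (V → ℝ)) [IsFiniteMeasure P] (E : V → V → Prop) : Prop :=
  ∀ A B C : Finset V, Disjoint A B → Disjoint C A → Disjoint C B →
    (CondIndep P A B C ↔ DSeparates E A B C)

/-- Two DAGs are Markov equivalent if the same distributions are faithful to them. -/
def MarkovEquivalent (E E' : V → V → Prop) : Prop :=
  ∀ (P : Measure (V → ℝ)) [IsProbabilityMeasure P], Faithful P E ↔ Faithful P E'

/-- The CPDAG of a DAG: `v → w` is directed in it if `v → w` is in all Markov equivalent DAGs, and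
`v - w` is undirected if both directions occur among them. -/
def cpdag (E : V → V → Prop) : V → V → Prop := fun v w =>
  ∃ E', IsDAG E' ∧ MarkovEquivalent E E' ∧ E' v w

end Graphs

/-! ### The PC algorithm

`ci i j k` is the answer of the test of "`i` and `j` are independent given `k`" (`True` means that
conditional independence is accepted).  The order in which pairs, conditioning sets and orientation
rules are selected is left open by the algorithm, so its outputs are described by a relation. -/

section PC

variable {V : Type*} [DecidableEq V]

/-- The state of the skeleton phase: the current undirected graph and the separation sets. -/
structure SkelState (V : Type*) where
  adj : V → V → Prop
  sep : V → V → Finset V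

/-- The complete undirected graph, with no separation set saved yet. -/
def initState : SkelState V := ⟨fun a b => a ≠ b, fun _ _ => ∅⟩

/-- Delete the edge `i - j` and save `k` in `S(i,j)` and `S(j,i)`. -/
def SkelState.delete (s : SkelState V) (i j : V) (k : Finset V) : SkelState V where
  adj a b := s.adj a b ∧ ¬ ((a = i ∧ b = j) ∨ (a = j ∧ b = i))
  sep a b := if (a = i ∧ b = j) ∨ (a = j ∧ b = i) then k else s.sep a b

/-- One deletion at level `ℓ`: `i, j` are adjacent, `k ⊆ adj(i) \ {j}` has `ℓ` elements, and
conditional independence of `i` and `j` given `k` is accepted. -/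
def DeleteStep (ci : V → V → Finset V → Prop) (ℓ : ℕ) (s s' : SkelState V) : Prop :=
  ∃ i j k, s.adj i j ∧ (∀ x ∈ k, s.adj i x ∧ x ≠ j) ∧ k.card = ℓ ∧ ci i j k ∧
    s' = s.delete i j k

/-- A completed pass at level `ℓ`: deletions are made until all adjacent `i, j` and all
`k ⊆ adj(i) \ {j}` with `ℓ` elements have been tested without success. -/
def LevelRun (ci : V → V → Finset V → Prop) (ℓ : ℕ) (s s' : SkelState V) : Prop :=
  Relation.ReflTransGen (DeleteStep ci ℓ) s s' ∧ ∀ s'', ¬ DeleteStep ci ℓ s' s''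

/-- The stopping criterion after level `ℓ`: `|adj(i) \ {j}| ≤ ℓ` for all adjacent `i, j`. -/
def StopAt (ℓ : ℕ) (s : SkelState V) : Prop :=
  ∀ i j, s.adj i j → {x | s.adj i x ∧ x ≠ j}.ncard ≤ ℓ

/-- The states that can be reached at the end of level `ℓ` of the skeleton phase. -/
inductive AfterLevel (ci : V → V → Finset V → Prop) : ℕ → SkelState V → Prop
  | zero {s : SkelState V} : LevelRun ci 0 initState s → AfterLevel ci 0 s
  | succ {ℓ : ℕ} {s s' : SkelState V} : AfterLevel ci ℓ s → ¬ StopAt ℓ s →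
      LevelRun ci (ℓ + 1) s s' → AfterLevel ci (ℓ + 1) s'

/-- `s` (a skeleton with separation sets) is a result of the skeleton phase. -/
def IsSkeletonOutput (ci : V → V → Finset V → Prop) (s : SkelState V) : Prop :=
  ∃ ℓ, AfterLevel ci ℓ s ∧ StopAt ℓ s

/-- `i - c - j` with `i, j` non-adjacent and `c` not in the separation set of `i` and `j`. -/
def IsColliderTriple (s : SkelState V) (t : V × V × V) : Prop :=
  t.1 ≠ t.2.2 ∧ ¬ s.adj t.1 t.2.2 ∧ s.adj t.1 t.2.1 ∧ s.adj t.2.2 t.2.1 ∧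
    t.2.1 ∉ s.sep t.1 t.2.2

/-- Orient the triple `t = (i, c, j)` as `i → c ← j`. -/
def orientCollider (E : V → V → Prop) (t : V × V × V) : V → V → Prop := fun x y =>
  ((x = t.1 ∨ x = t.2.2) ∧ y = t.2.1) ∨
    (E x y ∧ ¬ (x = t.2.1 ∧ (y = t.1 ∨ y = t.2.2)))

/-- `E` arises from the skeleton by orienting all collider triples, in some order. -/
def IsColliderOutput (s : SkelState V) (E : V → V → Prop) : Prop :=
  ∃ l : List (V × V × V), (∀ t, t ∈ l ↔ IsColliderTriple s t) ∧ E = l.foldl orientCollider s.adj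

/-- `u → v` is a directed edge. -/
def Dir (E : V → V → Prop) (u v : V) : Prop := E u v ∧ ¬ E v u

/-- `u - v` is an undirected edge. -/
def Undir (E : V → V → Prop) (u v : V) : Prop := E u v ∧ E v u

/-- The four rules by which an undirected edge `i - j` is oriented into `i → j`. -/
def MeekRule (E : V → V → Prop) (i j : V) : Prop :=
  (∃ h, Dir E h i ∧ ¬ Adj E h j) ∨
  (∃ c, Dir E i c ∧ Dir E c j) ∨
  (∃ c d, c ≠ d ∧ ¬ Adj E c d ∧ Undir E i c ∧ Dir E c j ∧ Undir E i d ∧ Dir E d j) ∨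
  (∃ c d, ¬ Adj E c j ∧ Undir E i c ∧ Dir E c d ∧ Dir E d j)

/-- One application of an orientation rule. -/
def MeekStep (E E' : V → V → Prop) : Prop :=
  ∃ i j, Undir E i j ∧ MeekRule E i j ∧ E' = fun x y => E x y ∧ ¬ (x = j ∧ y = i)

/-- `E` is an output of the PC algorithm run with the test answers `ci`: skeleton phase,
orientation of the colliders, then the orientation rules until none of them applies. -/
def IsPCOutput (ci : V → V → Finset V → Prop) (E : V → V → Prop) : Prop :=
  ∃ s E₀, IsSkeletonOutput ci s ∧ IsColliderOutput s E₀ ∧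
    Relation.ReflTransGen MeekStep E₀ E ∧ ∀ E', ¬ MeekStep E E'

/-- The rolled graph of a graph with nodes `(variable, time)`: there is an edge `u → v` if there is
an edge `(u, t₁) → (v, t₂)` with `t₁ ≤ t₂`. -/
def rolled {p τ : ℕ} (E : Fin p × Fin τ → Fin p × Fin τ → Prop) : Fin p → Fin p → Prop :=
  fun u v => ∃ t₁ t₂, t₁ ≤ t₂ ∧ E (u, t₁) (v, t₂)

/-- `R` is an output of the Time-Aware PC algorithm: the rolled graph of an output of PC. -/
def IsTimeAwarePCOutput {p τ : ℕ}
    (ci : Fin p × Fin τ → Fin p × Fin τ → Finset (Fin p × Fin τ) → Prop)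
    (R : Fin p → Fin p → Prop) : Prop :=
  ∃ E, IsPCOutput ci E ∧ R = rolled E

end PC

/-! ### Partial correlations -/

section PartialCorrelation

variable {V : Type*} [Fintype V] [DecidableEq V]

/-- The Schur complement `M₁₁ - M₁₂ M₂₂⁻¹ M₂₁`, where the second block has index set `k`. -/
def schur (M : Matrix V V ℝ) (k : Finset V) : Matrix V V ℝ :=
  M - M.submatrix id (Subtype.val : k → V) *
    (M.submatrix (Subtype.val : k → V) (Subtype.val : k → V))⁻¹ *
    M.submatrix (Subtype.val : k → V) id

/-- The partial correlation of `i` and `j` given `k` for the covariance matrix `M`. -/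
def partialCorr (M : Matrix V V ℝ) (i j : V) (k : Finset V) : ℝ :=
  schur M k i j / √(schur M k i i * schur M k j j)

/-- Fisher's z-transform. -/
def fisherZ (x : ℝ) : ℝ := 1 / 2 * Real.log ((1 + x) / (1 - x))

/-- The sample covariance matrix of `m` observations of a random vector. -/
def sampleCov (m : ℕ) (data : Fin m → V → ℝ) : Matrix V V ℝ := fun a b =>
  (∑ t, (data t a - (∑ s, data s a) / m) * (data t b - (∑ s, data s b) / m)) / m

/-- The covariance matrix of a random vector with law `P`. -/
def covMatrix (P : Measure (V → ℝ)) : Matrix V V ℝ := fun a b =>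
  covariance (fun x : V → ℝ => x a) (fun x : V → ℝ => x b) P

/-- The population quantity `z(i,j|k)`. -/
def popZ (P : Measure (V → ℝ)) (i j : V) (k : Finset V) : ℝ :=
  fisherZ (partialCorr (covMatrix P) i j k)

/-- The sample statistic `Z(i,j|k)`. -/
def sampleZ (m : ℕ) (data : Fin m → V → ℝ) (i j : V) (k : Finset V) : ℝ :=
  fisherZ (partialCorr (sampleCov m data) i j k)

end PartialCorrelation

/-! ### The time series and its mixing conditions

Time is indexed from `0`: `X t` is the observation with number `t + 1`. -/

section Series

variable {Ω : Type*} [MeasurableSpace Ω] {p : ℕ}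

/-- Strict stationarity: time shifts do not change the law of the whole process. -/
def StrictlyStationary (X : ℕ → Ω → Fin p → ℝ) (μ : Measure Ω) : Prop :=
  ∀ h : ℕ, μ.map (fun ω t => X (t + h) ω) = μ.map (fun ω t => X t ω)

/-- The σ-field generated by the variables `i` and `j` at the times in `S`. -/
@[reducible] def pairSigma (X : ℕ → Ω → Fin p → ℝ) (i j : Fin p) (S : Set ℕ) : MeasurableSpace Ω :=
  ⨆ t ∈ S, MeasurableSpace.comap (fun ω => (X t ω i, X t ω j)) inferInstance

/-- `𝓕_1^l`. -/
@[reducible] def past (X : ℕ → Ω → Fin p → ℝ) (i j : Fin p) (l : ℕ) : MeasurableSpace Ω :=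
  pairSigma X i j {t | t + 1 ≤ l}

/-- `𝓕_l^∞`. -/
@[reducible] def future (X : ℕ → Ω → Fin p → ℝ) (i j : Fin p) (l : ℕ) : MeasurableSpace Ω :=
  pairSigma X i j {t | l ≤ t + 1}

/-- The maximal correlation coefficients `ξ_{ij}(k)`. -/
def rhoCoef (μ : Measure Ω) (X : ℕ → Ω → Fin p → ℝ) (i j : Fin p) (k : ℕ) : ℝ :=
  sSup {x | ∃ l, 1 ≤ l ∧ ∃ U W : Ω → ℝ,
    Measurable[past X i j l] U ∧ MemLp U 2 μ ∧
    Measurable[future X i j (l + k)] W ∧ MemLp W 2 μ ∧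
    x = |covariance U W μ| / (√(variance U μ) * √(variance W μ))}

/-- The strong mixing coefficients `α_{ij}(k)`. -/
def alphaCoef (μ : Measure Ω) (X : ℕ → Ω → Fin p → ℝ) (i j : Fin p) (k : ℕ) : ℝ :=
  sSup {x | ∃ l, 1 ≤ l ∧ ∃ A B : Set Ω,
    MeasurableSet[past X i j l] A ∧ MeasurableSet[future X i j (l + k)] B ∧
    x = |μ.real (A ∩ B) - μ.real A * μ.real B|}

/-- The rate condition (A.3) on a family of mixing coefficients. -/
def RateCondition (coef : Fin p → Fin p → ℕ → ℝ) : Prop :=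
  ∃ s : ℕ → ℕ, (∀ n, 0 < s n) ∧ Tendsto s atTop atTop ∧
    (fun n => (s n : ℝ)) =o[atTop] (fun n : ℕ => √(n : ℝ)) ∧
    ∀ i j, Tendsto (fun n : ℕ => √(n : ℝ) * coef i j (s n)) atTop (𝓝 0)

/-- Conditions (A.1)-(A.3): ρ-mixing. -/
def RhoMixing (μ : Measure Ω) (X : ℕ → Ω → Fin p → ℝ) : Prop :=
  (∀ i j, Tendsto (rhoCoef μ X i j) atTop (𝓝 0)) ∧
  (∀ t i, Integrable (fun ω => X t ω i ^ 4) μ) ∧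
  (∀ i j, Summable (fun k => rhoCoef μ X i j (k + 1))) ∧
  RateCondition (rhoCoef μ X)

/-- Conditions (A.1)*-(A.3)*: strong mixing. -/
def StrongMixing (μ : Measure Ω) (X : ℕ → Ω → Fin p → ℝ) : Prop :=
  (∀ i j, Tendsto (alphaCoef μ X i j) atTop (𝓝 0)) ∧
  (∃ δ : ℝ, 2 < δ ∧ (∀ t i, Integrable (fun ω => |X t ω i| ^ (2 * δ)) μ) ∧
    ∀ i j, Summable (fun k => alphaCoef μ X i j (k + 1) ^ (1 - 2 / δ))) ∧
  RateCondition (alphaCoef μ X)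

/-- The block vectors `χ_t = (X_{1+(t-1)r}, …, X_{τ+(t-1)r})`, again with times from `0`; the
component `(v, s)` is variable `v` at time `s` of the block. -/
def block (X : ℕ → Ω → Fin p → ℝ) (r τ : ℕ) (t : ℕ) (ω : Ω) : Fin p × Fin τ → ℝ :=
  fun a => X (t * r + a.2) ω a.1

/-- The answers of the tests that use the statistic `T` of the first `m` block vectors: conditional
independence of `i` and `j` given `k` is accepted if and only if `|T(i,j|k)| ≤ γ`. -/
def testAnswers (X : ℕ → Ω → Fin p → ℝ) (r τ : ℕ)
    (T : (m : ℕ) → (Fin m → Fin p × Fin τ → ℝ) →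
      Fin p × Fin τ → Fin p × Fin τ → Finset (Fin p × Fin τ) → ℝ)
    (γ : ℝ) (m : ℕ) (ω : Ω) (i j : Fin p × Fin τ) (k : Finset (Fin p × Fin τ)) : Prop :=
  |T m (fun t => block X r τ t ω) i j k| ≤ γ

/-- Consistency of PC and of Time-Aware PC run on `χ_1, …, χ_{N n}` with the statistic `T` and the
threshold `γ`: with probability tending to one, the algorithm has an output and all of its outputs
(whatever the order of selection) equal the CPDAG of `G`, respectively its rolled graph. -/
def PCConsistent (μ : Measure Ω) (X : ℕ → Ω → Fin p → ℝ) (r τ : ℕ)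
    (T : (m : ℕ) → (Fin m → Fin p × Fin τ → ℝ) →
      Fin p × Fin τ → Fin p × Fin τ → Finset (Fin p × Fin τ) → ℝ)
    (γ : ℝ) (N : ℕ → ℕ) (G : Fin p × Fin τ → Fin p × Fin τ → Prop) : Prop :=
  Tendsto (fun n => μ {ω | ∀ E, IsPCOutput (testAnswers X r τ T γ (N n) ω) E ↔ E = cpdag G})
    atTop (𝓝 1) ∧
  Tendsto (fun n => μ {ω | ∀ R,
    IsTimeAwarePCOutput (testAnswers X r τ T γ (N n) ω) R ↔ R = rolled (cpdag G)})
    atTop (𝓝 1)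

/-- `ν(i,j|k)` is a measure of conditional dependence for the law `P`: it vanishes exactly if `i`
and `j` are conditionally independent given `k`. -/
def IsDependenceMeasure {V : Type*} [Fintype V] (P : Measure (V → ℝ)) [IsFiniteMeasure P]
    (ν : V → V → Finset V → ℝ) : Prop :=
  ∀ i j k, i ≠ j → i ∉ k → j ∉ k → (ν i j k = 0 ↔ CondIndep P {i} {j} k)

/-- The threshold `γ` is positive and below every non-zero value of `|ν(i,j|k)|`. -/
def IsThreshold {V : Type*} (ν : V → V → Finset V → ℝ) (γ : ℝ) : Prop :=
  0 < γ ∧ ∀ i j k, i ≠ j → i ∉ k → j ∉ k → ν i j k ≠ 0 → γ < |ν i j k|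

end Series

end TimeAwarePC

end

noncomputable section

namespace TimeAwarePC

/-! ### Active walks, ancestors and shortest directed paths -/

section Walks

variable {V : Type*}

/-! The theorem splits into a deterministic and a probabilistic half, joined by finiteness of the
set of tests.

Deterministic half (`isPCOutput_iff`): if every test answers according to d-separation in `G`, each
run of PC ends in the CPDAG, whatever its choices. In a DAG, non-adjacent nodes are separated by the
parents of one of them, and the skeleton phase cannot stop before having tried such a set; a
separating set contains the middle of an unshielded triple exactly if that is no collider. So the
first two phases produce the pattern of `G`: its adjacencies with the unshielded colliders directed.
By the Verma–Pearl theorem (`SamePattern.dConnected`) the pattern determines all d-separations, so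
Markov equivalence means having the same pattern; since a faithful law is given, no faithful law has
to be constructed. Meek's rules are sound because reversing an edge they direct would create a cycle
or a new unshielded collider. They are complete because in a closed graph `a → b - c` forces `a → c`
(`dir_of_dir_of_undir`): the undirected part can then be oriented on its own, and a perfect
elimination ordering orients any chosen edge in either direction without cycles or new unshielded
colliders (`exists_samePattern_of_edge`).

Probabilistic half: both mixing conditions give vanishing strong mixing coefficients and second
moments. For indicators, the variance of the average is bounded by a Cesàro mean of these
coefficients; approximation in `L¹` extends the law of large numbers to integrable functions
(`tendsto_avgError`). Sample covariances therefore converge in probability, and so do the Fisher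
transforms of partial correlations, which are continuous at a positive definite matrix. For a
Gaussian law, regression residuals are independent of the conditioning variables, so zero partial
correlation is conditional independence (`isDependenceMeasure_popZ`).

Finally, finitely many non-zero values of the dependence measure leave a margin around `γ`; with
probability tending to one all estimates lie within it, and then all test answers are correct. -/

theorem Adj.symm {E : V → V → Prop} {a b : V} (h : Adj E a b) : Adj E b a := Or.symm h

theorem IsDAG.asymm {E : V → V → Prop} (hE : IsDAG E) {a b : V} (h : E a b) : ¬ E b a :=
  fun h' => hE a (.tail (.single h) h')

theorem IsDAG.irrefl {E : V → V → Prop} (hE : IsDAG E) (a : V) : ¬ E a a :=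
  fun h => hE a (.single h)

theorem IsDAG.no_triangle {E : V → V → Prop} (hE : IsDAG E) {a b c : V} (h : E a b) (h' : E b c) :
    ¬ E c a := fun h'' => hE a (.tail (.tail (.single h) h') h'')

theorem IsDAG.ne_of_adj {E : V → V → Prop} (hE : IsDAG E) {a b : V} (h : Adj E a b) : a ≠ b := by
  rintro rfl
  exact h.elim (hE.irrefl a) (hE.irrefl a)

/-- `b` is an ancestor of `C`. -/
def Anc (E : V → V → Prop) (C : Finset V) (b : V) : Prop := ∃ d ∈ C, Relation.ReflTransGen E b d

theorem Anc.of_mem {E : V → V → Prop} {C : Finset V} {b : V} (h : b ∈ C) : Anc E C b :=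
  ⟨b, h, .refl⟩

theorem Anc.of_edge {E : V → V → Prop} {C : Finset V} {b d : V} (hd : Anc E C d) (h : E b d) :
    Anc E C b := let ⟨e, he, hde⟩ := hd; ⟨e, he, .head h hde⟩

theorem Anc.of_reach {E : V → V → Prop} {C : Finset V} {b d : V} (hd : Anc E C d)
    (h : Relation.ReflTransGen E b d) : Anc E C b := let ⟨e, he, hde⟩ := hd; ⟨e, he, h.trans hde⟩

/-- The condition on the interior node `b` of a walk `…, a, b, c, …` that is active given `C`. -/
def Ok (E : V → V → Prop) (C : Finset V) (a b c : V) : Prop :=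
  ((E a b ∧ E c b) → Anc E C b) ∧ (¬ (E a b ∧ E c b) → b ∉ C)

theorem Ok.symm {E : V → V → Prop} {C : Finset V} {a b c : V} (h : Ok E C a b c) : Ok E C c b a :=
  ⟨fun h' => h.1 h'.symm, fun h' => h.2 fun h'' => h' h''.symm⟩

/-- The walk `f 0, …, f n` is active given `C`. -/
def ActiveWalk (E : V → V → Prop) (C : Finset V) (f : ℕ → V) (n : ℕ) : Prop :=
  (∀ k, k + 1 ≤ n → Adj E (f k) (f (k + 1))) ∧
    ∀ k, k + 2 ≤ n → Ok E C (f k) (f (k + 1)) (f (k + 2))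

/-- Indexing by `ℕ` turns cutting and replacing nodes into arithmetic on indices. Injectivity is
kept out of `ActiveWalk`, since replacing a node may create repetitions; it is recovered from
minimal length. -/
theorem dConnected_iff_exists_activeWalk {E : V → V → Prop} {C : Finset V} {v w : V} :
    DConnected E C v w ↔ ∃ f n, ActiveWalk E C f n ∧ f 0 = v ∧ f n = w ∧
      Set.InjOn f {k | k ≤ n} := by
  constructor
  · rintro ⟨π, ⟨hnd, hch, hh, hl⟩, hπ⟩
    have hpos : 0 < π.length := by
      rcases π with _ | ⟨x, π⟩
      · simp at hh
      · simp
    have hget : ∀ k (hk : k < π.length), π.getD k v = π[k] := fun k hk => by simp [hk]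
    refine ⟨fun k => π.getD k v, π.length - 1, ⟨fun k hk => ?_, fun k hk => ?_⟩, ?_, ?_, ?_⟩
    · simp only [hget k (by omega), hget (k + 1) (by omega)]
      exact List.isChain_iff_getElem.1 hch k (by omega)
    · simp only [hget k (by omega), hget (k + 1) (by omega), hget (k + 2) (by omega)]
      have : [π[k]'(by omega), π[k + 1]'(by omega), π[k + 2]'(by omega)] <:+: π := by
        refine ⟨π.take k, π.drop (k + 3), ?_⟩
        have h1 := List.drop_eq_getElem_cons (l := π) (i := k) (by omega)
        have h2 := List.drop_eq_getElem_cons (l := π) (i := k + 1) (by omega)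
        have h3 := List.drop_eq_getElem_cons (l := π) (i := k + 2) (by omega)
        rw [h3] at h2
        rw [h2] at h1
        conv_rhs => rw [← List.take_append_drop k π, h1]
        simp
      exact hπ _ _ _ this
    · rw [List.head?_eq_getElem?] at hh
      simp [hh]
    · rw [List.getLast?_eq_getElem?] at hl
      simp [hl]
    · intro a ha b hb hab
      simp only [Set.mem_ofPred_eq] at ha hb
      simp only [hget a (by omega), hget b (by omega)] at hab
      exact (List.Nodup.getElem_inj_iff hnd).1 hab
  · rintro ⟨f, n, ⟨hadj, hok⟩, h0, hn, hinj⟩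
    refine ⟨(List.range (n + 1)).map f, ⟨?_, ?_, ?_, ?_⟩, ?_⟩
    · refine List.Nodup.map_on ?_ List.nodup_range
      intro a ha b hb hab
      simp only [List.mem_range] at ha hb
      exact hinj (by simp; omega) (by simp; omega) hab
    · rw [List.isChain_iff_getElem]
      intro i hi
      simp only [List.length_map, List.length_range] at hi
      simpa using hadj i (by omega)
    · simp [List.head?_eq_getElem?, h0]
    · simp [List.getLast?_eq_getElem?, hn]
    · rintro a b c ⟨s, t, hst⟩
      have hlen := congrArg List.length hst
      simp only [List.length_append, List.length_cons, List.length_nil, List.length_map,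
        List.length_range] at hlen
      have key : ∀ k, k < n + 1 → (s ++ [a, b, c] ++ t)[k]? = some (f k) := by
        intro k hk
        rw [hst]
        simp [hk]
      have ha := key s.length (by omega)
      have hb := key (s.length + 1) (by omega)
      have hc := key (s.length + 2) (by omega)
      simp at ha hb hc
      have := hok s.length (by omega)
      rwa [← ha, ← hb, ← hc] at this

theorem DConnected.symm {E : V → V → Prop} {C : Finset V} {v w : V} (h : DConnected E C v w) :
    DConnected E C w v := by
  obtain ⟨f, n, hf, h0, hn, hinj⟩ := dConnected_iff_exists_activeWalk.1 h
  refine dConnected_iff_exists_activeWalk.2 ⟨fun k => f (n - k), n, ⟨fun k hk => ?_, fun k hk => ?_⟩,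
    by simpa using hn, by simpa using h0, ?_⟩
  · have := hf.1 (n - (k + 1)) (by omega)
    rw [show n - (k + 1) + 1 = n - k by omega] at this
    exact this.symm
  · have := hf.2 (n - (k + 2)) (by omega)
    rw [show n - (k + 2) + 1 = n - (k + 1) by omega, show n - (k + 2) + 2 = n - k by omega] at this
    exact this.symm
  · intro a ha b hb hab
    simp only [Set.mem_ofPred_eq] at ha hb
    have := hinj (show n - a ≤ n by omega) (show n - b ≤ n by omega) hab
    omega

/-- Leave out the nodes with numbers `i + 1, …, i + s`. -/
def cut (f : ℕ → V) (i s : ℕ) : ℕ → V := fun k => if k ≤ i then f k else f (k + s)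

theorem cut_of_le {f : ℕ → V} {i s k : ℕ} (h : k ≤ i) : cut f i s k = f k := if_pos h

theorem cut_of_lt {f : ℕ → V} {i s k : ℕ} (h : i < k) : cut f i s k = f (k + s) :=
  if_neg (not_le.2 h)

/-- Only the new edge and the at most two triples that contain it need checking. If `i + s = n`, the
walk is merely truncated and the three side conditions are void. -/
theorem ActiveWalk.cut {E : V → V → Prop} {C : Finset V} {f : ℕ → V} {n i s : ℕ}
    (hf : ActiveWalk E C f n) (his : i + s ≤ n)
    (hadj : i + s + 1 ≤ n → Adj E (f i) (f (i + s + 1)))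
    (hok : ∀ j, i = j + 1 → i + s + 1 ≤ n → Ok E C (f j) (f i) (f (i + s + 1)))
    (hok' : i + s + 2 ≤ n → Ok E C (f i) (f (i + s + 1)) (f (i + s + 2))) :
    ActiveWalk E C (TimeAwarePC.cut f i s) (n - s) := by
  constructor
  · intro k hk
    rcases lt_trichotomy k i with h | h | h
    · rw [cut_of_le h.le, cut_of_le (by omega)]
      exact hf.1 k (by omega)
    · subst h
      rw [cut_of_le le_rfl, cut_of_lt (by omega), show k + 1 + s = k + s + 1 by omega]
      exact hadj (by omega)
    · rw [cut_of_lt h, cut_of_lt (by omega), show k + 1 + s = k + s + 1 by omega]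
      exact hf.1 _ (by omega)
  · intro k hk
    rcases lt_trichotomy (k + 1) i with h | h | h
    · rw [cut_of_le (by omega), cut_of_le (by omega), cut_of_le (by omega)]
      exact hf.2 k (by omega)
    · rw [cut_of_le (by omega), cut_of_le (by omega), cut_of_lt (by omega),
        show k + 2 + s = i + s + 1 by omega, h]
      exact hok k h.symm (by omega)
    · rcases (show i ≤ k by omega).eq_or_lt with h' | h'
      · subst h'
        rw [cut_of_le le_rfl, cut_of_lt (by omega), cut_of_lt (by omega),
          show i + 1 + s = i + s + 1 by omega, show i + 2 + s = i + s + 2 by omega]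
        exact hok' (by omega)
      · rw [cut_of_lt h', cut_of_lt (by omega), cut_of_lt (by omega),
          show k + 1 + s = k + s + 1 by omega, show k + 2 + s = k + s + 2 by omega]
        exact hf.2 _ (by omega)

/-- A walk that leaves a node along an outgoing edge is directed until it meets a collider. -/
theorem ActiveWalk.anc_or_directed {E : V → V → Prop} {C : Finset V} {f : ℕ → V} {n : ℕ}
    (hf : ActiveWalk E C f n) {i : ℕ} (hi : E (f i) (f (i + 1))) (j : ℕ) (hj : i + j + 1 ≤ n) :
    Anc E C (f i) ∨ (Relation.TransGen E (f i) (f (i + j + 1)) ∧ E (f (i + j)) (f (i + j + 1))) := by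
  induction j with
  | zero => exact .inr ⟨.single hi, hi⟩
  | succ j ih =>
    rcases ih (by omega) with h | ⟨h, h'⟩
    · exact .inl h
    · by_cases hc : E (f (i + j + 2)) (f (i + j + 1))
      · exact .inl (((hf.2 (i + j) (by omega)).1 ⟨h', hc⟩).of_reach h.to_reflTransGen)
      · have := (hf.1 (i + j + 1) (by omega)).resolve_right hc
        exact .inr ⟨h.tail this, this⟩

/-- Let `b` be the repeated node. If `b` becomes a collider, follow the loop: its first edge enters
`b`, so `b` was an active collider before, or it leaves `b`, and then a directed path leads to an
active collider, since it cannot return to `b` in a DAG. If `b ∈ C`, both of its occurrences were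
colliders, hence so is the merged one. -/
theorem ActiveWalk.cut_loop {E : V → V → Prop} (hE : IsDAG E) {C : Finset V} {f : ℕ → V} {n i s : ℕ}
    (hf : ActiveWalk E C f n) (his : i + s ≤ n) (hs : 0 < s) (heq : f i = f (i + s)) :
    ActiveWalk E C (TimeAwarePC.cut f i s) (n - s) := by
  refine hf.cut his (fun h => ?_) (fun j hj h => ?_) (fun h => ?_)
  · rw [heq]; exact hf.1 _ h
  · obtain ⟨s, rfl⟩ : ∃ t, s = t + 1 := ⟨s - 1, by omega⟩
    subst hj
    have h1 := hf.2 j (by omega)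
    have h2 := hf.2 (j + 1 + s) (by omega)
    rw [show j + 1 + s + 1 = j + 1 + (s + 1) by omega] at h2
    rw [← heq] at h2
    constructor
    · rintro ⟨ha, hc⟩
      by_cases h3 : E (f (j + 2)) (f (j + 1))
      · exact h1.1 ⟨ha, h3⟩
      · have h4 := (hf.1 (j + 1) (by omega)).resolve_right h3
        rcases hf.anc_or_directed h4 s (by omega) with h5 | h5
        · exact h5
        · rw [show j + 1 + s + 1 = j + 1 + (s + 1) by omega, ← heq] at h5
          exact (hE _ h5.1).elim
    · intro hn hb
      exact hn ⟨(not_imp_not.1 h1.2 hb).1, (not_imp_not.1 h2.2 hb).2⟩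
  · rw [heq]; exact hf.2 _ h

/-- `b → d₁ → ⋯ → dₘ ∈ C` for some nodes. -/
def Reach (E : V → V → Prop) (C : Finset V) : ℕ → V → Prop
  | 0, b => b ∈ C
  | m + 1, b => ∃ d, E b d ∧ Reach E C m d

theorem Anc.exists_reach {E : V → V → Prop} {C : Finset V} {b : V} (h : Anc E C b) :
    ∃ m, Reach E C m b := by
  obtain ⟨d, hd, h⟩ := h
  induction h using Relation.ReflTransGen.head_induction_on with
  | refl => exact ⟨0, hd⟩
  | head h' _ ih => obtain ⟨m, hm⟩ := ih; exact ⟨m + 1, _, h', hm⟩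

theorem Reach.anc {E : V → V → Prop} {C : Finset V} {m : ℕ} {b : V} (h : Reach E C m b) :
    Anc E C b := by
  induction m generalizing b with
  | zero => exact .of_mem h
  | succ m ih => obtain ⟨d, hd, h⟩ := h; exact (ih h).of_edge hd

/-- The length of the shortest directed path to `C`. -/
def ancDist (E : V → V → Prop) (C : Finset V) (b : V) : ℕ := sInf {m | Reach E C m b}

theorem Anc.reach_ancDist {E : V → V → Prop} {C : Finset V} {b : V} (h : Anc E C b) :
    Reach E C (ancDist E C b) b := Nat.sInf_mem (s := {m | Reach E C m b}) h.exists_reach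

theorem ancDist_le {E : V → V → Prop} {C : Finset V} {m : ℕ} {b : V} (h : Reach E C m b) :
    ancDist E C b ≤ m := Nat.sInf_le h

/-- An unshielded collider `a → b ← c`. -/
def VStruct (E : V → V → Prop) (a b c : V) : Prop := E a b ∧ E c b ∧ a ≠ c ∧ ¬ Adj E a c

theorem VStruct.symm {E : V → V → Prop} {a b c : V} (h : VStruct E a b c) : VStruct E c b a :=
  ⟨h.2.1, h.1, h.2.2.1.symm, fun h' => h.2.2.2 h'.symm⟩

/-- Two graphs with the same adjacencies and the same unshielded colliders. -/
def SamePattern (E E' : V → V → Prop) : Prop :=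
  (∀ a b, Adj E a b ↔ Adj E' a b) ∧ ∀ a b c, VStruct E a b c ↔ VStruct E' a b c

theorem SamePattern.symm {E E' : V → V → Prop} (h : SamePattern E E') : SamePattern E' E :=
  ⟨fun a b => (h.1 a b).symm, fun a b c => (h.2 a b c).symm⟩

/-- Once the first edge of a shortest directed path keeps its direction in `E'`, so do all others: a
first reversal would be a collider `b → d ← e` in `E'`, unshielded because a shortest path has no
shortcut, and hence a collider in `E` too. -/
theorem SamePattern.anc_of_shortest {E E' : V → V → Prop} (hE : IsDAG E)
    (h : SamePattern E E') {C : Finset V} (m : ℕ) {b d : V}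
    (hb : ∀ m', Reach E C m' b → m + 1 ≤ m') (hbd : E b d) (hd : Reach E C m d) (hbd' : E' b d) :
    Anc E' C b := by
  induction m generalizing b d with
  | zero => exact (Anc.of_mem hd).of_edge hbd'
  | succ m ih =>
    obtain ⟨e, hde, he⟩ := hd
    refine (ih (b := d) (d := e) ?_ hde he ?_).of_edge hbd'
    · intro m' hm'
      have := hb (m' + 1) ⟨d, hbd, hm'⟩
      omega
    · rcases (h.1 d e).1 (.inl hde) with h1 | h1
      · exact h1
      · have hbe : ¬ Adj E b e := by
          rintro (h2 | h2)
          · have := hb (m + 1) ⟨e, h2, he⟩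
            omega
          · exact hE.no_triangle hbd hde h2
        have hne : b ≠ e := by rintro rfl; exact hE.asymm hbd hde
        have := (h.2 b d e).2 ⟨hbd', h1, hne, fun h2 => hbe ((h.1 b e).2 h2)⟩
        exact (hE.asymm hde this.2.1).elim

end Walks

/-! ### The Verma–Pearl theorem: equal patterns have equal d-connections -/

section VermaPearl

variable {V : Type*}

/-- In a shortest active walk a node between two adjacent nodes is a common parent of them, and one
of these is a collider with an arrow from outside. -/
theorem ActiveWalk.shielded_of_minimal {E : V → V → Prop} (hE : IsDAG E) {C : Finset V} {f : ℕ → V}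
    {n k : ℕ} (hf : ActiveWalk E C f n)
    (hmin : ∀ i s, 0 < s → i + s ≤ n → (i + s = n → f i = f n) →
      ¬ ActiveWalk E C (TimeAwarePC.cut f i s) (n - s))
    (hk : k + 2 ≤ n) (hadj : Adj E (f k) (f (k + 2))) :
    E (f (k + 1)) (f k) ∧ E (f (k + 1)) (f (k + 2)) ∧
      ((∃ j, k = j + 1 ∧ E (f j) (f k)) ∨ (k + 3 ≤ n ∧ E (f (k + 3)) (f (k + 2)))) := by
  have hab := hf.1 k (by omega)
  have hbc := hf.1 (k + 1) (by omega)
  have h1 := hf.2 k (by omega)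
  by_contra hcon
  -- Bypass the middle node along the edge between its neighbours. The shorter walk could be blocked
  -- only at a neighbour that was a collider in `C` and stops being one; that is the configuration
  -- denied by `hcon`, so the shorter walk is active.
  refine hmin k 1 one_pos (by omega) (fun h => by omega) (hf.cut (by omega) (fun _ => hadj) ?_ ?_)
  · rintro j rfl -
    have h2 := hf.2 j (by omega)
    have hxa := hf.1 j (by omega)
    simp only [Nat.add_assoc, Nat.reduceAdd] at *
    constructor
    · rintro ⟨hx, hc⟩
      by_cases h3 : E (f (j + 2)) (f (j + 1))
      · exact h2.1 ⟨hx, h3⟩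
      · have h4 := hab.resolve_right h3
        have h5 : E (f (j + 3)) (f (j + 2)) := by
          rcases hbc with h5 | h5
          · exact (hE.no_triangle h4 h5 hc).elim
          · exact h5
        exact (h1.1 ⟨h4, h5⟩).of_edge h4
    · intro hn hC
      have h3 := not_imp_not.1 h2.2 hC
      have h4 : E (f (j + 1)) (f (j + 3)) := hadj.resolve_right fun h4 => hn ⟨h3.1, h4⟩
      have h5 : E (f (j + 2)) (f (j + 3)) := hbc.resolve_right fun h5 =>
        hE.no_triangle h4 h5 h3.2
      exact hcon ⟨h3.2, h5, .inl ⟨j, rfl, h3.1⟩⟩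
  · intro hk3
    have h2 := hf.2 (k + 1) (by omega)
    have hcy := hf.1 (k + 2) (by omega)
    simp only [Nat.add_assoc, Nat.reduceAdd] at *
    constructor
    · rintro ⟨ha, hy⟩
      by_cases h3 : E (f (k + 1)) (f (k + 2))
      · exact h2.1 ⟨h3, hy⟩
      · have h4 := hbc.resolve_left h3
        have h5 : E (f k) (f (k + 1)) := by
          rcases hab with h5 | h5
          · exact h5
          · exact (hE.no_triangle h4 h5 ha).elim
        exact (h1.1 ⟨h5, h4⟩).of_edge h4
    · intro hn hC
      have h3 := not_imp_not.1 h2.2 hC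
      have h4 : E (f (k + 2)) (f k) := hadj.resolve_left fun h4 => hn ⟨h4, h3.2⟩
      have h5 : E (f (k + 1)) (f k) := hab.resolve_left fun h5 => hE.no_triangle h4 h5 h3.1
      exact hcon ⟨h5, h3.1, .inr ⟨hk3, h3.2⟩⟩

/-- The distance of the collider `b` to `C`, and zero for a non-collider. -/
def colliderDist (E : V → V → Prop) (C : Finset V) (a b c : V) : ℕ :=
  open Classical in if E a b ∧ E c b then ancDist E C b else 0

/-- The sum of the distances of all colliders to `C`. -/
def walkCost (E : V → V → Prop) (C : Finset V) (f : ℕ → V) (n : ℕ) : ℕ :=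
  ∑ k ∈ Finset.range (n - 1), colliderDist E C (f k) (f (k + 1)) (f (k + 2))

/-- Replacing a collider `b` by its successor `d` on a shortest directed path to `C`. -/
theorem ActiveWalk.replace_collider {E : V → V → Prop} (hE : IsDAG E) {C : Finset V} {f : ℕ → V}
    {n k : ℕ} (hf : ActiveWalk E C f n) (hk : k + 2 ≤ n) {d : V}
    (hab : E (f k) (f (k + 1))) (hcb : E (f (k + 2)) (f (k + 1))) (hdC : Anc E C d)
    (hd : ancDist E C d < ancDist E C (f (k + 1)))
    (had : E (f k) d) (hcd : E (f (k + 2)) d) :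
    ActiveWalk E C (Function.update f (k + 1) d) n ∧
      walkCost E C (Function.update f (k + 1) d) n < walkCost E C f n := by
  have hu : ∀ j, j ≠ k + 1 → Function.update f (k + 1) d j = f j :=
    fun j hj => Function.update_of_ne hj _ _
  have hu' : Function.update f (k + 1) d (k + 1) = d := Function.update_self ..
  refine ⟨⟨fun j hj => ?_, fun j hj => ?_⟩, ?_⟩
  · by_cases h1 : j = k
    · subst h1; rw [hu _ (by omega), hu']; exact .inl had
    · by_cases h2 : j = k + 1
      · subst h2; rw [hu', hu _ (by omega)]; exact .inr hcd
      · rw [hu _ h2, hu _ (by omega)]; exact hf.1 j hj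
  · by_cases h1 : j = k
    · subst h1; rw [hu _ (by omega), hu', hu _ (by omega)]
      exact ⟨fun _ => hdC, fun h => (h ⟨had, hcd⟩).elim⟩
    · by_cases h2 : j = k + 1
      · subst h2; rw [hu', hu _ (by omega), hu _ (by omega)]
        exact ⟨fun h => (hE.asymm h.1 hcd).elim,
          fun _ => (hf.2 (k + 1) hj).2 fun h => hE.asymm h.1 hcb⟩
      · by_cases h3 : j + 1 = k
        · subst h3; rw [hu _ (by omega), hu _ (by omega), hu']
          exact ⟨fun h => (hE.asymm h.2 had).elim,
            fun _ => (hf.2 j hj).2 fun h => hE.asymm h.2 hab⟩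
        · rw [hu _ h2, hu _ (by omega), hu _ (by omega)]
          exact hf.2 j hj
  · refine Finset.sum_lt_sum (fun j hj => ?_) ⟨k, by simp; omega, ?_⟩
    · by_cases h1 : j = k
      · subst h1; rw [hu _ (by omega), hu', hu _ (by omega)]
        rw [colliderDist, if_pos ⟨had, hcd⟩, colliderDist, if_pos ⟨hab, hcb⟩]
        exact hd.le
      · by_cases h2 : j = k + 1
        · subst h2; rw [hu', hu _ (by omega), hu _ (by omega)]
          rw [colliderDist, if_neg fun h => hE.asymm h.1 hcd]
          exact Nat.zero_le _
        · by_cases h3 : j + 1 = k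
          · subst h3; rw [hu _ (by omega), hu _ (by omega), hu']
            rw [colliderDist, if_neg fun h => hE.asymm h.2 had]
            exact Nat.zero_le _
          · rw [hu _ h2, hu _ (by omega), hu _ (by omega)]
    · rw [hu _ (by omega), hu', hu _ (by omega)]
      rw [colliderDist, if_pos ⟨had, hcd⟩, colliderDist, if_pos ⟨hab, hcb⟩]
      exact hd

/-- Take an active walk of minimal length and, among those, of minimal total distance from its
colliders to `C`. Minimal length makes all its colliders unshielded, so that they are the same in
both graphs; minimal distance makes them ancestors of `C` in `E'` as well. -/
theorem SamePattern.dConnected {E E' : V → V → Prop} (hE : IsDAG E) (hE' : IsDAG E')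
    (h : SamePattern E E') {C : Finset V} {v w : V} (hvw : DConnected E C v w) :
    DConnected E' C v w := by
  classical
  have hex : ∃ n f, ActiveWalk E C f n ∧ f 0 = v ∧ f n = w := by
    obtain ⟨f, n, hf, h0, hn, -⟩ := dConnected_iff_exists_activeWalk.1 hvw
    exact ⟨n, f, hf, h0, hn⟩
  obtain ⟨n, hn, hnmin⟩ : ∃ n, (∃ f, ActiveWalk E C f n ∧ f 0 = v ∧ f n = w) ∧
      ∀ m, (∃ f, ActiveWalk E C f m ∧ f 0 = v ∧ f m = w) → n ≤ m :=
    ⟨Nat.find hex, Nat.find_spec hex, fun m hm => Nat.find_min' hex hm⟩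
  have hex' : ∃ c f, (ActiveWalk E C f n ∧ f 0 = v ∧ f n = w) ∧ walkCost E C f n = c :=
    let ⟨f, hf⟩ := hn; ⟨_, f, hf, rfl⟩
  obtain ⟨f, ⟨hf, h0, hfn⟩, hcost⟩ : ∃ f, (ActiveWalk E C f n ∧ f 0 = v ∧ f n = w) ∧
      ∀ g, (ActiveWalk E C g n ∧ g 0 = v ∧ g n = w) → walkCost E C f n ≤ walkCost E C g n := by
    obtain ⟨f, hf, hc⟩ := Nat.find_spec hex'
    exact ⟨f, hf, fun g hg => hc.trans_le (Nat.find_min' hex' ⟨g, hg, rfl⟩)⟩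
  have hmin : ∀ i s, 0 < s → i + s ≤ n → (i + s = n → f i = f n) →
      ¬ ActiveWalk E C (TimeAwarePC.cut f i s) (n - s) := by
    intro i s hs his he hact
    have := hnmin (n - s) ⟨_, hact, by rw [cut_of_le (Nat.zero_le _), h0], ?_⟩
    · omega
    · rcases his.eq_or_lt with h1 | h1
      · rw [cut_of_le (by omega), show n - s = i by omega, he h1, hfn]
      · rw [cut_of_lt (by omega), show n - s + s = n by omega, hfn]
  have hinj : Set.InjOn f {k | k ≤ n} := by
    have key : ∀ i j, i < j → j ≤ n → f i ≠ f j := by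
      intro i j hij hj he
      obtain ⟨s, rfl⟩ := Nat.exists_eq_add_of_lt hij
      rw [Nat.add_assoc] at he hj
      exact hmin i (s + 1) (by omega) hj (fun h => h ▸ he) (hf.cut_loop hE hj (by omega) he)
    intro i hi j hj he
    rcases lt_trichotomy i j with h1 | h1 | h1
    · exact (key i j h1 hj he).elim
    · exact h1
    · exact (key j i h1 hi he.symm).elim
  have hne : ∀ k, k + 2 ≤ n → f k ≠ f (k + 2) := fun k hk he => by
    have := hinj (show k ≤ n by omega) (show k + 2 ≤ n by omega) he
    omega
  have hshield := fun k (hk : k + 2 ≤ n) => hf.shielded_of_minimal hE hmin (k := k) hk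
  have hcoll : ∀ k, k + 2 ≤ n → E (f k) (f (k + 1)) → E (f (k + 2)) (f (k + 1)) →
      VStruct E (f k) (f (k + 1)) (f (k + 2)) := fun k hk ha hc =>
    ⟨ha, hc, hne k hk, fun hadj => hE.asymm ha (hshield k hk hadj).1⟩
  have hstatus : ∀ k, k + 2 ≤ n → ((E (f k) (f (k + 1)) ∧ E (f (k + 2)) (f (k + 1))) ↔
      (E' (f k) (f (k + 1)) ∧ E' (f (k + 2)) (f (k + 1)))) := by
    intro k hk
    constructor
    · rintro ⟨ha, hc⟩
      have := (h.2 _ _ _).1 (hcoll k hk ha hc)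
      exact ⟨this.1, this.2.1⟩
    · rintro ⟨ha, hc⟩
      by_cases hadj : Adj E (f k) (f (k + 2))
      -- If the triple is shielded, a neighbour is a collider of the walk with an arrow from the
      -- middle node. That collider is unshielded, so the arrow persists in `E'` and the middle node
      -- is no collider there.
      · obtain ⟨h1, h2, ⟨j, rfl, h3⟩ | ⟨h3, h4⟩⟩ := hshield k hk hadj
        · exact (hE'.asymm ha ((h.2 _ _ _).1 (hcoll j (by omega) h3 h1)).2.1).elim
        · exact (hE'.asymm hc ((h.2 _ _ _).1 (hcoll (k + 1) (by omega) h2 h4)).1).elim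
      · have := (h.2 _ _ _).2 ⟨ha, hc, hne k hk, fun h1 => hadj ((h.1 _ _).2 h1)⟩
        exact ⟨this.1, this.2.1⟩
  refine dConnected_iff_exists_activeWalk.2 ⟨f, n, ⟨fun k hk => (h.1 _ _).1 (hf.1 k hk),
    fun k hk => ⟨fun hc => ?_, fun hc => (hf.2 k hk).2 fun h' => hc ((hstatus k hk).1 h')⟩⟩,
    h0, hfn, hinj⟩
  obtain ⟨hab, hcb⟩ := (hstatus k hk).2 hc
  have hanc : Anc E C (f (k + 1)) := (hf.2 k hk).1 ⟨hab, hcb⟩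
  have hreach := hanc.reach_ancDist
  have hshort : ∀ m', Reach E C m' (f (k + 1)) → ancDist E C (f (k + 1)) ≤ m' :=
    fun m' hm' => ancDist_le hm'
  rcases hm : ancDist E C (f (k + 1)) with _ | m
  · rw [hm] at hreach
    exact .of_mem hreach
  rw [hm] at hreach hshort
  obtain ⟨d, hbd, hd⟩ := hreach
  rcases (h.1 _ _).1 (Or.inl hbd) with hbd' | hdb'
  · exact h.anc_of_shortest hE m hshort hbd hd hbd'
  have hv := hcoll k hk hab hcb
  have hv' := (h.2 _ _ _).1 hv
  -- The first edge of the shortest path to `C` is reversed in `E'`. An `x` without an edge to `d`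
  -- would form an unshielded collider with `d` in `E'` but not in `E`. So both neighbours point to
  -- `d`, and replacing the collider by `d` lowers the cost.
  have key : ∀ x, E x (f (k + 1)) → E' x (f (k + 1)) → E x d := by
    intro x hx hx'
    by_contra hxd
    have hne : x ≠ d := by rintro rfl; exact hE.asymm hx hbd
    have hnadj : ¬ Adj E x d := by
      rintro (h1 | h1)
      · exact hxd h1
      · exact hE.no_triangle hx hbd h1
    have := (h.2 _ _ _).2 ⟨hx', hdb', hne, fun h1 => hnadj ((h.1 _ _).2 h1)⟩
    exact hE.asymm hbd this.2.1
  have hlt : ancDist E C d < ancDist E C (f (k + 1)) := by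
    have := ancDist_le hd
    omega
  obtain ⟨h1, h2⟩ := hf.replace_collider hE hk hab hcb hd.anc hlt (key _ hab hv'.1)
    (key _ hcb hv'.2.1)
  have := hcost _ ⟨h1, by rw [Function.update_of_ne (by omega), h0],
    by rw [Function.update_of_ne (by omega), hfn]⟩
  omega

theorem SamePattern.dConnected_iff {E E' : V → V → Prop} (hE : IsDAG E) (hE' : IsDAG E')
    (h : SamePattern E E') {C : Finset V} {v w : V} : DConnected E C v w ↔ DConnected E' C v w :=
  ⟨h.dConnected hE hE', h.symm.dConnected hE' hE⟩

end VermaPearl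

/-! ### Separating sets; Markov equivalence means equal patterns -/

section Patterns

variable {V : Type*}

theorem IsDAG.dConnected_of_adj {E : V → V → Prop} (hE : IsDAG E) {v w : V} (h : Adj E v w)
    (C : Finset V) : DConnected E C v w := by
  have hne := hE.ne_of_adj h
  refine ⟨[v, w], ⟨by simp [hne], by simp [h], rfl, rfl⟩, ?_⟩
  intro a b c habc
  have := habc.length_le
  simp at this

/-- The parents of `v` separate it from every non-adjacent non-descendant. -/
theorem IsDAG.not_dConnected_parents {E : V → V → Prop} (hE : IsDAG E) {v w : V} (hne : v ≠ w)
    (hadj : ¬ Adj E v w) (hdesc : ¬ Relation.TransGen E v w) {C : Finset V}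
    (hC : ∀ x, x ∈ C ↔ E x v) : ¬ DConnected E C v w := by
  intro h
  obtain ⟨f, n, hf, rfl, rfl, -⟩ := dConnected_iff_exists_activeWalk.1 h
  have hn : 2 ≤ n := by
    by_contra hn
    interval_cases n
    · exact hne rfl
    · exact hadj (hf.1 0 le_rfl)
  rcases hf.1 0 (by omega) with h1 | h1
  · rcases hf.anc_or_directed h1 (n - 1) (by omega) with ⟨d, hd, h2⟩ | h2
    · exact hE _ (Relation.TransGen.tail' h2 ((hC d).1 hd))
    · rw [show 0 + (n - 1) + 1 = n by omega] at h2
      exact hdesc h2.1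
  · exact (hf.2 0 hn).2 (fun h2 => hE.asymm h1 h2.1) ((hC _).2 h1)

/-- By acyclicity, one of the two nodes is not a descendant of the other. -/
theorem IsDAG.parents_separate {E : V → V → Prop} (hE : IsDAG E) {v w : V} (hne : v ≠ w)
    (hadj : ¬ Adj E v w) : (∀ C : Finset V, (∀ x, x ∈ C ↔ E x v) → ¬ DConnected E C v w) ∨
      (∀ C : Finset V, (∀ x, x ∈ C ↔ E x w) → ¬ DConnected E C w v) := by
  by_cases h : Relation.TransGen E v w
  · refine .inr fun C hC => hE.not_dConnected_parents hne.symm (fun h' => hadj h'.symm) ?_ hC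
    exact fun h' => hE v (h.trans h')
  · exact .inl fun C hC => hE.not_dConnected_parents hne hadj h hC

/-- A set that separates the ends of an unshielded triple contains its middle node if and only if
that is not a collider. -/
theorem IsDAG.mem_iff_not_collider {E : V → V → Prop} (hE : IsDAG E) {a b c : V} {C : Finset V}
    (hne : a ≠ c) (hab : Adj E a b) (hcb : Adj E c b) (hsep : ¬ DConnected E C a c) :
    b ∈ C ↔ ¬ (E a b ∧ E c b) := by
  by_contra hcon
  refine hsep ⟨[a, b, c], ⟨?_, ?_, rfl, rfl⟩, ?_⟩
  · simp [hne, hE.ne_of_adj hab, (hE.ne_of_adj hcb).symm]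
  · simp [hab, hcb.symm]
  · intro a' b' c' h
    have := h.eq_of_length rfl
    simp only [List.cons.injEq, and_true] at this
    obtain ⟨rfl, rfl, rfl⟩ := this
    by_cases hc : E a' b' ∧ E c' b'
    · have hb : b' ∈ C := by tauto
      exact ⟨fun _ => ⟨b', hb, .refl⟩, fun h => (h hc).elim⟩
    · have hb : b' ∉ C := by tauto
      exact ⟨fun h => (hc h).elim, fun _ => hb⟩

theorem IsDAG.exists_separating [Finite V] {E : V → V → Prop} (hE : IsDAG E) {v w : V}
    (hne : v ≠ w) (hadj : ¬ Adj E v w) :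
    ∃ C : Finset V, v ∉ C ∧ w ∉ C ∧ ¬ DConnected E C v w := by
  have hpa : ∀ u, ∃ C : Finset V, ∀ x, x ∈ C ↔ E x u := fun u =>
    ⟨(Set.toFinite {x | E x u}).toFinset, fun x => by simp⟩
  rcases hE.parents_separate hne hadj with h | h
  · obtain ⟨C, hC⟩ := hpa v
    exact ⟨C, fun h' => hE.irrefl v ((hC v).1 h'), fun h' => hadj (.inr ((hC w).1 h')), h C hC⟩
  · obtain ⟨C, hC⟩ := hpa w
    exact ⟨C, fun h' => hadj (.inl ((hC v).1 h')), fun h' => hE.irrefl w ((hC w).1 h'),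
      fun h' => h C hC h'.symm⟩

/-- Two graphs with the same d-separations. -/
def SameSeparations (E E' : V → V → Prop) : Prop :=
  ∀ (C : Finset V) (v w : V), v ≠ w → v ∉ C → w ∉ C → (DConnected E C v w ↔ DConnected E' C v w)

theorem SameSeparations.symm {E E' : V → V → Prop} (h : SameSeparations E E') :
    SameSeparations E' E := fun C v w h1 h2 h3 => (h C v w h1 h2 h3).symm

theorem SameSeparations.adj [Finite V] {E E' : V → V → Prop} (hE : IsDAG E) (hE' : IsDAG E')
    (h : SameSeparations E E') {a b : V} (hab : Adj E a b) : Adj E' a b := by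
  by_contra hcon
  obtain ⟨C, ha, hb, hC⟩ := hE'.exists_separating (hE.ne_of_adj hab) hcon
  exact hC ((h C a b (hE.ne_of_adj hab) ha hb).1 (hE.dConnected_of_adj hab C))

/-- One set separates the ends in both graphs, and whether it contains the middle node decides the
collider status in both. -/
theorem SameSeparations.vStruct [Finite V] {E E' : V → V → Prop} (hE : IsDAG E) (hE' : IsDAG E')
    (h : SameSeparations E E') {a b c : V} (hv : VStruct E a b c) : VStruct E' a b c := by
  obtain ⟨hab, hcb, hne, hnadj⟩ := hv
  obtain ⟨C, ha, hc, hC⟩ := hE.exists_separating hne hnadj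
  have h1 := hE.mem_iff_not_collider hne (.inl hab) (.inl hcb) hC
  have h2 := hE'.mem_iff_not_collider hne (h.adj hE hE' (.inl hab)) (h.adj hE hE' (.inl hcb))
    (mt (h C a c hne ha hc).2 hC)
  have h3 : E' a b ∧ E' c b := by tauto
  exact ⟨h3.1, h3.2, hne, fun h4 => hnadj (h.symm.adj hE' hE h4)⟩

theorem SameSeparations.samePattern [Finite V] {E E' : V → V → Prop} (hE : IsDAG E)
    (hE' : IsDAG E') (h : SameSeparations E E') : SamePattern E E' :=
  ⟨fun _ _ => ⟨h.adj hE hE', h.symm.adj hE' hE⟩,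
    fun _ _ _ => ⟨h.vStruct hE hE', h.symm.vStruct hE' hE⟩⟩

theorem dSeparates_singleton {E : V → V → Prop} {v w : V} {C : Finset V} :
    DSeparates E {v} {w} C ↔ ¬ DConnected E C v w := by
  simp [DSeparates]

/-- The faithful law `P` prevents equivalence from being vacuous: faithful to both graphs, it forces
their d-separations to agree. -/
theorem markovEquivalent_iff_samePattern [Fintype V] {E E' : V → V → Prop} (hE : IsDAG E)
    (hE' : IsDAG E') {P : Measure (V → ℝ)} [IsProbabilityMeasure P] (hP : Faithful P E) :
    MarkovEquivalent E E' ↔ SamePattern E E' := by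
  constructor
  · intro h
    have hP' := (h P).1 hP
    refine SameSeparations.samePattern hE hE' fun C v w hne hv hw => ?_
    have h1 := hP {v} {w} C (by simpa using hne) (by simpa using hv) (by simpa using hw)
    have h2 := hP' {v} {w} C (by simpa using hne) (by simpa using hv) (by simpa using hw)
    rw [h1, dSeparates_singleton, dSeparates_singleton] at h2
    exact not_iff_not.1 h2
  · intro h Q _
    have : ∀ A B C : Finset V, DSeparates E A B C ↔ DSeparates E' A B C := fun A B C => by
      simp only [DSeparates, h.dConnected_iff hE hE']
    simp only [Faithful, this]

theorem cpdag_iff [Fintype V] {E : V → V → Prop} (hE : IsDAG E) {P : Measure (V → ℝ)}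
    [IsProbabilityMeasure P] (hP : Faithful P E) {v w : V} :
    cpdag E v w ↔ ∃ E', IsDAG E' ∧ SamePattern E E' ∧ E' v w :=
  exists_congr fun _ => and_congr_right fun hE' =>
    and_congr_left' (markovEquivalent_iff_samePattern hE hE' hP)

end Patterns

/-! ### Perfect elimination orderings and orientations of the undirected part -/

section PerfectElimination

variable {V : Type*}

/-- A perfect elimination ordering: the neighbours of each node among the later nodes are pairwise
adjacent. -/
def Perfect (U : V → V → Prop) : List V → Prop
  | [] => True
  | s :: L => s ∉ L ∧ (∀ x ∈ L, ∀ y ∈ L, U s x → U s y → x ≠ y → U x y) ∧ Perfect U L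

theorem Perfect.insert_append {U : V → V → Prop} {s : V} {B : List V} (hs : s ∉ B)
    (hB : ∀ x ∈ B, ∀ y ∈ B, U s x → U s y → x ≠ y → U x y) (M : List V)
    (hM : ∀ x ∈ M ++ B, U s x ∧ U x s) (hsM : s ∉ M) (h : Perfect U (M ++ B)) :
    Perfect U (M ++ s :: B) := by
  induction M with
  | nil => exact ⟨hs, hB, h⟩
  | cons m M ih =>
    rw [List.cons_append] at h
    obtain ⟨h1, h2, h3⟩ := h
    simp only [List.mem_cons, not_or, List.mem_append, List.cons_append] at *
    refine ⟨?_, ?_, ih (fun x hx => hM x (by tauto)) hsM.2 h3⟩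
    · simp only [List.mem_append, List.mem_cons]
      rintro (h | rfl | h) <;> tauto
    · simp only [List.mem_append, List.mem_cons]
      intro x hx y hy hmx hmy hxy
      by_cases hxs : x = s
      · subst hxs
        exact (hM y (by grind)).1
      · by_cases hys : y = s
        · subst hys
          exact (hM x (by grind)).2
        · exact h2 x (by tauto) y (by tauto) hmx hmy hxy

theorem Perfect.insert_of_not_adj {U : V → V → Prop} {s : V} {A B : List V} (T : List V)
    (hT : ∀ x ∈ T, ¬ U x s ∧ x ≠ s) (h : Perfect U (T ++ (A ++ B)))
    (h' : Perfect U (A ++ B) → Perfect U (A ++ s :: B)) : Perfect U (T ++ (A ++ s :: B)) := by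
  induction T with
  | nil => exact h' h
  | cons t T ih =>
    rw [List.cons_append] at h
    obtain ⟨h1, h2, h3⟩ := h
    refine ⟨?_, ?_, ih (fun x hx => hT x (by simp [hx])) h3⟩
    · have := hT t (by simp)
      change t ∉ T ++ (A ++ s :: B)
      simp only [List.mem_append, List.mem_cons] at h1 ⊢
      tauto
    · have hts := (hT t (by simp)).1
      have key : ∀ x ∈ T ++ (A ++ s :: B), U t x → x ∈ T ++ (A ++ B) := by
        intro x hx hU
        simp only [List.mem_append, List.mem_cons] at hx ⊢
        rcases hx with h | h | rfl | h
        · exact .inl h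
        · exact .inr (.inl h)
        · exact (hts hU).elim
        · exact .inr (.inr h)
      exact fun x hx y hy hx' hy' => h2 x (key x hx hx') y (key y hy hy') hx' hy'

/-- Every clique can be moved to the end of a perfect elimination ordering. -/
theorem Perfect.exists_append {U : V → V → Prop} (hU : ∀ x y, U x y → U y x) (L : List V)
    (hL : Perfect U L) (l : List V) (hnd : l.Nodup) (hl : ∀ x ∈ l, x ∈ L)
    (hclique : ∀ x ∈ l, ∀ y ∈ l, x ≠ y → U x y) :
    ∃ T, Perfect U (T ++ l) ∧ ∀ x, x ∈ T ++ l ↔ x ∈ L := by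
  classical
  induction L generalizing l with
  | nil =>
    obtain rfl : l = [] := List.eq_nil_iff_forall_not_mem.2 fun x hx => by simpa using hl x hx
    exact ⟨[], trivial, by simp⟩
  | cons s L ih =>
    obtain ⟨h1, h2, h3⟩ := hL
    by_cases hs : s ∈ l
    · obtain ⟨l₂, l₁, rfl⟩ := List.append_of_mem hs
      have hs2 : s ∉ l₂ ++ l₁ := (List.nodup_middle.1 hnd).notMem
      have hnd' : (l₂ ++ l₁).Nodup := (List.nodup_cons.1 (List.nodup_middle.1 hnd)).2
      have hsub : ∀ x ∈ l₂ ++ l₁, x ∈ L ∧ U s x := by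
        intro x hx
        have hxs : x ≠ s := fun h => hs2 (h ▸ hx)
        have hx' : x ∈ l₂ ++ s :: l₁ := by
          simp only [List.mem_append, List.mem_cons] at hx ⊢
          tauto
        exact ⟨by simpa [hxs] using hl x hx', hclique s hs x hx' hxs.symm⟩
      -- `R` holds the later neighbours of `s` outside the clique. Together with `l₂ ++ l₁` it is a
      -- clique of `L`, which the induction hypothesis moves to the end. No node left in front of it
      -- is adjacent to `s`, so `s` can be inserted between `l₂` and `l₁`. Even for a one-element
      -- list, the induction thus needs arbitrary cliques.
      set R := (L.filter fun x => U s x ∧ x ∉ l₂ ++ l₁).dedup with hR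
      have hmR : ∀ x, x ∈ R ↔ x ∈ L ∧ U s x ∧ x ∉ l₂ ++ l₁ := fun x => by
        rw [hR, List.mem_dedup, List.mem_filter, decide_eq_true_iff]
      have hall : ∀ x ∈ R ++ (l₂ ++ l₁), x ∈ L ∧ U s x := by
        intro x hx
        rcases List.mem_append.1 hx with h | h
        · exact ⟨((hmR x).1 h).1, ((hmR x).1 h).2.1⟩
        · exact hsub x h
      obtain ⟨T, hT, hTL⟩ := ih h3 (R ++ (l₂ ++ l₁))
        (List.nodup_append.2 ⟨List.nodup_dedup _, hnd', fun x hx y hy hxy =>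
          ((hmR x).1 hx).2.2 (hxy ▸ hy)⟩)
        (fun x hx => (hall x hx).1)
        (fun x hx y hy hxy => h2 x (hall x hx).1 y (hall y hy).1 (hall x hx).2 (hall y hy).2 hxy)
      have hTnd : ∀ x ∈ T, x ∉ R ++ (l₂ ++ l₁) := by
        clear hTL
        induction T with
        | nil => simp
        | cons t T ih =>
          intro x hx
          rcases List.mem_cons.1 hx with rfl | hx
          · exact fun h => hT.1 (List.mem_append.2 (.inr h))
          · exact ih hT.2.2 x hx
      refine ⟨T ++ R, ?_, fun x => ?_⟩
      · have e1 : T ++ (R ++ (l₂ ++ l₁)) = T ++ ((R ++ l₂) ++ l₁) := by simp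
        have e2 : T ++ R ++ (l₂ ++ s :: l₁) = T ++ ((R ++ l₂) ++ s :: l₁) := by simp
        rw [e2]
        rw [e1] at hT
        refine Perfect.insert_of_not_adj T ?_ hT (Perfect.insert_append ?_ ?_ _ ?_ ?_)
        · intro x hx
          have hxL : x ∈ L := (hTL x).1 (List.mem_append.2 (.inl hx))
          have hxR := hTnd x hx
          refine ⟨fun hxs => hxR ?_, fun h => h1 (h ▸ hxL)⟩
          by_cases hx' : x ∈ l₂ ++ l₁
          · exact List.mem_append.2 (.inr hx')
          · exact List.mem_append.2 (.inl ((hmR x).2 ⟨hxL, hU _ _ hxs, hx'⟩))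
        · exact fun h => hs2 (List.mem_append.2 (.inr h))
        · exact fun x hx y hy _ _ hxy => hclique x (by simp [hx]) y (by simp [hy]) hxy
        · intro x hx
          have := (hall x (by simpa using hx)).2
          exact ⟨this, hU _ _ this⟩
        · intro h
          rcases List.mem_append.1 h with h | h
          · exact h1 ((hmR s).1 h).1
          · exact hs2 (List.mem_append.2 (.inl h))
      · have := hTL x
        simp only [List.mem_append, List.mem_cons] at this ⊢
        tauto
    · obtain ⟨T, hT, hTL⟩ := ih h3 l hnd (fun x hx => by
        have := hl x hx
        have hne : x ≠ s := fun h => hs (h ▸ hx)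
        simpa [hne] using this) hclique
      refine ⟨s :: T, ⟨fun h => h1 ((hTL s).1 h), ?_, hT⟩, fun x => ?_⟩
      · exact fun x hx y hy => h2 x ((hTL x).1 hx) y ((hTL y).1 hy)
      · simp only [List.cons_append, List.mem_cons, hTL]

theorem Perfect.adj_of_idxOf_lt [DecidableEq V] {U : V → V → Prop} {L : List V} (hL : Perfect U L)
    {x y z : V} (hx : x ∈ L) (hz : z ∈ L) (hyx : U y x) (hyz : U y z) (hxz : x ≠ z)
    (h1 : L.idxOf y < L.idxOf x) (h2 : L.idxOf y < L.idxOf z) : U x z := by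
  induction L with
  | nil => simp at hx
  | cons s L ih =>
    have hxs : s ≠ x := by rintro rfl; simp at h1
    have hzs : s ≠ z := by rintro rfl; simp at h2
    have hx' : x ∈ L := by simpa [hxs.symm] using hx
    have hz' : z ∈ L := by simpa [hzs.symm] using hz
    by_cases hys : s = y
    · subst hys
      exact hL.2.1 x hx' z hz' hyx hyz hxz
    · rw [List.idxOf_cons_ne _ hys] at h1 h2
      rw [List.idxOf_cons_ne _ hxs] at h1
      rw [List.idxOf_cons_ne _ hzs] at h2
      exact ih hL.2.2 hx' hz' (by omega) (by omega)

theorem Perfect.nodup {U : V → V → Prop} {L : List V} (hL : Perfect U L) : L.Nodup := by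
  induction L with
  | nil => exact List.nodup_nil
  | cons s L ih => exact List.nodup_cons.2 ⟨hL.1, ih hL.2.2⟩

/-- The reverse of a topological ordering of a DAG without unshielded colliders is a perfect
elimination ordering. -/
theorem IsDAG.exists_perfect [Finite V] {G U : V → V → Prop} (hG : IsDAG G)
    (hUG : ∀ x y, U x y → Adj G x y)
    (hmoral : ∀ x y z, U y x → U y z → G x y → G z y → x ≠ z → U x z) (S : Finset V) :
    ∃ L, Perfect U L ∧ ∀ x, x ∈ L ↔ x ∈ S := by
  classical
  induction hn : S.card generalizing S with
  | zero =>
    obtain rfl := Finset.card_eq_zero.1 hn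
    exact ⟨[], trivial, by simp⟩
  | succ n ih =>
    have hne : S.Nonempty := Finset.card_pos.1 (by omega)
    -- A minimal element for reversed reachability is a sink of `S`. Its `U`-neighbours in `S` are
    -- all parents, so `hmoral` makes them pairwise adjacent and the sink may be eliminated first.
    let r : V → V → Prop := fun x y => Relation.TransGen G y x
    have : IsTrans V r := ⟨fun x y z h1 h2 => h2.trans h1⟩
    have : Std.Irrefl r := ⟨fun x h => hG x h⟩
    obtain ⟨s, hs, hmin⟩ := (Finite.wellFounded_of_trans_of_irrefl r).has_min (S : Set V) hne
    have hsink : ∀ x ∈ S, ¬ G s x := fun x hx h => hmin x hx (.single h)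
    obtain ⟨L, hL, hLS⟩ := ih (S.erase s) (by rw [Finset.card_erase_of_mem hs]; omega)
    have hmem : ∀ x ∈ L, U s x → G x s := fun x hx hU =>
      (hUG s x hU).resolve_left (hsink x (Finset.mem_of_mem_erase ((hLS x).1 hx)))
    refine ⟨s :: L, ⟨by simp [hLS], ?_, hL⟩, fun x => ?_⟩
    · exact fun x hx y hy hx' hy' hxy => hmoral x s y hx' hy' (hmem x hx hx') (hmem y hy hy') hxy
    · rw [List.mem_cons, hLS, Finset.mem_erase]
      by_cases h : x = s
      · simpa [h] using hs
      · simp [h]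

/-- The undirected edges of a maximally oriented graph can be oriented in both ways. -/
theorem exists_samePattern_of_edge [Finite V] {G E : V → V → Prop} (hG : IsDAG G)
    (hadj : ∀ a b, Adj E a b ↔ Adj G a b) (hdir : ∀ a b, Dir E a b → G a b)
    (hv : ∀ a b c, VStruct G a b c → Dir E a b)
    (hkey : ∀ a b c, Dir E a b → Undir E b c → Dir E a c) {i j : V} (hij : E i j) :
    ∃ H, IsDAG H ∧ SamePattern G H ∧ H i j := by
  classical
  by_cases hji : E j i
  swap
  · exact ⟨G, hG, ⟨fun _ _ => .rfl, fun _ _ _ => .rfl⟩, hdir i j ⟨hij, hji⟩⟩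
  have hcases : ∀ a b, Adj E a b → Dir E a b ∨ Dir E b a ∨ Undir E a b := by
    intro a b h
    simp only [Dir, Undir, Adj] at *
    tauto
  have hUsymm : ∀ a b, Undir E a b → Undir E b a := fun _ _ h => And.symm h
  have hUadj : ∀ a b, Undir E a b → Adj G a b := fun a b h => (hadj a b).1 (.inl h.1)
  -- The collider must be shielded, or its edges would be directed in `E`. If the edge between `x`
  -- and `z` were directed, `hkey` would direct one of the two undirected edges at `y`.
  have hmoral : ∀ x y z, Undir E y x → Undir E y z → G x y → G z y → x ≠ z → Undir E x z := by
    intro x y z h1 h2 h3 h4 h5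
    have h6 : Adj G x z := by
      by_contra h6
      exact (hv x y z ⟨h3, h4, h5, h6⟩).2 h1.1
    rcases hcases x z ((hadj x z).2 h6) with h | h | h
    · exact ((hkey x z y h (hUsymm _ _ h2)).2 h1.1).elim
    · exact ((hkey z x y h (hUsymm _ _ h1)).2 h2.1).elim
    · exact h
  have := Fintype.ofFinite V
  obtain ⟨L₀, hL₀, hmem₀⟩ := hG.exists_perfect hUadj hmoral Finset.univ
  -- Undirected edges will point from later to earlier nodes. With `i` last, `i - j` becomes `i →
  -- j`, and two parents of a node along such edges are later neighbours of it, hence adjacent.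
  obtain ⟨T, hL, hmem⟩ := Perfect.exists_append hUsymm L₀ hL₀ [i] (by simp) (by simp [hmem₀])
    (by simp)
  set L := T ++ [i] with hLdef
  have hmem : ∀ x, x ∈ L := fun x => by simp [hmem, hmem₀]
  let O : V → V → Prop := fun x y => Undir E x y ∧ L.idxOf y < L.idxOf x
  have hO : ∀ x y, Undir E x y → O x y ∨ O y x := by
    intro x y h
    have hne : L.idxOf x ≠ L.idxOf y := fun h' =>
      hG.ne_of_adj (hUadj _ _ h) ((List.idxOf_inj (hmem x)).1 h')
    rcases hne.lt_or_gt with h' | h'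
    · exact .inr ⟨hUsymm _ _ h, h'⟩
    · exact .inl ⟨h, h'⟩
  have hOtrans : ∀ x y, Relation.TransGen O x y → L.idxOf y < L.idxOf x := by
    intro x y h
    induction h with
    | single h => exact h.2
    | tail _ h ih => exact h.2.trans ih
  let H : V → V → Prop := fun x y => Dir E x y ∨ O x y
  have hHadj : ∀ a b, Adj G a b ↔ Adj H a b := by
    intro a b
    rw [← hadj]
    constructor
    · intro h
      rcases hcases a b h with h | h | h
      · exact .inl (.inl h)
      · exact .inr (.inl h)
      · exact (hO a b h).imp .inr .inr
    · rintro ((h | h) | (h | h))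
      · exact .inl h.1
      · exact .inl h.1.1
      · exact .inr h.1
      · exact .inr h.1.1
  have habs : ∀ x y z, Dir E x y → Relation.ReflTransGen O y z → Dir E x z := by
    intro x y z h h'
    induction h' with
    | refl => exact h
    | tail _ h'' ih => exact hkey _ _ _ ih h''.1
  -- On a cycle containing a directed edge, the `O`-steps after the last such edge and those before
  -- the first join into one `O`-path. By `habs` it is absorbed into the last directed edge, leaving
  -- a cycle of `G`.
  have hpath : ∀ x y, Relation.TransGen H x y → Relation.TransGen O x y ∨
      ∃ z, Relation.ReflTransGen O x z ∧ ∃ t u,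
        Relation.ReflTransGen G z t ∧ Dir E t u ∧ Relation.ReflTransGen O u y := by
    intro x y h
    induction h with
    | single h =>
      rcases h with h | h
      · exact .inr ⟨x, .refl, x, _, .refl, h, .refl⟩
      · exact .inl (.single h)
    | @tail b c _ h ih =>
      rcases ih with ih | ⟨z, hxz, t, u, hzt, htu, hub⟩
      · rcases h with h | h
        · exact .inr ⟨b, ih.to_reflTransGen, b, _, .refl, h, .refl⟩
        · exact .inl (ih.tail h)
      · rcases h with h | h
        · exact .inr ⟨z, hxz, b, c, hzt.tail (hdir _ _ (habs _ _ _ htu hub)), h, .refl⟩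
        · exact .inr ⟨z, hxz, t, u, hzt, htu, hub.tail h⟩
  refine ⟨H, fun x hx => ?_, ⟨hHadj, fun a b c => ⟨fun h => ?_, fun h => ?_⟩⟩, .inr ⟨⟨hij, hji⟩, ?_⟩⟩
  · rcases hpath x x hx with h | ⟨z, hxz, t, u, hzt, htu, hux⟩
    · exact lt_irrefl _ (hOtrans x x h)
    · exact hG z (Relation.TransGen.tail' hzt (hdir _ _ (habs _ _ _ htu (hux.trans hxz))))
  · exact ⟨.inl (hv _ _ _ h), .inl (hv _ _ _ h.symm), h.2.2.1, fun h' => h.2.2.2 ((hHadj _ _).2 h')⟩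
  -- A collider with one edge of each kind is shielded by `hkey`, one with two formerly undirected
  -- edges by the perfect ordering. Only colliders with two directed edges can be unshielded.
  · obtain ⟨h1, h2, hne, hnadj⟩ := h
    have hnE : ¬ Adj E a c := fun h' => hnadj ((hHadj _ _).1 ((hadj _ _).1 h'))
    rcases h1 with h1 | h1
    · rcases h2 with h2 | h2
      · exact ⟨hdir _ _ h1, hdir _ _ h2, hne, fun h' => hnE ((hadj _ _).2 h')⟩
      · exact (hnE (.inl (hkey a b c h1 (hUsymm _ _ h2.1)).1)).elim
    · rcases h2 with h2 | h2
      · exact (hnE (.inr (hkey c b a h2 (hUsymm _ _ h1.1)).1)).elim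
      · exact (hnE (.inl (hL.adj_of_idxOf_lt (hmem a) (hmem c) (hUsymm _ _ h1.1) (hUsymm _ _ h2.1)
          hne h1.2 h2.2).1)).elim
  · have hne : j ≠ i := (hG.ne_of_adj (hUadj _ _ ⟨hij, hji⟩)).symm
    have hjT : j ∈ T := by
      have := hmem j
      rw [hLdef] at this
      simpa [hne] using this
    have hiT : i ∉ T := by
      have := hL.nodup
      rw [hLdef] at this
      intro h
      exact (List.nodup_append.1 this).2.2 i h i (by simp) rfl
    rw [hLdef, List.idxOf_append_of_mem hjT, List.idxOf_append_of_notMem hiT]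
    have := List.idxOf_lt_length_iff.2 hjT
    omega

end PerfectElimination

/-! ### Soundness and completeness of the orientation rules -/

section Meek

variable {V : Type*}

/-- The graph in which exactly the edges of unshielded colliders of `G` are directed. -/
def pattern (G : V → V → Prop) : V → V → Prop := fun x y =>
  Adj G x y ∧ ¬ ∃ d, VStruct G y x d

/-- `E` lies between the pattern of `G` and all graphs that are equivalent to `G`. -/
def Sound (G E : V → V → Prop) : Prop :=
  (∀ H, IsDAG H → SamePattern G H → ∀ x y, H x y → E x y) ∧ ∀ x y, E x y → pattern G x y

theorem SamePattern.refl (G : V → V → Prop) : SamePattern G G :=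
  ⟨fun _ _ => .rfl, fun _ _ _ => .rfl⟩

theorem sound_pattern (G : V → V → Prop) : Sound G (pattern G) :=
  ⟨fun _ hH h x y hxy => ⟨(h.1 x y).2 (.inl hxy), fun ⟨d, hd⟩ =>
    hH.asymm hxy ((h.2 y x d).1 hd).1⟩, fun _ _ h => h⟩

theorem Sound.adj_iff {G E : V → V → Prop} (hG : IsDAG G) (h : Sound G E) {a b : V} :
    Adj E a b ↔ Adj G a b := by
  constructor
  · rintro (h' | h')
    · exact (h.2 _ _ h').1
    · exact (h.2 _ _ h').1.symm
  · exact fun h' => h'.imp (h.1 G hG (.refl G) _ _) (h.1 G hG (.refl G) _ _)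

theorem Sound.of_dir {G E H : V → V → Prop} (hG : IsDAG G) (h : Sound G E) (hH : IsDAG H)
    (hGH : SamePattern G H) {a b : V} (hab : Dir E a b) : H a b :=
  ((hGH.1 a b).1 ((h.adj_iff hG).1 (.inl hab.1))).resolve_right fun h' => hab.2 (h.1 H hH hGH _ _ h')

theorem Sound.dir_of_vStruct {G E : V → V → Prop} (hG : IsDAG G) (h : Sound G E) {a b c : V}
    (hv : VStruct G a b c) : Dir E a b :=
  ⟨h.1 G hG (.refl G) _ _ hv.1, fun h' => (h.2 _ _ h').2 ⟨c, hv⟩⟩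

/-- An equivalent DAG with `j → i` would have a directed cycle, or an unshielded collider on an edge
that is undirected in `E`, whereas `E` directs all of those. -/
theorem Sound.meekRule {G E H : V → V → Prop} (hG : IsDAG G) (h : Sound G E) (hH : IsDAG H)
    (hGH : SamePattern G H) {i j : V} (hij : Undir E i j) (hr : MeekRule E i j) : ¬ H j i := by
  intro hji
  have hdir : ∀ {a b}, Dir E a b → H a b := fun hab => h.of_dir hG hH hGH hab
  have hadj : ∀ a b, Adj E a b ↔ Adj H a b := fun a b => (h.adj_iff hG).trans (hGH.1 a b)
  have hv : ∀ {a b c}, VStruct H a b c → ¬ E b a := fun hv =>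
    (h.dir_of_vStruct hG ((hGH.2 _ _ _).2 hv)).2
  rcases hr with ⟨a, hai, haj⟩ | ⟨c, hic, hcj⟩ | ⟨c, d, hcd, hncd, hic, hcj, hid, hdj⟩ |
    ⟨c, d, hncj, hic, hcd, hdj⟩
  · have hne : a ≠ j := by rintro rfl; exact hai.2 hij.1
    exact hv (VStruct.symm ⟨hdir hai, hji, hne, fun h' => haj ((hadj _ _).2 h')⟩) hij.1
  · exact hH.no_triangle (hdir hic) (hdir hcj) hji
  · have hci : ∀ {x}, Undir E i x → Dir E x j → H x i := fun {x} hix hxj =>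
      ((hadj x i).1 (.inl hix.2)).resolve_right fun h' => hH.no_triangle h' (hdir hxj) hji
    exact hv ⟨hci hic hcj, hci hid hdj, hcd, fun h' => hncd ((hadj _ _).2 h')⟩ hic.1
  · have hcne : c ≠ j := by rintro rfl; exact hcd.2 hdj.1
    rcases (hadj i c).1 (.inl hic.1) with h' | h'
    · exact hH i (.tail (.tail (.tail (.single h') (hdir hcd)) (hdir hdj)) hji)
    · exact hv ⟨h', hji, hcne, fun h'' => hncj ((hadj _ _).2 h'')⟩ hic.1

theorem Sound.meekStep {G E E' : V → V → Prop} (hG : IsDAG G) (h : Sound G E)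
    (hs : MeekStep E E') : Sound G E' := by
  obtain ⟨i, j, hij, hr, rfl⟩ := hs
  refine ⟨fun H hH hGH x y hxy => ⟨h.1 H hH hGH x y hxy, ?_⟩, fun x y hxy => h.2 x y hxy.1⟩
  rintro ⟨rfl, rfl⟩
  exact h.meekRule hG hH hGH hij hr hxy

theorem Sound.meekSteps {G E E' : V → V → Prop} (hG : IsDAG G) (h : Sound G E)
    (hs : Relation.ReflTransGen MeekStep E E') : Sound G E' := by
  induction hs with
  | refl => exact h
  | tail _ hs ih => exact ih.meekStep hG hs

theorem meekSteps_subset {E E' : V → V → Prop} (hs : Relation.ReflTransGen MeekStep E E') {x y : V}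
    (h : E' x y) : E x y := by
  induction hs with
  | refl => exact h
  | tail _ hs ih =>
    obtain ⟨i, j, -, -, rfl⟩ := hs
    exact ih h.1

/-! ### Graphs to which no orientation rule applies -/

section Closed

variable {E : V → V → Prop}

/-- Rule 1 would orient `b → c` if `a`, `c` were non-adjacent, and rule 2 would orient `c → b` if `c
→ a`. -/
theorem dir_or_undir (hcl : ∀ i j, Undir E i j → ¬ MeekRule E i j) {a b c : V} (hab : Dir E a b)
    (hbc : Undir E b c) : Dir E a c ∨ Undir E a c := by
  have hadj : Adj E a c := by
    by_contra h
    exact hcl b c hbc (.inl ⟨a, hab, h⟩)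
  by_cases h1 : E a c
  · by_cases h2 : E c a
    · exact .inr ⟨h1, h2⟩
    · exact .inl ⟨h1, h2⟩
  · exact (hcl c b hbc.symm (.inr (.inl ⟨a, ⟨hadj.resolve_left h1, h1⟩, hab⟩))).elim

/-- Suppose `a - c`. If `d → c`, rule 1 orients `c → a`; if `d - c`, rule 3 orients `c → b`. -/
theorem dir_of_collider (hcl : ∀ i j, Undir E i j → ¬ MeekRule E i j) {a b c d : V}
    (hab : Dir E a b) (hdb : Dir E d b) (hne : a ≠ d) (hnadj : ¬ Adj E a d) (hbc : Undir E b c) :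
    Dir E a c := by
  refine (dir_or_undir hcl hab hbc).resolve_right fun hac => ?_
  rcases dir_or_undir hcl hdb hbc with h | h
  · exact hcl c a hac.symm (.inl ⟨d, h, fun h' => hnadj h'.symm⟩)
  · exact hcl c b hbc.symm (.inr (.inr (.inl ⟨a, d, hne, hnadj, hac.symm, hab, h.symm, hdb⟩)))

/-- This is the induction step for the edge just directed. The premises of its rule were directed
earlier, so `ih` carries their arrows over to `c`. If `i - c` remained, some rule would still apply
in the final graph `E`. -/
theorem dir_of_meekRule {G E' : V → V → Prop} (hG : IsDAG G) (hE : Sound G E) (hE' : Sound G E')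
    (hsub : ∀ x y, E x y → E' x y) (hcl : ∀ i j, Undir E i j → ¬ MeekRule E i j)
    (ih : ∀ a b c, Dir E' a b → Undir E b c → Dir E a c) {i j c : V} (hij : Dir E i j)
    (hr : MeekRule E' i j) (hjc : Undir E j c) : Dir E i c := by
  have hadj : ∀ a b, Adj E' a b ↔ Adj E a b := fun a b =>
    (hE'.adj_iff hG).trans (hE.adj_iff hG).symm
  have hdir : ∀ {a b}, Dir E' a b → Dir E a b := fun {a b} h =>
    ⟨((hadj a b).1 (.inl h.1)).resolve_right fun h' => h.2 (hsub _ _ h'), fun h' =>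
      h.2 (hsub _ _ h')⟩
  have hGdir : ∀ {a b}, Dir E a b → G a b := fun h => hE.of_dir hG hG (.refl G) h
  have htri : ∀ {a b}, Adj E a b → Dir E a b ∨ Dir E b a ∨ Undir E a b := by
    intro a b h
    simp only [Dir, Undir, Adj] at *
    tauto
  refine (dir_or_undir hcl hij hjc).resolve_right fun hic => ?_
  rcases hr with ⟨a, hai, haj⟩ | ⟨d, hid, hdj⟩ | ⟨p, q, hpq, hnpq, hip, hpj, hiq, hqj⟩ |
    ⟨p, q, hnpj, hip, hpq, hqj⟩
  · exact hcl c j hjc.symm (.inl ⟨a, ih _ _ _ hai hic, fun h => haj ((hadj _ _).2 h)⟩)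
  · exact hcl i c hic (.inr (.inl ⟨d, hdir hid, ih _ _ _ hdj hjc⟩))
  · have hpc := ih _ _ _ hpj hjc
    have hqc := ih _ _ _ hqj hjc
    have hn : ¬ Adj E p q := fun h => hnpq ((hadj _ _).2 h)
    -- The edges at `i` were undirected in `E'` but may have been directed since, so their final
    -- status has to be distinguished.
    rcases htri ((hadj _ _).1 (.inl hip.1)) with h1 | h1 | h1
    · exact hcl i c hic (.inr (.inl ⟨p, h1, hpc⟩))
    · rcases htri ((hadj _ _).1 (.inl hiq.1)) with h2 | h2 | h2
      · exact hcl i c hic (.inr (.inl ⟨q, h2, hqc⟩))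
      · have hv : VStruct G p i q := ⟨hGdir h1, hGdir h2, hpq, fun h => hn ((hE.adj_iff hG).2 h)⟩
        exact (hE'.dir_of_vStruct hG hv).2 hip.1
      · exact hcl i q h2 (.inl ⟨p, h1, hn⟩)
    · rcases htri ((hadj _ _).1 (.inl hiq.1)) with h2 | h2 | h2
      · exact hcl i c hic (.inr (.inl ⟨q, h2, hqc⟩))
      · exact hcl i p h1 (.inl ⟨q, h2, fun h => hn h.symm⟩)
      · exact hcl i c hic (.inr (.inr (.inl ⟨p, q, hpq, hn, h1, hpc, h2, hqc⟩)))
  · have hqc := ih _ _ _ hqj hjc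
    have hpq := hdir hpq
    have hqj := hdir hqj
    have hn : ¬ Adj E p j := fun h => hnpj ((hadj _ _).2 h)
    by_cases hpc : Adj E p c
    · rcases htri hpc with h1 | h1 | h1
      · exact hcl c j hjc.symm (.inl ⟨p, h1, hn⟩)
      · exact hG.no_triangle (hGdir h1) (hGdir hpq) (hGdir hqc)
      · exact hcl c j hjc.symm (.inr (.inr (.inr ⟨p, q, hn, h1.symm, hpq, hqj⟩)))
    · rcases htri ((hadj _ _).1 (.inl hip.1)) with h1 | h1 | h1
      · by_cases hiq : Adj E i q
        · rcases htri hiq with h2 | h2 | h2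
          · exact hcl i c hic (.inr (.inl ⟨q, h2, hqc⟩))
          · exact hG.no_triangle (hGdir h1) (hGdir hpq) (hGdir h2)
          · exact hcl i q h2 (.inr (.inl ⟨p, h1, hpq⟩))
        · have hne : i ≠ q := by rintro rfl; exact hG.asymm (hGdir h1) (hGdir hpq)
          exact (dir_of_collider hcl hij hqj hne hiq hjc).2 hic.2
      · exact hcl i c hic (.inl ⟨p, h1, hpc⟩)
      · exact hcl i c hic (.inr (.inr (.inr ⟨p, q, hpc, h1, hpq, hqc⟩)))

/-- In a maximally oriented graph, `a → b - c` implies `a → c`. -/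
theorem dir_of_dir_of_undir {G E' : V → V → Prop} (hG : IsDAG G)
    (hcl : ∀ i j, Undir E i j → ¬ MeekRule E i j)
    (h1 : Relation.ReflTransGen MeekStep (pattern G) E') (h2 : Relation.ReflTransGen MeekStep E' E)
    (a b c : V) (hab : Dir E' a b) (hbc : Undir E b c) : Dir E a c := by
  -- Induction on the order in which edges became directed: `E'` grows out of the pattern, while `b
  -- - c` always refers to the fixed final graph `E`.
  induction h1 generalizing a b c with
  | refl =>
    have hE := (sound_pattern G).meekSteps hG h2
    obtain ⟨d, hd⟩ : ∃ d, VStruct G a b d := by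
      by_contra h
      exact hab.2 ⟨hab.1.1.symm, h⟩
    exact dir_of_collider hcl (hE.dir_of_vStruct hG hd) (hE.dir_of_vStruct hG hd.symm) hd.2.2.1
      (fun h => hd.2.2.2 ((hE.adj_iff hG).1 h)) hbc
  | tail h1 hs ih =>
    have hE' := (sound_pattern G).meekSteps hG h1
    have hE := (hE'.meekStep hG hs).meekSteps hG h2
    have ih := fun a b c => ih (.head hs h2) a b c
    have hsub := fun x y (h : E x y) => meekSteps_subset (.head hs h2) h
    have hsub' := fun x y (h : E x y) => meekSteps_subset h2 h
    have hsound := hE'.meekStep hG hs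
    obtain ⟨i, j, hij, hr, rfl⟩ := hs
    by_cases h : a = i ∧ b = j
    · obtain ⟨rfl, rfl⟩ := h
      refine dir_of_meekRule hG hE hE' hsub hcl ih ⟨?_, fun h => (hsub' _ _ h).2 ⟨rfl, rfl⟩⟩ hr hbc
      exact ((hE.adj_iff hG).2 ((hsound.adj_iff hG).1 (.inl hab.1))).resolve_right
        fun h => (hsub' _ _ h).2 ⟨rfl, rfl⟩
    · exact ih a b c ⟨hab.1.1, fun h' => hab.2 ⟨h', fun h'' => h ⟨h''.2, h''.1⟩⟩⟩ hbc

end Closed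

theorem meekClosure_iff [Finite V] {G E : V → V → Prop} (hG : IsDAG G)
    (hs : Relation.ReflTransGen MeekStep (pattern G) E) (hcl : ∀ E', ¬ MeekStep E E') {v w : V} :
    E v w ↔ ∃ H, IsDAG H ∧ SamePattern G H ∧ H v w := by
  have hE := (sound_pattern G).meekSteps hG hs
  have hcl' : ∀ i j, Undir E i j → ¬ MeekRule E i j := fun i j hij hr => hcl _ ⟨i, j, hij, hr, rfl⟩
  exact ⟨exists_samePattern_of_edge hG (fun _ _ => hE.adj_iff hG)
    (fun _ _ => hE.of_dir hG hG (.refl G)) (fun _ _ _ => hE.dir_of_vStruct hG)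
    (dir_of_dir_of_undir hG hcl' hs .refl), fun ⟨H, hH, hGH, h⟩ => hE.1 H hH hGH v w h⟩

/-- Termination by a natural-number measure, for both edge deletion and edge orientation. -/
theorem exists_terminal {α : Type*} (r : α → α → Prop) (m : α → ℕ) (h : ∀ a b, r a b → m b < m a)
    (a : α) : ∃ b, Relation.ReflTransGen r a b ∧ ∀ c, ¬ r b c := by
  induction hn : m a using Nat.strong_induction_on generalizing a with
  | _ n ih =>
    by_cases hc : ∃ c, r a c
    · obtain ⟨c, hc⟩ := hc
      obtain ⟨b, hb, hb'⟩ := ih _ (hn ▸ h a c hc) c rfl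
      exact ⟨b, .head hc hb, hb'⟩
    · exact ⟨a, .refl, fun c hc' => hc ⟨c, hc'⟩⟩

/-- The number of edges. -/
def edgeCount (E : V → V → Prop) : ℕ := {e : V × V | E e.1 e.2}.ncard

theorem edgeCount_lt [Finite V] {E E' : V → V → Prop} (h : ∀ x y, E' x y → E x y) {i j : V}
    (hE : E i j) (hE' : ¬ E' i j) : edgeCount E' < edgeCount E :=
  Set.ncard_lt_ncard ⟨fun _ he => h _ _ he, fun h' => hE' (h' (a := (i, j)) hE)⟩ (Set.toFinite _)

theorem exists_meekClosure [Finite V] (E₀ : V → V → Prop) :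
    ∃ E, Relation.ReflTransGen MeekStep E₀ E ∧ ∀ E', ¬ MeekStep E E' := by
  refine exists_terminal MeekStep edgeCount ?_ E₀
  rintro E _ ⟨i, j, hij, -, rfl⟩
  exact edgeCount_lt (fun x y h => h.1) hij.2 (fun h => h.2 ⟨rfl, rfl⟩)

end Meek

/-! ### The skeleton phase -/

section SkeletonPhase

variable {V : Type*}

/-- The skeleton phase never deletes an edge of `G` and saves separating sets. -/
def SkelInvariant (G : V → V → Prop) (s : SkelState V) : Prop :=
  (∀ a b, Adj G a b → s.adj a b) ∧ (∀ a b, s.adj a b → s.adj b a ∧ a ≠ b) ∧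
    ∀ a b, a ≠ b → ¬ s.adj a b → ¬ DConnected G (s.sep a b) a b

/-- The test answers are the d-separations of `G`. -/
def Oracle (G : V → V → Prop) (ci : V → V → Finset V → Prop) : Prop :=
  ∀ i j k, i ≠ j → i ∉ k → j ∉ k → (ci i j k ↔ ¬ DConnected G k i j)

variable {G : V → V → Prop}

theorem skelInvariant_initState (hG : IsDAG G) : SkelInvariant G (initState : SkelState V) :=
  ⟨fun _ _ h => hG.ne_of_adj h, fun _ _ h => ⟨h.symm, h⟩, fun _ _ h h' => (h' h).elim⟩

variable [DecidableEq V] {ci : V → V → Finset V → Prop}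

theorem SkelInvariant.deleteStep (hG : IsDAG G) (hci : Oracle G ci) {ℓ : ℕ} {s s' : SkelState V}
    (h : SkelInvariant G s) (hs : DeleteStep ci ℓ s s') : SkelInvariant G s' := by
  obtain ⟨i, j, k, hij, hk, -, hijk, rfl⟩ := hs
  have hsep : ¬ DConnected G k i j := (hci i j k (h.2.1 i j hij).2
    (fun h' => (h.2.1 _ _ (hk i h').1).2 rfl) (fun h' => (hk j h').2 rfl)).1 hijk
  refine ⟨fun a b hab => ⟨h.1 a b hab, ?_⟩, fun a b hab => ⟨⟨(h.2.1 a b hab.1).1, ?_⟩,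
    (h.2.1 a b hab.1).2⟩, fun a b hne hab => ?_⟩
  · rintro (⟨rfl, rfl⟩ | ⟨rfl, rfl⟩)
    · exact hsep (hG.dConnected_of_adj hab k)
    · exact hsep (hG.dConnected_of_adj hab.symm k)
  · have := hab.2
    tauto
  · by_cases hc : (a = i ∧ b = j) ∨ (a = j ∧ b = i)
    · simp only [SkelState.delete, if_pos hc]
      rcases hc with ⟨rfl, rfl⟩ | ⟨rfl, rfl⟩
      · exact hsep
      · exact fun h' => hsep h'.symm
    · simp only [SkelState.delete, if_neg hc]
      exact h.2.2 a b hne fun h' => hab ⟨h', hc⟩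

theorem deleteSteps_subset {ℓ : ℕ} {s s' : SkelState V}
    (hs : Relation.ReflTransGen (DeleteStep ci ℓ) s s') {a b : V} (h : s'.adj a b) : s.adj a b := by
  induction hs with
  | refl => exact h
  | tail _ hs ih =>
    obtain ⟨i, j, k, -, -, -, -, rfl⟩ := hs
    exact ih h.1

theorem SkelInvariant.deleteSteps (hG : IsDAG G) (hci : Oracle G ci) {ℓ : ℕ} {s s' : SkelState V}
    (h : SkelInvariant G s) (hs : Relation.ReflTransGen (DeleteStep ci ℓ) s s') :
    SkelInvariant G s' := by
  induction hs with
  | refl => exact h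
  | tail _ hs ih => exact ih.deleteStep hG hci hs

/-- Adjacency sets only shrink, so a conditioning set still admissible now was admissible at its own
level and was rejected there. Hence the conclusion covers all sizes up to `ℓ`. -/
theorem AfterLevel.skelInvariant (hG : IsDAG G) (hci : Oracle G ci) {ℓ : ℕ} {s : SkelState V}
    (h : AfterLevel ci ℓ s) : SkelInvariant G s ∧
      ∀ i j k, s.adj i j → (∀ x ∈ k, s.adj i x ∧ x ≠ j) → k.card ≤ ℓ → ¬ ci i j k := by
  induction h with
  | zero h =>
    exact ⟨(skelInvariant_initState hG).deleteSteps hG hci h.1, fun i j k hij hk hc hijk =>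
      h.2 _ ⟨i, j, k, hij, hk, Nat.le_zero.1 hc, hijk, rfl⟩⟩
  | succ _ _ h ih =>
    refine ⟨ih.1.deleteSteps hG hci h.1, fun i j k hij hk hc hijk => ?_⟩
    rcases hc.lt_or_eq with hc | hc
    · exact ih.2 i j k (deleteSteps_subset h.1 hij) (fun x hx =>
        ⟨deleteSteps_subset h.1 (hk x hx).1, (hk x hx).2⟩) (by omega) hijk
    · exact h.2 _ ⟨i, j, k, hij, hk, hc, hijk, rfl⟩

/-- A superfluous edge `a - b` is impossible: the parents of one end separate it from the other,
they lie in its current adjacency set, and the stopping criterion bounds their number by `ℓ`, so the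
test with them has been made. -/
theorem IsSkeletonOutput.correct [Finite V] (hG : IsDAG G) (hci : Oracle G ci) {s : SkelState V}
    (h : IsSkeletonOutput ci s) : (∀ a b, s.adj a b ↔ Adj G a b) ∧
      ∀ a b, a ≠ b → ¬ Adj G a b → ¬ DConnected G (s.sep a b) a b := by
  obtain ⟨ℓ, hℓ, hlast⟩ := h
  obtain ⟨hinv, htested⟩ := hℓ.skelInvariant hG hci
  have key : ∀ a b, s.adj a b → ¬ Adj G a b →
      ¬ ∀ C : Finset V, (∀ x, x ∈ C ↔ G x a) → ¬ DConnected G C a b := by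
    intro a b hab hn hsep
    set C := (Set.toFinite {x | G x a}).toFinset with hC
    have hmem : ∀ x, x ∈ C ↔ G x a := fun x => by simp [hC]
    have hsub : ∀ x ∈ C, s.adj a x ∧ x ≠ b := fun x hx =>
      ⟨hinv.1 _ _ (.inr ((hmem x).1 hx)), fun h => hn (.inr (h ▸ (hmem x).1 hx))⟩
    refine htested a b C hab hsub ?_ ((hci a b C (hinv.2.1 a b hab).2 ?_ ?_).2 (hsep C hmem))
    · rw [← Set.ncard_coe_finset]
      exact (Set.ncard_le_ncard (fun x hx => hsub x hx) (Set.toFinite _)).trans (hlast a b hab)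
    · exact fun h => hG.irrefl a ((hmem a).1 h)
    · exact fun h => (hsub b h).2 rfl
  have hadj : ∀ a b, s.adj a b ↔ Adj G a b := by
    refine fun a b => ⟨fun hab => ?_, hinv.1 a b⟩
    by_contra hn
    rcases hG.parents_separate (hinv.2.1 a b hab).2 hn with h | h
    · exact key a b hab hn h
    · exact key b a (hinv.2.1 a b hab).1 (fun h' => hn h'.symm) h
  exact ⟨hadj, fun a b hne hn => hinv.2.2 a b hne fun h => hn ((hadj a b).1 h)⟩

theorem exists_levelRun [Finite V] (ci : V → V → Finset V → Prop) (ℓ : ℕ) (s : SkelState V) :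
    ∃ s', LevelRun ci ℓ s s' := by
  refine exists_terminal (DeleteStep ci ℓ) (fun s => edgeCount s.adj) ?_ s
  rintro s _ ⟨i, j, k, hij, -, -, -, rfl⟩
  exact edgeCount_lt (fun x y h => h.1) hij (fun h => h.2 (.inl ⟨rfl, rfl⟩))

theorem exists_isSkeletonOutput [Finite V] (ci : V → V → Finset V → Prop) :
    ∃ s, IsSkeletonOutput ci s := by
  by_contra hcon
  have key : ∀ ℓ, ∃ s, AfterLevel ci ℓ s := by
    intro ℓ
    induction ℓ with
    | zero => exact (exists_levelRun ci 0 initState).imp fun s h => .zero h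
    | succ ℓ ih =>
      obtain ⟨s, hs⟩ := ih
      exact (exists_levelRun ci (ℓ + 1) s).imp fun s' h => .succ hs (fun h' => hcon ⟨s, ℓ, hs, h'⟩) h
  -- At level `|V|` the stopping criterion holds for reasons of size.
  obtain ⟨s, hs⟩ := key (Nat.card V)
  exact hcon ⟨s, _, hs, fun i j _ => Set.ncard_le_card _⟩

end SkeletonPhase

/-! ### The orientation of colliders -/

section ColliderPhase

variable {V : Type*} {G : V → V → Prop}

/-- Genuine unshielded colliders never demand opposite directions of an edge. So each orientation
only removes reversed edges, never adds one, and the order does not matter. -/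
theorem foldl_orientCollider (hG : IsDAG G) (l : List (V × V × V))
    (hl : ∀ t ∈ l, VStruct G t.1 t.2.1 t.2.2) (E : V → V → Prop) (hE : ∀ x y, G x y → E x y)
    (x y : V) : l.foldl orientCollider E x y ↔
      E x y ∧ ¬ ∃ t ∈ l, x = t.2.1 ∧ (y = t.1 ∨ y = t.2.2) := by
  induction l generalizing E with
  | nil => simp
  | cons t l ih =>
    have ht := hl t (by simp)
    have h1 : ∀ x y, orientCollider E t x y ↔ E x y ∧ ¬ (x = t.2.1 ∧ (y = t.1 ∨ y = t.2.2)) := by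
      intro x y
      constructor
      · rintro (⟨h, rfl⟩ | h)
        · have hx : G x t.2.1 := by
            rcases h with rfl | rfl
            · exact ht.1
            · exact ht.2.1
          exact ⟨hE _ _ hx, fun h' => hG.irrefl x (by nth_rw 2 [h'.1]; exact hx)⟩
        · exact h
      · exact .inr
    have h2 : ∀ x y, G x y → orientCollider E t x y := by
      refine fun x y hxy => (h1 x y).2 ⟨hE x y hxy, ?_⟩
      rintro ⟨rfl, rfl | rfl⟩
      · exact hG.asymm hxy ht.1
      · exact hG.asymm hxy ht.2.1
    rw [List.foldl_cons, ih (fun t' ht' => hl t' (by simp [ht'])) _ h2, h1]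
    simp only [List.mem_cons, exists_eq_or_imp, not_or, and_assoc]

variable {s : SkelState V}

theorem isColliderTriple_iff (hG : IsDAG G) (hadj : ∀ a b, s.adj a b ↔ Adj G a b)
    (hsep : ∀ a b, a ≠ b → ¬ Adj G a b → ¬ DConnected G (s.sep a b) a b) (t : V × V × V) :
    IsColliderTriple s t ↔ VStruct G t.1 t.2.1 t.2.2 := by
  simp only [IsColliderTriple, hadj]
  constructor
  · rintro ⟨h1, h2, h3, h4, h5⟩
    have h6 := hG.mem_iff_not_collider h1 h3 h4 (hsep _ _ h1 h2)
    have h7 : G t.1 t.2.1 ∧ G t.2.2 t.2.1 := by tauto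
    exact ⟨h7.1, h7.2, h1, h2⟩
  · rintro ⟨h1, h2, h3, h4⟩
    have h6 := hG.mem_iff_not_collider h3 (.inl h1) (.inl h2) (hsep _ _ h3 h4)
    exact ⟨h3, h4, .inl h1, .inl h2, by tauto⟩

theorem IsColliderOutput.eq_pattern (hG : IsDAG G) (hadj : ∀ a b, s.adj a b ↔ Adj G a b)
    (hsep : ∀ a b, a ≠ b → ¬ Adj G a b → ¬ DConnected G (s.sep a b) a b) {E : V → V → Prop}
    (h : IsColliderOutput s E) : E = pattern G := by
  obtain ⟨l, hl, rfl⟩ := h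
  have hl' : ∀ t, t ∈ l ↔ VStruct G t.1 t.2.1 t.2.2 := fun t =>
    (hl t).trans (isColliderTriple_iff hG hadj hsep t)
  ext x y
  rw [foldl_orientCollider hG l (fun t => (hl' t).1) _ (fun x y h => (hadj x y).2 (.inl h)), hadj]
  refine and_congr_right fun _ => not_congr ⟨?_, ?_⟩
  · rintro ⟨t, ht, rfl, rfl | rfl⟩
    · exact ⟨_, (hl' t).1 ht⟩
    · exact ⟨_, ((hl' t).1 ht).symm⟩
  · rintro ⟨d, hd⟩
    exact ⟨(y, x, d), (hl' _).2 hd, rfl, .inl rfl⟩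

theorem exists_isColliderOutput [Finite V] (s : SkelState V) : ∃ E, IsColliderOutput s E :=
  ⟨_, (Set.toFinite {t | IsColliderTriple s t}).toFinset.toList, fun t => by simp, rfl⟩

end ColliderPhase

/-- With the d-separations of `G` as test answers, the PC algorithm has the CPDAG of `G` as its only
output. -/
theorem isPCOutput_iff {V : Type*} [Fintype V] [DecidableEq V] {G : V → V → Prop} (hG : IsDAG G)
    {P : Measure (V → ℝ)} [IsProbabilityMeasure P] (hP : Faithful P G)
    {ci : V → V → Finset V → Prop} (hci : Oracle G ci) (E : V → V → Prop) :
    IsPCOutput ci E ↔ E = cpdag G := by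
  have key : ∀ E, IsPCOutput ci E → E = cpdag G := by
    rintro E ⟨s, E₀, hs, hE₀, hE, hcl⟩
    obtain ⟨hadj, hsep⟩ := hs.correct hG hci
    obtain rfl := hE₀.eq_pattern hG hadj hsep
    ext v w
    rw [meekClosure_iff hG hE hcl, cpdag_iff hG hP]
  refine ⟨key E, ?_⟩
  rintro rfl
  obtain ⟨s, hs⟩ := exists_isSkeletonOutput ci
  obtain ⟨E₀, hE₀⟩ := exists_isColliderOutput s
  obtain ⟨E, hE, hcl⟩ := exists_meekClosure E₀
  have h : IsPCOutput ci E := ⟨s, E₀, hs, hE₀, hE, hcl⟩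
  rwa [← key E h]

/-! ### A weak law of large numbers under decaying dependence -/

section LawOfLargeNumbers

variable {Ω S : Type*} [MeasurableSpace Ω] [MeasurableSpace S] {μ : Measure Ω}

/-- The mean distance of the averages of `h (Z t)` to the expectation of `h`. -/
def avgError (μ : Measure Ω) (Z : ℕ → Ω → S) (h : S → ℝ) (m : ℕ) : ℝ :=
  ∫ ω, |(∑ t ∈ Finset.range m, h (Z t ω)) / m - ∫ x, h x ∂(μ.map (Z 0))| ∂μ

theorem avgError_nonneg {Z : ℕ → Ω → S} {h : S → ℝ} {m : ℕ} : 0 ≤ avgError μ Z h m :=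
  integral_nonneg fun _ => abs_nonneg _

theorem avgError_const_mul (Z : ℕ → Ω → S) (c : ℝ) (h : S → ℝ) (m : ℕ) :
    avgError μ Z (fun x => c * h x) m = |c| * avgError μ Z h m := by
  rw [avgError, avgError, ← integral_const_mul]
  congr 1 with ω
  rw [← abs_mul, integral_const_mul, ← Finset.mul_sum]
  congr 1
  ring

theorem integrable_comp_law {Z : ℕ → Ω → S} (hZ : ∀ t, Measurable (Z t))
    (hlaw : ∀ t, μ.map (Z t) = μ.map (Z 0)) {h : S → ℝ} (hh : Integrable h (μ.map (Z 0))) (t : ℕ) :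
    Integrable (fun ω => h (Z t ω)) μ :=
  Integrable.comp_measurable (hlaw t ▸ hh) (hZ t)

theorem integral_comp_law {Z : ℕ → Ω → S} (hZ : ∀ t, Measurable (Z t))
    (hlaw : ∀ t, μ.map (Z t) = μ.map (Z 0)) {h : S → ℝ} (hh : Integrable h (μ.map (Z 0))) (t : ℕ) :
    ∫ ω, h (Z t ω) ∂μ = ∫ x, h x ∂(μ.map (Z 0)) := by
  rw [← hlaw t, integral_map (hZ t).aemeasurable]
  rw [hlaw t]
  exact hh.aestronglyMeasurable

variable [IsProbabilityMeasure μ]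

theorem covariance_sq_le {U W : Ω → ℝ} (hU : MemLp U 2 μ) (hW : MemLp W 2 μ) :
    covariance U W μ ^ 2 ≤ variance U μ * variance W μ := by
  have h : ∀ t : ℝ, 0 ≤ variance W μ * (t * t) + 2 * covariance U W μ * t + variance U μ := by
    intro t
    have h1 := variance_nonneg (U + t • W) μ
    rw [variance_add hU (hW.const_smul t), variance_smul, covariance_smul_right] at h1
    linarith
  have := discrim_le_zero h
  rw [discrim] at this
  nlinarith

theorem abs_covariance_le {U W : Ω → ℝ} (hU : MemLp U 2 μ) (hW : MemLp W 2 μ) :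
    |covariance U W μ| ≤ √(variance U μ) * √(variance W μ) := by
  rw [← Real.sqrt_mul (variance_nonneg U μ)]
  exact Real.abs_le_sqrt (covariance_sq_le hU hW)

theorem covariance_indicator {A B : Set Ω} (hA : MeasurableSet A) (hB : MeasurableSet B) :
    covariance (A.indicator 1) (B.indicator 1) μ =
      μ.real (A ∩ B) - μ.real A * μ.real B := by
  have h : ∀ {A : Set Ω}, MeasurableSet A → MemLp (A.indicator (1 : Ω → ℝ)) 2 μ := fun hA =>
    memLp_indicator_const 2 hA (1 : ℝ) (.inr (measure_ne_top _ _))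
  rw [covariance_eq_sub (h hA) (h hB), ← Set.inter_indicator_one, integral_indicator_one hA,
    integral_indicator_one hB, integral_indicator_one (hA.inter hB)]

theorem integral_abs_le_sqrt {f : Ω → ℝ} (hf : MemLp f 2 μ) :
    ∫ ω, |f ω| ∂μ ≤ √(∫ ω, f ω ^ 2 ∂μ) := by
  refine Real.le_sqrt_of_sq_le ?_
  have h := variance_nonneg (fun ω => |f ω|) μ
  rw [variance_eq_sub (X := fun ω => |f ω|) hf.abs] at h
  simpa using h

variable {Z : ℕ → Ω → S} (hZ : ∀ t, Measurable (Z t)) (hlaw : ∀ t, μ.map (Z t) = μ.map (Z 0))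

include hZ hlaw

theorem integrable_avg {h : S → ℝ} (hh : Integrable h (μ.map (Z 0))) (m : ℕ) :
    Integrable (fun ω => (∑ t ∈ Finset.range m, h (Z t ω)) / m - ∫ x, h x ∂(μ.map (Z 0))) μ :=
  ((integrable_finsetSum _ fun t _ => integrable_comp_law hZ hlaw hh t).div_const _).sub
    (integrable_const _)

theorem avgError_add {f g : S → ℝ} (hf : Integrable f (μ.map (Z 0)))
    (hg : Integrable g (μ.map (Z 0))) (m : ℕ) :
    avgError μ Z (f + g) m ≤ avgError μ Z f m + avgError μ Z g m := by
  rw [avgError, avgError, avgError, ← integral_add (integrable_avg hZ hlaw hf m).abs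
    (integrable_avg hZ hlaw hg m).abs]
  refine integral_mono (integrable_avg hZ hlaw (hf.add hg) m).abs
    ((integrable_avg hZ hlaw hf m).abs.add (integrable_avg hZ hlaw hg m).abs) fun ω => ?_
  have h1 : ∫ x, (f + g) x ∂(μ.map (Z 0)) = ∫ x, f x ∂(μ.map (Z 0)) + ∫ x, g x ∂(μ.map (Z 0)) :=
    integral_add hf hg
  simp only [h1]
  refine le_trans (le_of_eq ?_) (abs_add_le _ _)
  congr 1
  simp only [Pi.add_apply, Finset.sum_add_distrib]
  ring

/-- The bound is uniform in `m`, as the `Z t` have the same law; this is what allows approximation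
in `L¹`. -/
theorem avgError_le_integral {h : S → ℝ} (hh : Integrable h (μ.map (Z 0))) (m : ℕ) :
    avgError μ Z h m ≤ 2 * ∫ x, |h x| ∂(μ.map (Z 0)) := by
  have hI : |∫ x, h x ∂(μ.map (Z 0))| ≤ ∫ x, |h x| ∂(μ.map (Z 0)) := abs_integral_le_integral_abs
  have hint : ∀ t, Integrable (fun ω => |h (Z t ω)|) μ := fun t =>
    (integrable_comp_law hZ hlaw hh t).abs
  have hsum := integrable_finsetSum (Finset.range m) fun t _ => hint t
  calc avgError μ Z h m
      ≤ ∫ ω, ((∑ t ∈ Finset.range m, |h (Z t ω)|) / m + ∫ x, |h x| ∂(μ.map (Z 0))) ∂μ := by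
        refine integral_mono (integrable_avg hZ hlaw hh m).abs
          ((hsum.div_const _).add (integrable_const _)) fun ω => ?_
        refine (abs_sub _ _).trans (add_le_add ?_ hI)
        rw [abs_div, Nat.abs_cast]
        gcongr
        exact Finset.abs_sum_le_sum_abs _ _
    _ = (∑ t ∈ Finset.range m, ∫ x, |h x| ∂(μ.map (Z 0))) / m + ∫ x, |h x| ∂(μ.map (Z 0)) := by
        rw [integral_add (hsum.div_const _) (integrable_const _), integral_div,
          integral_finsetSum _ fun t _ => hint t, integral_const, probReal_univ, one_smul]
        congr 2
        exact Finset.sum_congr rfl fun t _ => integral_comp_law hZ hlaw hh.abs t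
    _ ≤ 2 * ∫ x, |h x| ∂(μ.map (Z 0)) := by
        have h0 : 0 ≤ ∫ x, |h x| ∂(μ.map (Z 0)) := integral_nonneg fun _ => abs_nonneg _
        rw [Finset.sum_const, Finset.card_range, nsmul_eq_mul]
        rcases Nat.eq_zero_or_pos m with rfl | hm
        · simp; linarith
        · rw [mul_div_cancel_left₀ _ (by positivity)]
          linarith

theorem avgError_le_of_sub {f g : S → ℝ} (hf : Integrable f (μ.map (Z 0)))
    (hg : Integrable g (μ.map (Z 0))) (m : ℕ) :
    avgError μ Z g m ≤ avgError μ Z f m + 2 * ∫ x, |f x - g x| ∂(μ.map (Z 0)) := by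
  have h := avgError_add hZ hlaw hf (hg.sub hf) m
  rw [add_sub_cancel] at h
  refine h.trans (add_le_add_right ((avgError_le_integral hZ hlaw (hg.sub hf) m).trans_eq ?_) _)
  simp_rw [Pi.sub_apply, abs_sub_comm (g _)]

/-- The `L²` law of large numbers for the indicator of an event under decaying correlations. -/
theorem tendsto_avgError_indicator {a : ℕ → ℝ} (ha : Tendsto a atTop (𝓝 0)) {B : Set S}
    (hB : MeasurableSet B)
    (hcov : ∀ s d, |μ.real (Z s ⁻¹' B ∩ Z (s + d) ⁻¹' B) -
      μ.real (Z s ⁻¹' B) * μ.real (Z (s + d) ⁻¹' B)| ≤ a d) :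
    Tendsto (avgError μ Z (B.indicator 1)) atTop (𝓝 0) := by
  set Y : ℕ → Ω → ℝ := fun t => (Z t ⁻¹' B).indicator 1 with hY
  have hYmem : ∀ t, MemLp (Y t) 2 μ := fun t =>
    memLp_indicator_const 2 (hZ t hB) (1 : ℝ) (.inr (measure_ne_top _ _))
  have hcovY : ∀ s d, covariance (Y s) (Y (s + d)) μ ≤ a d := fun s d => by
    rw [hY, covariance_indicator (hZ s hB) (hZ _ hB)]
    exact (le_abs_self _).trans (hcov s d)
  have ha0 : ∀ d, 0 ≤ a d := fun d => (abs_nonneg _).trans (hcov 0 d)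
  have hmean : ∀ t, ∫ ω, Y t ω ∂μ = ∫ x, B.indicator 1 x ∂(μ.map (Z 0)) := fun t =>
    integral_comp_law hZ hlaw ((integrable_const (1 : ℝ)).indicator hB) t
  have hSmem : ∀ m, MemLp (∑ t ∈ Finset.range m, Y t) 2 μ := fun m =>
    memLp_finsetSum' _ fun t _ => hYmem t
  -- Adding the term `Y m` increases the variance by at most `a 0` plus twice the sum of `a d` over
  -- `1 ≤ d ≤ m`.
  have hvar : ∀ m : ℕ, variance (∑ t ∈ Finset.range m, Y t) μ ≤
      2 * (m * ∑ d ∈ Finset.range m, a d) := by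
    intro m
    induction m with
    | zero => simp
    | succ m ih =>
      rw [Finset.sum_range_succ, variance_add (hSmem m) (hYmem m),
        covariance_sum_left' (fun t _ => hYmem t) (hYmem m)]
      have h1 : ∑ t ∈ Finset.range m, covariance (Y t) (Y m) μ ≤
          ∑ d ∈ Finset.range m, a (d + 1) := by
        rw [← Finset.sum_range_reflect (fun d => a (d + 1))]
        refine Finset.sum_le_sum fun t ht => ?_
        have ht := Finset.mem_range.1 ht
        have := hcovY t (m - t)
        rwa [show t + (m - t) = m by omega, show m - t = m - 1 - t + 1 by omega] at this
      have h2 : variance (Y m) μ ≤ a 0 := by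
        rw [← covariance_self (hYmem m).aemeasurable]
        exact hcovY m 0
      have h3 : ∑ d ∈ Finset.range (m + 1), a d = ∑ d ∈ Finset.range m, a (d + 1) + a 0 :=
        Finset.sum_range_succ' _ _
      have h4 : ∑ d ∈ Finset.range m, a d ≤ ∑ d ∈ Finset.range (m + 1), a d := by
        rw [Finset.sum_range_succ]
        linarith [ha0 m]
      have h5 : (m : ℝ) * ∑ d ∈ Finset.range m, a d ≤ m * ∑ d ∈ Finset.range (m + 1), a d := by
        gcongr
      push_cast
      nlinarith [ha0 0]
  -- The variance of the average is at most twice the Cesàro mean of `a`, which tends to zero with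
  -- `a`; no summability is needed.
  have hbound : ∀ m : ℕ, 0 < m →
      avgError μ Z (B.indicator 1) m ≤ √(2 * ((m : ℝ)⁻¹ * ∑ d ∈ Finset.range m, a d)) := by
    intro m hm
    have hm' : (0 : ℝ) < m := Nat.cast_pos.2 hm
    set T : Ω → ℝ := fun ω => (m : ℝ)⁻¹ * (∑ t ∈ Finset.range m, Y t) ω with hT
    have hTmem : MemLp T 2 μ := (hSmem m).const_mul _
    have hTmean : ∫ ω, T ω ∂μ = ∫ x, B.indicator 1 x ∂(μ.map (Z 0)) := by
      rw [hT, integral_const_mul]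
      simp_rw [Finset.sum_apply]
      rw [integral_finsetSum _ fun t _ => (hYmem t).integrable one_le_two,
        Finset.sum_congr rfl fun t _ => hmean t, Finset.sum_const, Finset.card_range, nsmul_eq_mul,
        inv_mul_cancel_left₀ hm'.ne']
    have hTvar : variance T μ ≤ 2 * ((m : ℝ)⁻¹ * ∑ d ∈ Finset.range m, a d) := by
      rw [hT, variance_const_mul]
      calc ((m : ℝ)⁻¹) ^ 2 * variance (∑ t ∈ Finset.range m, Y t) μ
          ≤ ((m : ℝ)⁻¹) ^ 2 * (2 * (m * ∑ d ∈ Finset.range m, a d)) := by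
            gcongr
            exact hvar m
        _ = 2 * ((m : ℝ)⁻¹ * ∑ d ∈ Finset.range m, a d) := by field_simp
    have h1 : avgError μ Z (B.indicator 1) m = ∫ ω, |T ω - ∫ ω, T ω ∂μ| ∂μ := by
      rw [avgError, hTmean]
      congr 1 with ω
      simp only [hT, Finset.sum_apply, inv_mul_eq_div]
      rfl
    rw [h1]
    refine (integral_abs_le_sqrt (hTmem.sub (memLp_const _))).trans (Real.sqrt_le_sqrt ?_)
    rw [variance_eq_integral hTmem.aemeasurable] at hTvar
    exact hTvar
  have hlim : Tendsto (fun m : ℕ => √(2 * ((m : ℝ)⁻¹ * ∑ d ∈ Finset.range m, a d))) atTop (𝓝 0) := by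
    have := (ha.cesaro.const_mul 2).sqrt
    simpa using this
  exact squeeze_zero' (.of_forall fun m => avgError_nonneg)
    ((eventually_gt_atTop 0).mono hbound) hlim

/-- The `L¹` law of large numbers for integrable functions under decaying correlations. -/
theorem tendsto_avgError {a : ℕ → ℝ} (ha : Tendsto a atTop (𝓝 0))
    (hcov : ∀ B, MeasurableSet B → ∀ s d, |μ.real (Z s ⁻¹' B ∩ Z (s + d) ⁻¹' B) -
      μ.real (Z s ⁻¹' B) * μ.real (Z (s + d) ⁻¹' B)| ≤ a d)
    {h : S → ℝ} (hh : Integrable h (μ.map (Z 0))) :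
    Tendsto (avgError μ Z h) atTop (𝓝 0) := by
  have : IsProbabilityMeasure (μ.map (Z 0)) := Measure.isProbabilityMeasure_map (hZ 0).aemeasurable
  -- The functions that satisfy the law are closed under `L¹` approximation. This gives both the
  -- closedness and the almost-everywhere step of the induction below.
  have key : ∀ {f : S → ℝ}, Integrable f (μ.map (Z 0)) →
      (∀ ε > 0, ∃ g : S → ℝ, Integrable g (μ.map (Z 0)) ∧ Tendsto (avgError μ Z g) atTop (𝓝 0) ∧
        ∫ x, |g x - f x| ∂(μ.map (Z 0)) < ε) → Tendsto (avgError μ Z f) atTop (𝓝 0) := by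
    intro f hf happ
    rw [Metric.tendsto_atTop]
    intro ε hε
    obtain ⟨g, hg, hg', hgf⟩ := happ (ε / 4) (by positivity)
    obtain ⟨N, hN⟩ := Metric.tendsto_atTop.1 hg' (ε / 2) (by positivity)
    refine ⟨N, fun m hm => ?_⟩
    have h1 := hN m hm
    have h2 := avgError_le_of_sub hZ hlaw hg hf m
    rw [Real.dist_0_eq_abs, abs_of_nonneg avgError_nonneg] at h1 ⊢
    linarith
  refine Integrable.induction (fun h => Tendsto (avgError μ Z h) atTop (𝓝 0)) ?_ ?_ ?_ ?_ hh
  · intro c B hB _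
    have h1 := (tendsto_avgError_indicator hZ hlaw ha hB (hcov B hB)).const_mul |c|
    rw [mul_zero] at h1
    refine h1.congr fun m => ?_
    rw [← avgError_const_mul]
    congr 1
    ext x
    by_cases hx : x ∈ B <;> simp [hx]
  · intro f g _ hf hg h1 h2
    have h3 := h1.add h2
    rw [add_zero] at h3
    exact squeeze_zero (fun m => avgError_nonneg) (avgError_add hZ hlaw hf hg) h3
  · refine isClosed_of_closure_subset fun f hf => key (L1.integrable_coeFn f) fun ε hε => ?_
    obtain ⟨g, hg, hgf⟩ := Metric.mem_closure_iff.1 hf ε hε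
    refine ⟨g, L1.integrable_coeFn g, hg, ?_⟩
    rw [dist_comm, L1.dist_eq_integral_dist] at hgf
    exact hgf
  · intro f g hfg hf h1
    refine key (hf.congr hfg) fun ε hε => ⟨f, hf, h1, ?_⟩
    rw [integral_congr_ae (g := 0) (hfg.mono fun x hx => by simp [hx])]
    simpa using hε

end LawOfLargeNumbers

/-! ### Mixing of the block vectors and convergence of sample covariances -/

section Mixing

variable {Ω : Type*} [mΩ : MeasurableSpace Ω] {p : ℕ} {μ : Measure Ω}
  {X : ℕ → Ω → Fin p → ℝ}

theorem abs_measureReal_inter_sub_le_one [IsProbabilityMeasure μ] (A B : Set Ω) :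
    |μ.real (A ∩ B) - μ.real A * μ.real B| ≤ 1 := by
  have h1 : 0 ≤ μ.real (A ∩ B) := measureReal_nonneg
  have h2 : μ.real (A ∩ B) ≤ 1 := measureReal_le_one
  have h3 : 0 ≤ μ.real A * μ.real B := mul_nonneg measureReal_nonneg measureReal_nonneg
  have h4 : μ.real A * μ.real B ≤ 1 := mul_le_one₀ measureReal_le_one measureReal_nonneg
    measureReal_le_one
  rw [abs_le]
  constructor <;> linarith

theorem le_alphaCoef [IsProbabilityMeasure μ] {i j : Fin p} {k l : ℕ} (hl : 1 ≤ l) {A B : Set Ω}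
    (hA : MeasurableSet[past X i j l] A) (hB : MeasurableSet[future X i j (l + k)] B) :
    |μ.real (A ∩ B) - μ.real A * μ.real B| ≤ alphaCoef μ X i j k := by
  refine le_csSup ⟨1, ?_⟩ ⟨l, hl, A, B, hA, hB, rfl⟩
  rintro _ ⟨_, _, A, B, _, _, rfl⟩
  exact abs_measureReal_inter_sub_le_one A B

theorem pairSigma_le (hX : ∀ t, Measurable (X t)) (i j : Fin p) (S : Set ℕ) :
    pairSigma X i j S ≤ mΩ :=
  iSup₂_le fun t _ => Measurable.comap_le <|
    ((measurable_pi_apply i).comp (hX t)).prodMk ((measurable_pi_apply j).comp (hX t))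

theorem alphaCoef_nonneg {i j : Fin p} {k : ℕ} : 0 ≤ alphaCoef μ X i j k := by
  refine Real.sSup_nonneg ?_
  rintro _ ⟨_, _, A, B, _, _, rfl⟩
  exact abs_nonneg _

/-- Apply the maximal correlation to indicators, whose standard deviations are at most one.
Boundedness of the set of correlations, needed for the real supremum, is the Cauchy–Schwarz
inequality. -/
theorem alphaCoef_le_rhoCoef [IsProbabilityMeasure μ] (hX : ∀ t, Measurable (X t)) {i j : Fin p} {k : ℕ} :
    alphaCoef μ X i j k ≤ rhoCoef μ X i j k := by
  have hbdd : ∀ U W : Ω → ℝ, MemLp U 2 μ → MemLp W 2 μ →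
      |covariance U W μ| / (√(variance U μ) * √(variance W μ)) ≤ 1 := fun U W hU hW =>
    div_le_one_of_le₀ (abs_covariance_le hU hW) (by positivity)
  refine Real.sSup_le ?_ (Real.sSup_nonneg ?_)
  · rintro _ ⟨l, hl, A, B, hA, hB, rfl⟩
    have hA' := pairSigma_le hX i j _ A hA
    have hB' := pairSigma_le hX i j _ B hB
    have hmem : ∀ {A : Set Ω}, MeasurableSet A → MemLp (A.indicator (1 : Ω → ℝ)) 2 μ := fun hA =>
      memLp_indicator_const 2 hA (1 : ℝ) (.inr (measure_ne_top _ _))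
    have hsd : ∀ {A : Set Ω}, MeasurableSet A →
        √(variance (A.indicator (1 : Ω → ℝ)) μ) ≤ 1 := by
      intro A hA
      rw [Real.sqrt_le_left zero_le_one, one_pow, ← covariance_self (hmem hA).aemeasurable,
        covariance_indicator hA hA]
      exact (le_abs_self _).trans (abs_measureReal_inter_sub_le_one A A)
    rw [← covariance_indicator hA' hB']
    refine le_trans ?_ (le_csSup ⟨1, ?_⟩ ⟨l, hl, A.indicator 1, B.indicator 1, ?_, hmem hA', ?_,
      hmem hB', rfl⟩)
    · have h := abs_covariance_le (hmem hA') (hmem hB')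
      -- If a variance vanishes, the correlation is the quotient by zero, that is `0`;
      -- Cauchy–Schwarz then makes the covariance zero too.
      rcases (mul_nonneg (Real.sqrt_nonneg (variance (A.indicator (1 : Ω → ℝ)) μ))
        (Real.sqrt_nonneg (variance (B.indicator (1 : Ω → ℝ)) μ))).eq_or_lt with h0 | h0
      · rw [← h0] at h ⊢
        simpa using h
      · rw [le_div_iff₀ h0]
        exact mul_le_of_le_one_right (abs_nonneg _)
          (mul_le_one₀ (hsd hA') (Real.sqrt_nonneg _) (hsd hB'))
    · rintro _ ⟨_, _, U, W, _, hU, _, hW, rfl⟩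
      exact hbdd U W hU hW
    · exact Measurable.indicator (@measurable_const _ _ _ (past X i j l) 1) hA
    · exact Measurable.indicator (@measurable_const _ _ _ (future X i j (l + k)) 1) hB
  · rintro _ ⟨_, _, U, W, _, hU, _, hW, rfl⟩
    positivity

theorem memLp_two_of_sq_le [IsProbabilityMeasure μ] {f g : Ω → ℝ} (hf : Measurable f) (hg : Integrable g μ)
    (h : ∀ ω, f ω ^ 2 ≤ 1 + g ω) : MemLp f 2 μ := by
  rw [memLp_two_iff_integrable_sq hf.aestronglyMeasurable]
  refine Integrable.mono' ((integrable_const (1 : ℝ)).add hg)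
    (hf.pow_const 2).aestronglyMeasurable (.of_forall fun ω => ?_)
  rw [Real.norm_of_nonneg (sq_nonneg _)]
  exact h ω

/-- Only this much of either set of mixing conditions enters the consistency proof. -/
theorem mixing_consequences [IsProbabilityMeasure μ] (hX : ∀ t, Measurable (X t)) (h : RhoMixing μ X ∨ StrongMixing μ X) :
    (∀ i j, Tendsto (alphaCoef μ X i j) atTop (𝓝 0)) ∧
      ∀ t i, MemLp (fun ω => X t ω i) 2 μ := by
  have hXm : ∀ t i, Measurable fun ω => X t ω i := fun t i => (measurable_pi_apply i).comp (hX t)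
  rcases h with ⟨h1, h2, -⟩ | ⟨h1, ⟨δ, hδ, h2, -⟩, -⟩
  · exact ⟨fun i j => squeeze_zero (fun _ => alphaCoef_nonneg) (fun _ => alphaCoef_le_rhoCoef hX)
      (h1 i j), fun t i => memLp_two_of_sq_le (hXm t i) (h2 t i) fun ω => by
        nlinarith [sq_nonneg (X t ω i ^ 2 - 1), sq_nonneg (X t ω i)]⟩
  · refine ⟨h1, fun t i => memLp_two_of_sq_le (hXm t i) (h2 t i) fun ω => ?_⟩
    rw [← sq_abs]
    rcases le_total |X t ω i| 1 with h | h
    · have h3 : |X t ω i| ^ 2 ≤ 1 := pow_le_one₀ (abs_nonneg _) h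
      have h4 : 0 ≤ |X t ω i| ^ (2 * δ) := Real.rpow_nonneg (abs_nonneg _) _
      linarith
    · have h3 : |X t ω i| ^ (2 : ℝ) ≤ |X t ω i| ^ (2 * δ) :=
        Real.rpow_le_rpow_of_exponent_le h (by linarith)
      rw [Real.rpow_two] at h3
      linarith

theorem measurable_pairSigma {Ω : Type*} {X : ℕ → Ω → Fin p → ℝ} {i j : Fin p} {S : Set ℕ} {u : ℕ} (hu : u ∈ S) :
    Measurable[pairSigma X i j S] (fun ω => (X u ω i, X u ω j)) :=
  (comap_measurable _).mono
    (le_iSup₂ (f := fun t (_ : t ∈ S) => MeasurableSpace.comap (fun ω => (X t ω i, X t ω j))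
      inferInstance) u hu) le_rfl

variable {r τ : ℕ}

theorem measurable_block (hX : ∀ t, Measurable (X t)) (t : ℕ) : Measurable (block X r τ t) :=
  measurable_pi_lambda _ fun a => (measurable_pi_apply a.1).comp (hX _)

/-- The components `a` and `b` of the block vectors. -/
def blockPair (X : ℕ → Ω → Fin p → ℝ) (r τ : ℕ) (a b : Fin p × Fin τ) (t : ℕ) (ω : Ω) : ℝ × ℝ :=
  (block X r τ t ω a, block X r τ t ω b)

theorem measurable_blockPair_pairSigma {Ω : Type*} {X : ℕ → Ω → Fin p → ℝ} (a b : Fin p × Fin τ) (t : ℕ) {S : Set ℕ}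
    (ha : t * r + a.2 ∈ S) (hb : t * r + b.2 ∈ S) :
    Measurable[pairSigma X a.1 b.1 S] (blockPair X r τ a b t) :=
  (measurable_fst.comp (measurable_pairSigma ha)).prodMk
    (measurable_snd.comp (measurable_pairSigma hb))

theorem measurable_blockPair (hX : ∀ t, Measurable (X t)) (a b : Fin p × Fin τ) (t : ℕ) :
    Measurable (blockPair X r τ a b t) :=
  (measurable_blockPair_pairSigma a b t (Set.mem_univ _) (Set.mem_univ _)).mono
    (pairSigma_le hX _ _ _) le_rfl

theorem map_blockPair (hX : ∀ t, Measurable (X t)) (hstat : StrictlyStationary X μ)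
    (a b : Fin p × Fin τ) (t : ℕ) :
    μ.map (blockPair X r τ a b t) = μ.map (blockPair X r τ a b 0) := by
  set F : (ℕ → Fin p → ℝ) → ℝ × ℝ := fun x => (x a.2 a.1, x b.2 b.1) with hF
  have hFm : Measurable F := by fun_prop
  have h : ∀ t, blockPair X r τ a b t = F ∘ fun ω u => X (u + t * r) ω := fun t => by
    ext ω <;> simp [blockPair, block, hF, add_comm]
  rw [h t, h 0, ← Measure.map_map hFm (measurable_pi_lambda _ fun u => hX _),
    ← Measure.map_map hFm (measurable_pi_lambda _ fun u => hX _), hstat (t * r), hstat (0 * r)]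

/-- A bound for the dependence of block vectors at the distance `d`. -/
def blockAlpha (μ : Measure Ω) (X : ℕ → Ω → Fin p → ℝ) (r τ : ℕ) (a b : Fin p × Fin τ) (d : ℕ) : ℝ :=
  if d * r < τ then 1 else alphaCoef μ X a.1 b.1 (d * r - τ)

theorem tendsto_blockAlpha (hr : 1 ≤ r) (hα : ∀ i j, Tendsto (alphaCoef μ X i j) atTop (𝓝 0))
    (a b : Fin p × Fin τ) : Tendsto (blockAlpha μ X r τ a b) atTop (𝓝 0) := by
  have h1 : Tendsto (fun d : ℕ => d * r - τ) atTop atTop := by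
    refine tendsto_atTop_atTop.2 fun n => ⟨n + τ, fun d hd => ?_⟩
    have := Nat.le_mul_of_pos_right d hr
    omega
  refine ((hα a.1 b.1).comp h1).congr' ?_
  filter_upwards [eventually_ge_atTop τ] with d hd
  have := Nat.le_mul_of_pos_right d hr
  rw [blockAlpha, if_neg (by omega)]
  rfl

theorem abs_blockPair_le [IsProbabilityMeasure μ] (a b : Fin p × Fin τ) {B : Set (ℝ × ℝ)} (hB : MeasurableSet B)
    (s d : ℕ) : |μ.real (blockPair X r τ a b s ⁻¹' B ∩ blockPair X r τ a b (s + d) ⁻¹' B) -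
      μ.real (blockPair X r τ a b s ⁻¹' B) * μ.real (blockPair X r τ a b (s + d) ⁻¹' B)| ≤
        blockAlpha μ X r τ a b d := by
  rw [blockAlpha]
  split_ifs with h
  · exact abs_measureReal_inter_sub_le_one _ _
  · have ha := a.2.isLt
    have hb := b.2.isLt
    -- Block `s` ends at observation number `s * r + τ`, and block `s + d` begins at number `(s + d)
    -- * r + 1`. The gap is one more than the `d * r - τ` used, which does no harm.
    refine le_alphaCoef (l := s * r + τ) (by omega)
      (measurable_blockPair_pairSigma a b s ?_ ?_ hB)
      (measurable_blockPair_pairSigma a b (s + d) ?_ ?_ hB)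
    · change s * r + a.2 + 1 ≤ s * r + τ
      omega
    · change s * r + b.2 + 1 ≤ s * r + τ
      omega
    · change s * r + τ + (d * r - τ) ≤ (s + d) * r + a.2 + 1
      rw [add_mul]
      omega
    · change s * r + τ + (d * r - τ) ≤ (s + d) * r + b.2 + 1
      rw [add_mul]
      omega

theorem tendstoInMeasure_of_tendsto_integral [IsProbabilityMeasure μ] {f : ℕ → Ω → ℝ} {c : ℝ}
    (hf : ∀ m, Integrable (fun ω => f m ω - c) μ)
    (h : Tendsto (fun m => ∫ ω, |f m ω - c| ∂μ) atTop (𝓝 0)) :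
    TendstoInMeasure μ f atTop (fun _ => c) := by
  rw [tendstoInMeasure_iff_measureReal_norm]
  intro ε hε
  have h' := h.const_mul ε⁻¹
  rw [mul_zero] at h'
  refine squeeze_zero (fun _ => measureReal_nonneg) (fun m => ?_) h'
  rw [le_inv_mul_iff₀ hε]
  exact mul_meas_ge_le_integral_of_nonneg (.of_forall fun _ => abs_nonneg _) (hf m).abs ε

/-- The mixing coefficients control only two variables at a time. Two components of a block suffice,
since a covariance entry involves no more. -/
theorem tendstoInMeasure_blockPair [IsProbabilityMeasure μ] (hX : ∀ t, Measurable (X t)) (hstat : StrictlyStationary X μ)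
    (hα : ∀ i j, Tendsto (alphaCoef μ X i j) atTop (𝓝 0)) (hr : 1 ≤ r)
    (a b : Fin p × Fin τ) {h : ℝ × ℝ → ℝ} (hh : Measurable h)
    (hint : Integrable (fun ω => h (blockPair X r τ a b 0 ω)) μ) :
    TendstoInMeasure μ (fun m ω => (∑ t ∈ Finset.range m, h (blockPair X r τ a b t ω)) / m) atTop
      (fun _ => ∫ ω, h (blockPair X r τ a b 0 ω) ∂μ) := by
  have hZ := measurable_blockPair (r := r) hX a b
  have hlaw := map_blockPair (r := r) hX hstat a b
  have hint' : Integrable h (μ.map (blockPair X r τ a b 0)) :=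
    (integrable_map_measure hh.aestronglyMeasurable (hZ 0).aemeasurable).2 hint
  rw [← integral_map (hZ 0).aemeasurable hh.aestronglyMeasurable]
  exact tendstoInMeasure_of_tendsto_integral (integrable_avg hZ hlaw hint')
    (tendsto_avgError hZ hlaw (tendsto_blockAlpha hr hα a b)
      (fun B hB => abs_blockPair_le a b hB) hint')

/-- The continuous mapping theorem for convergence in probability to a constant. -/
theorem tendstoInMeasure_continuousAt {ι κ : Type*} [Fintype ι] {l : Filter κ} {f : ι → κ → Ω → ℝ}
    {c : ι → ℝ} (hf : ∀ i, TendstoInMeasure μ (f i) l (fun _ => c i)) {F : (ι → ℝ) → ℝ}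
    (hF : ContinuousAt F c) :
    TendstoInMeasure μ (fun n ω => F fun i => f i n ω) l (fun _ => F c) := by
  rw [tendstoInMeasure_iff_dist]
  intro ε hε
  obtain ⟨δ, hδ, hδF⟩ := Metric.continuousAt_iff.1 hF ε hε
  have hsum : Tendsto (fun n => ∑ i, μ {ω | δ ≤ dist (f i n ω) (c i)}) l (𝓝 0) := by
    have := tendsto_finsetSum Finset.univ fun i _ => tendstoInMeasure_iff_dist.1 (hf i) δ hδ
    simpa using this
  refine tendsto_of_tendsto_of_tendsto_of_le_of_le tendsto_const_nhds hsum (fun _ => zero_le)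
    fun n => (measure_mono fun ω hω => ?_).trans (measure_iUnion_fintype_le _ _)
  by_contra hcon
  simp only [Set.mem_iUnion, not_exists, Set.mem_ofPred_eq, not_le] at hcon hω
  exact absurd (hδF ((dist_pi_lt_iff hδ).2 hcon)) (not_lt.2 hω)

theorem sampleCov_block {Ω : Type*} {X : ℕ → Ω → Fin p → ℝ} {m : ℕ} (hm : 0 < m) (ω : Ω) (a b : Fin p × Fin τ) :
    sampleCov m (fun t : Fin m => block X r τ t ω) a b =
      (∑ t ∈ Finset.range m, block X r τ t ω a * block X r τ t ω b) / m -
        (∑ t ∈ Finset.range m, block X r τ t ω a) / m *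
          ((∑ t ∈ Finset.range m, block X r τ t ω b) / m) := by
  have hm' : (m : ℝ) ≠ 0 := Nat.cast_ne_zero.2 hm.ne'
  have h1 : ∀ f : ℕ → ℝ, ∑ t : Fin m, f t = ∑ t ∈ Finset.range m, f t := fun f =>
    Fin.sum_univ_eq_sum_range f m
  rw [sampleCov]
  set A := ∑ t ∈ Finset.range m, block X r τ t ω a with hA
  set B := ∑ t ∈ Finset.range m, block X r τ t ω b with hB
  rw [h1 fun t => block X r τ t ω a, h1 fun t => block X r τ t ω b,
    h1 fun t => (block X r τ t ω a - A / m) * (block X r τ t ω b - B / m)]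
  have h2 : ∀ t, (block X r τ t ω a - A / m) * (block X r τ t ω b - B / m) =
      block X r τ t ω a * block X r τ t ω b - B / m * block X r τ t ω a -
        A / m * block X r τ t ω b + A / m * (B / m) := fun t => by ring
  simp only [h2, Finset.sum_add_distrib, Finset.sum_sub_distrib, ← Finset.mul_sum, ← hA, ← hB,
    Finset.sum_const, Finset.card_range, nsmul_eq_mul]
  field_simp
  ring

theorem memLp_block (hX : ∀ t i, MemLp (fun ω => X t ω i) 2 μ) (t : ℕ) (a : Fin p × Fin τ) :
    MemLp (fun ω => block X r τ t ω a) 2 μ := hX _ _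

theorem tendstoInMeasure_sampleCov [IsProbabilityMeasure μ] (hX : ∀ t, Measurable (X t)) (hstat : StrictlyStationary X μ)
    (hmix : RhoMixing μ X ∨ StrongMixing μ X) (hr : 1 ≤ r) (a b : Fin p × Fin τ) :
    TendstoInMeasure μ (fun m ω => sampleCov m (fun t : Fin m => block X r τ t ω) a b) atTop
      (fun _ => covMatrix (μ.map (block X r τ 0)) a b) := by
  obtain ⟨hα, hL2⟩ := mixing_consequences hX hmix
  have ha := memLp_block (r := r) hL2 0 a
  have hb := memLp_block (r := r) hL2 0 b
  have hcov : covMatrix (μ.map (block X r τ 0)) a b = ∫ ω, block X r τ 0 ω a * block X r τ 0 ω b ∂μ -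
      (∫ ω, block X r τ 0 ω a ∂μ) * ∫ ω, block X r τ 0 ω b ∂μ := by
    rw [covMatrix, covariance_map_fun (measurable_pi_apply a).aestronglyMeasurable
      (measurable_pi_apply b).aestronglyMeasurable
      (measurable_block hX 0).aemeasurable, covariance_eq_sub ha hb]
    rfl
  have h1 := tendstoInMeasure_blockPair hX hstat hα hr a b (h := fun x => x.1 * x.2)
    (by fun_prop) (ha.integrable_mul hb)
  have h2 := tendstoInMeasure_blockPair hX hstat hα hr a b (h := fun x => x.1)
    (by fun_prop) (ha.integrable one_le_two)
  have h3 := tendstoInMeasure_blockPair hX hstat hα hr a b (h := fun x => x.2)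
    (by fun_prop) (hb.integrable one_le_two)
  have h4 := tendstoInMeasure_continuousAt (ι := Fin 3) (l := atTop)
    (f := ![fun m ω => (∑ t ∈ Finset.range m, block X r τ t ω a * block X r τ t ω b) / m,
      fun m ω => (∑ t ∈ Finset.range m, block X r τ t ω a) / m,
      fun m ω => (∑ t ∈ Finset.range m, block X r τ t ω b) / m])
    (c := ![∫ ω, block X r τ 0 ω a * block X r τ 0 ω b ∂μ, ∫ ω, block X r τ 0 ω a ∂μ,
      ∫ ω, block X r τ 0 ω b ∂μ]) (μ := μ) (F := fun x => x 0 - x 1 * x 2)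
    (by
      intro i
      fin_cases i
      · exact h1
      · exact h2
      · exact h3) (by fun_prop)
  rw [hcov]
  refine h4.congr' ?_ .rfl
  filter_upwards [eventually_gt_atTop 0] with m hm
  exact .of_forall fun ω => (sampleCov_block hm ω a b).symm

end Mixing

/-! ### Regression residuals, Schur complements and continuity -/

section PartialCorrelations

variable {V : Type*} [DecidableEq V]

/-- The coefficients of the regression of the components on those in `k`. -/
def regCoef (M : Matrix V V ℝ) (k : Finset V) : Matrix V k ℝ :=
  M.submatrix id (Subtype.val : k → V) *
    (M.submatrix (Subtype.val : k → V) (Subtype.val : k → V))⁻¹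

/-- The residual of the component `i` after regression on the components in `k`, as a linear form. -/
def resid (M : Matrix V V ℝ) (k : Finset V) (i : V) : V → ℝ := fun a =>
  (if a = i then 1 else 0) - if h : a ∈ k then regCoef M k i ⟨a, h⟩ else 0

variable [Fintype V]

theorem resid_dotProduct (M : Matrix V V ℝ) (k : Finset V) (i : V) (f : V → ℝ) :
    resid M k i ⬝ᵥ f = f i - ∑ c : k, regCoef M k i c * f c := by
  have h : ∑ a, (if h : a ∈ k then regCoef M k i ⟨a, h⟩ else 0) * f a =
      ∑ c : k, regCoef M k i c * f c := by
    rw [← Finset.sum_subset (Finset.subset_univ k), ← Finset.sum_attach k]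
    · refine Finset.sum_congr rfl fun c _ => ?_
      rw [dif_pos c.2]
    · intro a _ ha
      rw [dif_neg ha, zero_mul]
  simp only [dotProduct, resid, sub_mul, Finset.sum_sub_distrib, h]
  simp

theorem schur_apply (M : Matrix V V ℝ) (k : Finset V) (i j : V) :
    schur M k i j = resid M k i ⬝ᵥ fun a => M a j := by
  rw [resid_dotProduct]
  rfl

variable {M : Matrix V V ℝ} (hM : M.PosDef)

include hM

omit [Fintype V] in
theorem det_submatrix_ne_zero (k : Finset V) :
    (M.submatrix (Subtype.val : k → V) (Subtype.val : k → V)).det ≠ 0 :=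
  ((Matrix.isUnit_iff_isUnit_det _).1 (hM.submatrix Subtype.val_injective).isUnit).ne_zero

theorem resid_dotProduct_of_mem (k : Finset V) (i : V) (c : k) :
    (resid M k i ⬝ᵥ fun a => M a c) = 0 := by
  have h : (regCoef M k * M.submatrix (Subtype.val : k → V) (Subtype.val : k → V)) i c = M i c := by
    rw [regCoef, Matrix.mul_assoc,
      Matrix.nonsing_inv_mul _ (isUnit_iff_ne_zero.2 (det_submatrix_ne_zero hM k)), Matrix.mul_one]
    rfl
  rw [resid_dotProduct, ← h, Matrix.mul_apply]
  simp

/-- The residual of `i` is `M`-orthogonal to the components in `k`, so only the `j`-coordinate in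
the residual of `j` contributes. Schur complements are thus covariances of residuals. -/
theorem resid_quadraticForm (k : Finset V) (i j : V) :
    resid M k i ⬝ᵥ M.mulVec (resid M k j) = schur M k i j := by
  rw [Matrix.dotProduct_mulVec, dotProduct_comm, resid_dotProduct, schur_apply]
  have h : ∀ c : k, Matrix.vecMul (resid M k i) M c = 0 := resid_dotProduct_of_mem hM k i
  simp only [h, mul_zero, Finset.sum_const_zero, sub_zero]
  rfl

theorem schur_comm (k : Finset V) (i j : V) : schur M k i j = schur M k j i := by
  rw [← resid_quadraticForm hM, ← resid_quadraticForm hM, Matrix.dotProduct_mulVec,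
    dotProduct_comm, ← Matrix.mulVec_transpose]
  congr 2
  simpa using hM.isHermitian.eq

theorem schur_combination_pos {k : Finset V} {i j : V} (hij : i ≠ j) (hi : i ∉ k) (hj : j ∉ k)
    {s t : ℝ} (hst : s ≠ 0 ∨ t ≠ 0) :
    0 < s ^ 2 * schur M k i i + 2 * s * t * schur M k i j + t ^ 2 * schur M k j j := by
  have hne : s • resid M k i + t • resid M k j ≠ 0 := by
    intro h
    rcases hst with h' | h'
    · have := congrFun h i
      simp [resid, hi, hij] at this
      exact h' this
    · have := congrFun h j
      simp [resid, hj, hij.symm] at this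
      exact h' this
  have h := hM.dotProduct_mulVec_pos hne
  rw [star_trivial, Matrix.mulVec_add, Matrix.mulVec_smul, Matrix.mulVec_smul] at h
  simp only [add_dotProduct, dotProduct_add, smul_dotProduct, dotProduct_smul,
    resid_quadraticForm hM, smul_eq_mul, schur_comm hM k j i] at h
  linarith

theorem schur_pos {k : Finset V} {i j : V} (hij : i ≠ j) (hi : i ∉ k) (hj : j ∉ k) :
    0 < schur M k i i * schur M k j j ∧ schur M k i j ^ 2 < schur M k i i * schur M k j j := by
  have h1 := schur_combination_pos hM hij hi hj (s := 1) (t := 0) (.inl one_ne_zero)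
  have h2 := schur_combination_pos hM hij hi hj (s := 0) (t := 1) (.inr one_ne_zero)
  simp only [one_pow, one_mul, ne_eq, OfNat.ofNat_ne_zero, not_false_eq_true, zero_pow, zero_mul,
    mul_zero, add_zero, zero_add, mul_one] at h1 h2
  -- These coefficients turn the quadratic form into the `i, i` entry times the determinant of the
  -- two-by-two Schur complement.
  have h3 := schur_combination_pos hM hij hi hj (s := - schur M k i j) (t := schur M k i i)
    (.inr h1.ne')
  refine ⟨mul_pos h1 h2, ?_⟩
  have h4 : 0 < schur M k i i * (schur M k i i * schur M k j j - schur M k i j ^ 2) := by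
    nlinarith
  linarith [(mul_pos_iff_of_pos_left h1).1 h4]

theorem abs_partialCorr_lt_one {k : Finset V} {i j : V} (hij : i ≠ j) (hi : i ∉ k) (hj : j ∉ k) :
    |partialCorr M i j k| < 1 := by
  obtain ⟨h1, h2⟩ := schur_pos hM hij hi hj
  rw [partialCorr, abs_div, abs_of_nonneg (Real.sqrt_nonneg _), div_lt_one (Real.sqrt_pos.2 h1)]
  exact Real.lt_sqrt_of_sq_lt (by rwa [sq_abs])

theorem partialCorr_eq_zero_iff {k : Finset V} {i j : V} (hij : i ≠ j) (hi : i ∉ k) (hj : j ∉ k) :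
    partialCorr M i j k = 0 ↔ schur M k i j = 0 := by
  rw [partialCorr, div_eq_zero_iff, or_iff_left]
  exact (Real.sqrt_pos.2 (schur_pos hM hij hi hj).1).ne'

omit hM in
theorem fisherZ_eq_zero_iff {x : ℝ} (hx : |x| < 1) : fisherZ x = 0 ↔ x = 0 := by
  obtain ⟨h1, h2⟩ := abs_lt.1 hx
  have h3 : 0 < (1 + x) / (1 - x) := div_pos (by linarith) (by linarith)
  rw [fisherZ, mul_eq_zero, or_iff_right (by norm_num)]
  constructor
  · intro h
    have h4 := Real.eq_one_of_pos_of_log_eq_zero h3 h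
    rw [div_eq_one_iff_eq (by linarith)] at h4
    linarith
  · rintro rfl
    simp

omit hM in
theorem continuousAt_fisherZ {x : ℝ} (hx : |x| < 1) : ContinuousAt fisherZ x := by
  obtain ⟨h1, h2⟩ := abs_lt.1 hx
  have h3 : 0 < (1 + x) / (1 - x) := div_pos (by linarith) (by linarith)
  unfold fisherZ
  exact continuousAt_const.mul (ContinuousAt.log
    ((by fun_prop : ContinuousAt (fun x : ℝ => 1 + x) x).div (by fun_prop) (by linarith)) h3.ne')

omit [Fintype V] in
-- The principal minor of `M` on `k` is non-zero, so inversion by adjugate and determinant is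
-- continuous there, although matrix inversion is not so everywhere.
theorem continuousAt_schur (k : Finset V) (i j : V) :
    ContinuousAt (fun m : Matrix V V ℝ => schur m k i j) M := by
  have hinv : ContinuousAt (fun m : Matrix V V ℝ =>
      (m.submatrix (Subtype.val : k → V) (Subtype.val : k → V))⁻¹) M := by
    simp only [Matrix.inv_def, Ring.inverse_eq_inv']
    have hsub : Continuous fun m : Matrix V V ℝ =>
        m.submatrix (Subtype.val : k → V) (Subtype.val : k → V) :=
      continuous_id.matrix_submatrix _ _
    exact (hsub.matrix_det.continuousAt.inv₀ (det_submatrix_ne_zero hM k)).smul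
      hsub.matrix_adjugate.continuousAt
  have hentry : ∀ a b : V, ContinuousAt (fun m : Matrix V V ℝ => m a b) M := fun a b =>
    (continuous_id.matrix_elem a b).continuousAt
  have h : ∀ m : Matrix V V ℝ, schur m k i j = m i j - ∑ c : k, (∑ d : k, m i d *
      (m.submatrix (Subtype.val : k → V) (Subtype.val : k → V))⁻¹ d c) * m c j := fun m => by
    simp [schur, Matrix.mul_apply]
  have hinv' : ∀ d c : k, ContinuousAt (fun m : Matrix V V ℝ =>
      (m.submatrix (Subtype.val : k → V) (Subtype.val : k → V))⁻¹ d c) M := fun d c =>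
    ((continuous_id.matrix_elem d c : Continuous fun A : Matrix k k ℝ => A d c).continuousAt).comp
      hinv
  have hrow : ∀ c : k, ContinuousAt (fun m : Matrix V V ℝ => ∑ d : k, m i d *
      (m.submatrix (Subtype.val : k → V) (Subtype.val : k → V))⁻¹ d c) M := fun c =>
    tendsto_finsetSum _ fun d _ => (hentry i d).mul (hinv' d c)
  have hsum : ContinuousAt (fun m : Matrix V V ℝ => ∑ c : k, (∑ d : k, m i d *
      (m.submatrix (Subtype.val : k → V) (Subtype.val : k → V))⁻¹ d c) * m c j) M :=
    tendsto_finsetSum _ fun c _ => (hrow c).mul (hentry c j)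
  rw [show (fun m : Matrix V V ℝ => schur m k i j) = _ from funext h]
  exact (hentry i j).sub hsum

theorem continuousAt_partialCorr {k : Finset V} {i j : V} (hij : i ≠ j) (hi : i ∉ k) (hj : j ∉ k) :
    ContinuousAt (fun m : Matrix V V ℝ => partialCorr m i j k) M := by
  unfold partialCorr
  exact (continuousAt_schur hM k i j).div
    ((continuousAt_schur hM k i i).mul (continuousAt_schur hM k j j)).sqrt
    (Real.sqrt_pos.2 (schur_pos hM hij hi hj).1).ne'

omit hM [DecidableEq V] in
theorem covariance_dotProduct {P : Measure (V → ℝ)} [IsProbabilityMeasure P]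
    (hP : ∀ a, MemLp (fun x : V → ℝ => x a) 2 P) (u w : V → ℝ) :
    covariance (fun x => u ⬝ᵥ x) (fun x => w ⬝ᵥ x) P = u ⬝ᵥ (covMatrix P).mulVec w := by
  simp only [dotProduct, Matrix.mulVec]
  rw [covariance_fun_sum_fun_sum (fun a => (hP a).const_mul _) (fun a => (hP a).const_mul _)]
  refine Finset.sum_congr rfl fun a _ => ?_
  rw [Finset.mul_sum]
  refine Finset.sum_congr rfl fun b _ => ?_
  rw [covariance_const_mul_left, covariance_const_mul_right, covMatrix]
  ring

omit hM in
theorem posDef_covMatrix {P : Measure (V → ℝ)} [IsProbabilityMeasure P]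
    (hP : ∀ a, MemLp (fun x : V → ℝ => x a) 2 P) (hdet : (covMatrix P).det ≠ 0) :
    (covMatrix P).PosDef := by
  refine (Matrix.PosSemidef.posDef_iff_det_ne_zero ?_).2 hdet
  refine .of_dotProduct_mulVec_nonneg ?_ fun u => ?_
  · ext a b
    exact covariance_comm _ _
  · rw [star_trivial, ← covariance_dotProduct hP, covariance_self]
    · exact variance_nonneg _ _
    · simp only [dotProduct]
      exact Measurable.aemeasurable (by fun_prop)

end PartialCorrelations

/-- Kept generic in two types so that it can be applied to one space carrying two different
σ-algebras. -/
theorem measurable_snd_sub_fst {α β : Type*} [MeasurableSpace α] [MeasurableSpace β] {f : α → ℝ}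
    {g : β → ℝ} (hf : Measurable f) (hg : Measurable g) :
    Measurable fun x : α × β => g x.2 - f x.1 :=
  (hg.comp measurable_snd).sub (hf.comp measurable_fst)

/-! ### Conditional independence and shifts by functions of the condition -/

section CondIndep

variable {Ω : Type*} {m mΩ : MeasurableSpace Ω} [StandardBorelSpace Ω] {P : Measure Ω}
  [IsFiniteMeasure P]

/-- Composing the trimmed measure with the conditional kernel gives the law of `ω ↦ (ω, ω)`, which
lives on the diagonal. -/
theorem ae_ae_condExpKernel_eq (hm : m ≤ mΩ) {h : Ω → ℝ} (hh : Measurable[m] h) :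
    ∀ᵐ ω ∂(P.trim hm), ∀ᵐ ω' ∂(condExpKernel P m ω), h ω' = h ω := by
  have key : ∀ᵐ x ∂((P.trim hm) ⊗ₘ condExpKernel P m), h x.2 - h x.1 = 0 := by
    rw [compProd_trim_condExpKernel]
    have hd : @Measurable Ω (Ω × Ω) mΩ (m.prod mΩ) Function.diag :=
      (measurable_id'' hm).prodMk measurable_id
    have hs : @Measurable (Ω × Ω) ℝ (m.prod mΩ) _ fun x => h x.2 - h x.1 :=
      @measurable_snd_sub_fst Ω Ω m mΩ h h hh (hh.mono hm le_rfl)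
    exact (@ae_map_iff _ _ mΩ (m.prod mΩ) _ _
      (@Measurable.aemeasurable _ _ mΩ (m.prod mΩ) _ _ hd) _ (hs (measurableSet_singleton 0))).2
      (Eventually.of_forall fun ω => sub_self _)
  filter_upwards [Measure.ae_ae_of_ae_compProd key] with ω hω
  filter_upwards [hω] with ω' hω' using sub_eq_zero.1 hω'

/-- Under almost every conditional law, `h` and `h'` are constants, and translations preserve
independence. -/
theorem CondIndepFun.sub_measurable (hm : m ≤ mΩ) {f g h h' : Ω → ℝ} (hf : Measurable f)
    (hg : Measurable g) (hh : Measurable[m] h) (hh' : Measurable[m] h')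
    (H : CondIndepFun m hm f g P) :
    CondIndepFun m hm (fun ω => f ω - h ω) (fun ω => g ω - h' ω) P := by
  have h1 := (condIndepFun_iff_map_prod_eq_prod_map_map hf hg).1 H
  intro s t hs ht
  obtain ⟨s, hs, rfl⟩ := hs
  obtain ⟨t, ht, rfl⟩ := ht
  filter_upwards [h1, ae_ae_condExpKernel_eq (P := P) hm hh,
    ae_ae_condExpKernel_eq (P := P) hm hh'] with ω h2 h3 h4
  have h5 : IndepFun f g (condExpKernel P m ω) := by
    rw [indepFun_iff_map_prod_eq_prod_map_map hf.aemeasurable hg.aemeasurable]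
    rw [Kernel.map_apply _ (hf.prodMk hg), Kernel.prod_apply, Kernel.map_apply _ hf,
      Kernel.map_apply _ hg] at h2
    exact h2
  have h6 : IndepFun (fun ω' => f ω' - h ω) (fun ω' => g ω' - h' ω) (condExpKernel P m ω) :=
    h5.comp (measurable_id.sub_const (h ω)) (measurable_id.sub_const (h' ω))
  have h7 : IndepFun (fun ω' => f ω' - h ω') (fun ω' => g ω' - h' ω') (condExpKernel P m ω) := by
    refine h6.congr ?_ ?_
    · filter_upwards [h3] with x hx
      rw [hx]
    · filter_upwards [h4] with x hx
      rw [hx]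
  exact h7.measure_inter_preimage_eq_mul _ _ hs ht

theorem condIndepFun_sub_iff (hm : m ≤ mΩ) {f g h h' : Ω → ℝ} (hf : Measurable f)
    (hg : Measurable g) (hh : Measurable[m] h) (hh' : Measurable[m] h') :
    CondIndepFun m hm (fun ω => f ω - h ω) (fun ω => g ω - h' ω) P ↔ CondIndepFun m hm f g P := by
  refine ⟨fun H => ?_, CondIndepFun.sub_measurable hm hf hg hh hh'⟩
  have := CondIndepFun.sub_measurable hm (hf.sub (hh.mono hm le_rfl))
    (hg.sub (hh'.mono hm le_rfl)) hh.neg hh'.neg H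
  simpa using this

/-- Conditional probabilities of events of `(f, g)` given `m` are almost surely the unconditional
ones, so the two product formulas coincide. -/
theorem condIndepFun_iff_indepFun [IsProbabilityMeasure P] (hm : m ≤ mΩ) {f g : Ω → ℝ}
    (hf : Measurable f) (hg : Measurable g)
    (H : Indep (MeasurableSpace.comap (fun ω => (f ω, g ω)) inferInstance) m P) :
    CondIndepFun m hm f g P ↔ IndepFun f g P := by
  have hfg := (hf.prodMk hg).comap_le
  have key : ∀ u, MeasurableSet u → P⟦(fun ω => (f ω, g ω)) ⁻¹' u | m⟧ =ᵐ[P]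
      fun _ => P.real ((fun ω => (f ω, g ω)) ⁻¹' u) := by
    intro u hu
    have hu' : MeasurableSet[MeasurableSpace.comap (fun ω => (f ω, g ω)) inferInstance]
        ((fun ω => (f ω, g ω)) ⁻¹' u) := ⟨u, hu, rfl⟩
    have := condExp_indep_eq (μ := P) hfg hm
      (stronglyMeasurable_const.indicator (f := fun _ => (1 : ℝ)) hu') H
    rwa [integral_indicator_const _ ((hf.prodMk hg) hu), smul_eq_mul, mul_one] at this
  have e1 : ∀ s t, f ⁻¹' s ∩ g ⁻¹' t = (fun ω => (f ω, g ω)) ⁻¹' (s ×ˢ t) := fun s t => rfl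
  have e2 : ∀ s, f ⁻¹' s = (fun ω => (f ω, g ω)) ⁻¹' (Prod.fst ⁻¹' s) := fun s => rfl
  have e3 : ∀ t, g ⁻¹' t = (fun ω => (f ω, g ω)) ⁻¹' (Prod.snd ⁻¹' t) := fun s => rfl
  rw [condIndepFun_iff_condExp_inter_preimage_eq_mul hf hg,
    indepFun_iff_measure_inter_preimage_eq_mul]
  refine forall₄_congr fun s t hs ht => ?_
  have k1 := key _ (hs.prod ht)
  have k2 := key _ (measurable_fst hs)
  have k3 := key _ (measurable_snd ht)
  rw [← e1] at k1
  rw [← e2] at k2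
  rw [← e3] at k3
  have : P (f ⁻¹' s ∩ g ⁻¹' t) = P (f ⁻¹' s) * P (g ⁻¹' t) ↔
      P.real (f ⁻¹' s ∩ g ⁻¹' t) = P.real (f ⁻¹' s) * P.real (g ⁻¹' t) := by
    rw [measureReal_def, measureReal_def, measureReal_def, ← ENNReal.toReal_mul,
      ENNReal.toReal_eq_toReal_iff' (measure_ne_top _ _)
        (ENNReal.mul_ne_top (measure_ne_top _ _) (measure_ne_top _ _))]
  rw [this]
  constructor
  · intro h
    obtain ⟨ω, h1, h2, h3, h4⟩ := (h.and (k1.and (k2.and k3))).exists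
    dsimp only at h1 h2 h3 h4
    rw [← h2, ← h3, ← h4, h1]
  · intro h
    filter_upwards [k1, k2, k3] with ω h2 h3 h4
    rw [h2, h3, h4, h]

end CondIndep

/-! ### Gaussian laws: zero partial correlation is conditional independence -/

section Gaussian

variable {V : Type*} [Fintype V] [DecidableEq V] {P : Measure (V → ℝ)} [IsProbabilityMeasure P]

omit [DecidableEq V] in
theorem condIndep_singleton_iff (i j : V) (k : Finset V) :
    CondIndep P {i} {j} k ↔
      CondIndepFun (MeasurableSpace.comap (fun x : V → ℝ => k.restrict x) inferInstance)
        (Finset.measurable_restrict k).comap_le (fun x : V → ℝ => x i) (fun x => x j) P := by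
  constructor
  · intro h
    exact CondIndepFun.comp h
      (measurable_pi_apply (⟨i, Finset.mem_singleton_self i⟩ : ({i} : Finset V)))
      (measurable_pi_apply (⟨j, Finset.mem_singleton_self j⟩ : ({j} : Finset V)))
  · intro h
    have := CondIndepFun.comp h (φ := fun a (_ : ({i} : Finset V)) => a)
      (ψ := fun a (_ : ({j} : Finset V)) => a) (by fun_prop) (by fun_prop)
    have e : ∀ a : V, (fun (b : ℝ) (_ : ({a} : Finset V)) => b) ∘ (fun x : V → ℝ => x a) =
        fun x => ({a} : Finset V).restrict x := fun a => by
      funext x ⟨b, hb⟩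
      simp [Finset.mem_singleton.1 hb]
    rw [e, e] at this
    exact this

omit [Fintype V] in
theorem measurable_comap_regression (M : Matrix V V ℝ) (k : Finset V) (i : V) :
    Measurable[MeasurableSpace.comap (fun x : V → ℝ => k.restrict x) inferInstance]
      fun x : V → ℝ => ∑ c : k, regCoef M k i c * x c :=
  (show Measurable fun y : k → ℝ => ∑ c : k, regCoef M k i c * y c by fun_prop).comp
    (comap_measurable _)

omit [DecidableEq V] [IsProbabilityMeasure P] in
theorem memLp_of_hasGaussianLaw (hP : HasGaussianLaw id P) (a : V) :
    MemLp (fun x : V → ℝ => x a) 2 P :=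
  (hP.map_fun (ContinuousLinearMap.proj (R := ℝ) (φ := fun _ : V => ℝ) a)).memLp_two

/-- Subtracting the regressions on `k` does not affect conditional independence given `k`. The
residuals are jointly Gaussian with, and uncorrelated to, the components in `k`, hence independent
of them, so conditioning may be dropped. For jointly Gaussian residuals, independence means zero
covariance, a zero Schur complement entry. -/
theorem isDependenceMeasure_popZ (hP : HasGaussianLaw id P) (hdet : (covMatrix P).det ≠ 0) :
    IsDependenceMeasure P (popZ P) := by
  intro i j k hij hi hj
  have hL2 := memLp_of_hasGaussianLaw hP
  have hM := posDef_covMatrix hL2 hdet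
  set M := covMatrix P with hMdef
  have hZ : popZ P i j k = 0 ↔ schur M k i j = 0 := by
    rw [popZ, fisherZ_eq_zero_iff (abs_partialCorr_lt_one hM hij hi hj),
      partialCorr_eq_zero_iff hM hij hi hj]
  rw [hZ, condIndep_singleton_iff,
    ← condIndepFun_sub_iff _ (measurable_pi_apply i) (measurable_pi_apply j)
      (measurable_comap_regression M k i) (measurable_comap_regression M k j)]
  simp_rw [← resid_dotProduct]
  have hmeas : ∀ a, Measurable fun x : V → ℝ => resid M k a ⬝ᵥ x := fun a => by
    unfold dotProduct
    fun_prop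
  have hcov : ∀ a b, covariance (fun x => resid M k a ⬝ᵥ x) (fun x => resid M k b ⬝ᵥ x) P =
      schur M k a b := fun a b => by
    rw [covariance_dotProduct hL2, resid_quadraticForm hM]
  let L : V → (V → ℝ) →L[ℝ] ℝ := fun a =>
    ∑ b, resid M k a b • ContinuousLinearMap.proj (R := ℝ) (φ := fun _ : V => ℝ) b
  have hL : ∀ a x, L a x = resid M k a ⬝ᵥ x := fun a x => by
    simp [L, dotProduct]
  have hR : ∀ a, MemLp (fun x : V → ℝ => resid M k a ⬝ᵥ x) 2 P := fun a => by
    simpa only [dotProduct] using memLp_finsetSum _ fun b _ => (hL2 b).const_mul _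
  -- The pair of residuals must be independent of the conditioning vector jointly; independence of
  -- each one separately would not suffice.
  have hind : IndepFun (fun x (b : Fin 2) => resid M k (![i, j] b) ⬝ᵥ x)
      (fun x (c : k) => x c) P := by
    refine HasGaussianLaw.indepFun_of_covariance_eval (X := fun (b : Fin 2) x => resid M k (![i, j] b) ⬝ᵥ x)
      (Y := fun (c : k) (x : V → ℝ) => x c) ?_ ?_
    · have := hP.map_fun ((ContinuousLinearMap.pi fun b : Fin 2 => L (![i, j] b)).prod
        (ContinuousLinearMap.pi fun c : k =>
          ContinuousLinearMap.proj (R := ℝ) (φ := fun _ : V => ℝ) (c : V)))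
      convert! this using 1
      funext x
      refine Prod.ext ?_ ?_
      · funext b
        exact (hL _ _).symm
      · rfl
    · intro b c
      have h1 := covariance_dotProduct hL2 (resid M k (![i, j] b)) (Pi.single (c : V) 1)
      simp only [single_dotProduct, one_mul, Matrix.mulVec_single_one] at h1
      rw [h1]
      exact resid_dotProduct_of_mem hM k _ c
  rw [condIndepFun_iff_indepFun _ (hmeas i) (hmeas j)]
  · rw [← hcov i j]
    constructor
    · refine fun h => HasGaussianLaw.indepFun_of_covariance_eq_zero ?_ h
      have := hP.map_fun ((L i).prod (L j))
      convert! this using 1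
      funext x
      exact Prod.ext (hL _ _).symm (hL _ _).symm
    · exact fun h => h.covariance_eq_zero (hR i) (hR j)
  · exact (hind.comp (φ := fun y => (y 0, y 1)) (ψ := id) (by fun_prop) measurable_id)

end Gaussian

/-! ### From convergence in probability to correct test answers -/

section Consistency

variable {Ω : Type*} [MeasurableSpace Ω] {μ : Measure Ω} [IsProbabilityMeasure μ] {p : ℕ}
  {X : ℕ → Ω → Fin p → ℝ} {r τ : ℕ}

theorem continuousAt_fisherZ_partialCorr {V : Type*} [Fintype V] [DecidableEq V]
    {M : Matrix V V ℝ} (hM : M.PosDef) {i j : V} {k : Finset V} (hij : i ≠ j) (hi : i ∉ k)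
    (hj : j ∉ k) :
    ContinuousAt (fun m : V × V → ℝ => fisherZ (partialCorr (fun a b => m (a, b)) i j k))
      (fun q => M q.1 q.2) := by
  have h1 : ContinuousAt (fun m : V × V → ℝ => (fun a b => m (a, b) : Matrix V V ℝ))
      (fun q => M q.1 q.2) := Continuous.continuousAt (by fun_prop)
  have h2 := (continuousAt_partialCorr hM hij hi hj).comp_of_eq h1 rfl
  exact (continuousAt_fisherZ (abs_partialCorr_lt_one hM hij hi hj)).comp_of_eq h2 rfl

theorem tendstoInMeasure_sampleZ (hX : ∀ t, Measurable (X t)) (hstat : StrictlyStationary X μ)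
    (hmix : RhoMixing μ X ∨ StrongMixing μ X) (hr : 1 ≤ r)
    (hdet : (covMatrix (μ.map (block X r τ 0))).det ≠ 0) {i j : Fin p × Fin τ}
    {k : Finset (Fin p × Fin τ)} (hij : i ≠ j) (hi : i ∉ k) (hj : j ∉ k) :
    TendstoInMeasure μ (fun m ω => sampleZ m (fun t => block X r τ t ω) i j k) atTop
      (fun _ => popZ (μ.map (block X r τ 0)) i j k) := by
  have := Measure.isProbabilityMeasure_map (μ := μ) (measurable_block (r := r) (τ := τ) hX 0).aemeasurable
  have hL2 : ∀ a, MemLp (fun x : Fin p × Fin τ → ℝ => x a) 2 (μ.map (block X r τ 0)) := fun a =>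
    (memLp_map_measure_iff (measurable_pi_apply a).aestronglyMeasurable
      (measurable_block hX 0).aemeasurable).2 ((mixing_consequences hX hmix).2 _ _)
  have hM := posDef_covMatrix hL2 hdet
  have hF := continuousAt_fisherZ_partialCorr hM hij hi hj
  have key := tendstoInMeasure_continuousAt (μ := μ)
    (f := fun (q : (Fin p × Fin τ) × (Fin p × Fin τ)) m ω =>
      sampleCov m (fun t : Fin m => block X r τ t ω) q.1 q.2)
    (fun q => tendstoInMeasure_sampleCov hX hstat hmix hr q.1 q.2) hF
  simp only [sampleZ, popZ]
  exact key

omit [IsProbabilityMeasure μ] in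
theorem IsGaussianProcess.hasGaussianLaw_block (hG : IsGaussianProcess X μ) : HasGaussianLaw id (μ.map (block X r τ 0)) := by
  have h := hG.hasGaussianLaw (Finset.range τ)
  let L : (Finset.range τ → Fin p → ℝ) →L[ℝ] (Fin p × Fin τ → ℝ) :=
    ContinuousLinearMap.pi fun a =>
      (ContinuousLinearMap.proj (R := ℝ) (φ := fun _ : Fin p => ℝ) a.1).comp
        (ContinuousLinearMap.proj (R := ℝ) (φ := fun _ : Finset.range τ => Fin p → ℝ)
          ⟨a.2, Finset.mem_range.2 a.2.2⟩)
  have h1 := h.map_fun L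
  have h2 : (fun ω => L ((Finset.range τ).restrict (X · ω))) = block X r τ 0 := by
    funext ω a
    simp [L, block]
  rw [h2] at h1
  have := h1.isGaussian_map
  exact IsGaussian.hasGaussianLaw_id

theorem exists_margin {V : Type*} [Finite V] {ν : V → V → Finset V → ℝ} {γ : ℝ}
    (hγ : IsThreshold ν γ) : ∃ ε > 0, ε ≤ γ ∧
      ∀ i j k, i ≠ j → i ∉ k → j ∉ k → ν i j k ≠ 0 → γ + ε ≤ |ν i j k| := by
  classical
  -- Each of the finitely many strict inequalities leaves room for all small positive `ε`, hence all
  -- of them do simultaneously.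
  have key : ∀ᶠ ε in 𝓝[>] (0 : ℝ), ε ≤ γ ∧
      ∀ q : V × V × Finset V, q.1 ≠ q.2.1 → q.1 ∉ q.2.2 → q.2.1 ∉ q.2.2 →
        ν q.1 q.2.1 q.2.2 ≠ 0 → γ + ε ≤ |ν q.1 q.2.1 q.2.2| := by
    refine ((eventually_le_nhds hγ.1).filter_mono nhdsWithin_le_nhds).and (eventually_all.2 fun q => ?_)
    by_cases h : q.1 ≠ q.2.1 ∧ q.1 ∉ q.2.2 ∧ q.2.1 ∉ q.2.2 ∧ ν q.1 q.2.1 q.2.2 ≠ 0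
    · have h1 := hγ.2 _ _ _ h.1 h.2.1 h.2.2.1 h.2.2.2
      filter_upwards [(eventually_le_nhds (sub_pos.2 h1)).filter_mono nhdsWithin_le_nhds]
        with ε hε _ _ _ _
      linarith
    · exact Eventually.of_forall fun ε h1 h2 h3 h4 => (h ⟨h1, h2, h3, h4⟩).elim
  obtain ⟨ε, ⟨h1, h2⟩, h3⟩ := (key.and self_mem_nhdsWithin).exists
  exact ⟨ε, h3, h1, fun i j k => h2 (i, j, k)⟩

theorem oracle_of_close {V : Type*} [Fintype V] {P : Measure (V → ℝ)} [IsProbabilityMeasure P]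
    {G : V → V → Prop} (hP : Faithful P G) {ν S : V → V → Finset V → ℝ}
    (hν : IsDependenceMeasure P ν) {γ ε : ℝ} (hε : ε ≤ γ)
    (hγ : ∀ i j k, i ≠ j → i ∉ k → j ∉ k → ν i j k ≠ 0 → γ + ε ≤ |ν i j k|)
    (hS : ∀ i j k, i ≠ j → i ∉ k → j ∉ k → |S i j k - ν i j k| < ε) :
    Oracle G fun i j k => |S i j k| ≤ γ := by
  intro i j k hij hi hj
  have h1 := hS i j k hij hi hj
  have h2 : ν i j k = 0 ↔ ¬ DConnected G k i j := by
    rw [hν i j k hij hi hj, hP {i} {j} k (by simpa using hij) (by simpa using hi)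
      (by simpa using hj), dSeparates_singleton]
  rw [← h2]
  constructor
  · intro h
    by_contra h0
    have h3 := hγ i j k hij hi hj h0
    have h4 := abs_sub_abs_le_abs_sub (ν i j k) (S i j k)
    rw [abs_sub_comm] at h4
    linarith
  · intro h0
    rw [h0, sub_zero] at h1
    exact h1.le.trans hε

/-- The sets `S n` need not be measurable. The bound therefore covers the whole space by `S n` and
the bad events, which uses only subadditivity of the outer measure. -/
theorem tendsto_measure_one {ι : Type*} [Finite ι] {l : Filter ℕ} {f : ι → ℕ → Ω → ℝ} {c : ι → ℝ}
    (hf : ∀ q, TendstoInMeasure μ (f q) l fun _ => c q) {ε : ℝ} (hε : 0 < ε) {S : ℕ → Set Ω}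
    (hS : ∀ n ω, (∀ q, |f q n ω - c q| < ε) → ω ∈ S n) :
    Tendsto (fun n => μ (S n)) l (𝓝 1) := by
  have := Fintype.ofFinite ι
  have h0 : Tendsto (fun n => ∑ q, μ {ω | ε ≤ dist (f q n ω) (c q)}) l (𝓝 0) := by
    have := tendsto_finsetSum (Finset.univ : Finset ι) fun q _ =>
      tendstoInMeasure_iff_dist.1 (hf q) ε hε
    simpa using this
  have h1 : Tendsto (fun n => 1 - ∑ q, μ {ω | ε ≤ dist (f q n ω) (c q)}) l (𝓝 1) := by
    simpa using ENNReal.Tendsto.sub tendsto_const_nhds h0 (Or.inl ENNReal.one_ne_top)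
  refine tendsto_of_tendsto_of_tendsto_of_le_of_le h1 tendsto_const_nhds (fun n => ?_)
    fun n => prob_le_one
  rw [tsub_le_iff_right]
  have hcov : (Set.univ : Set Ω) ⊆ S n ∪ ⋃ q, {ω | ε ≤ dist (f q n ω) (c q)} := by
    intro ω _
    by_cases h : ∀ q, |f q n ω - c q| < ε
    · exact Or.inl (hS n ω h)
    · push Not at h
      obtain ⟨q, hq⟩ := h
      exact Or.inr (Set.mem_iUnion.2 ⟨q, hq⟩)
  calc (1 : ENNReal) = μ Set.univ := measure_univ.symm
    _ ≤ μ (S n) + μ (⋃ q, {ω | ε ≤ dist (f q n ω) (c q)}) :=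
      (measure_mono hcov).trans (measure_union_le _ _)
    _ ≤ _ := add_le_add le_rfl (measure_iUnion_fintype_le _ _)

theorem isTimeAwarePCOutput_iff {ci : Fin p × Fin τ → Fin p × Fin τ → Finset (Fin p × Fin τ) → Prop}
    {G : Fin p × Fin τ → Fin p × Fin τ → Prop} (h : ∀ E, IsPCOutput ci E ↔ E = cpdag G)
    (R : Fin p → Fin p → Prop) : IsTimeAwarePCOutput ci R ↔ R = rolled (cpdag G) := by
  simp [IsTimeAwarePCOutput, h]

theorem pcConsistent_of_tendstoInMeasure (hX : ∀ t, Measurable (X t))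
    {G : Fin p × Fin τ → Fin p × Fin τ → Prop} (hG : IsDAG G)
    (hfaithful : Faithful (μ.map (block X r τ 0)) G) {N : ℕ → ℕ} (hN : Tendsto N atTop atTop)
    {ν : Fin p × Fin τ → Fin p × Fin τ → Finset (Fin p × Fin τ) → ℝ}
    {T : (m : ℕ) → (Fin m → Fin p × Fin τ → ℝ) →
      Fin p × Fin τ → Fin p × Fin τ → Finset (Fin p × Fin τ) → ℝ}
    (hν : IsDependenceMeasure (μ.map (block X r τ 0)) ν)
    (hT : ∀ i j k, i ≠ j → i ∉ k → j ∉ k →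
      TendstoInMeasure μ (fun m ω => T m (fun t => block X r τ t ω) i j k) atTop
        (fun _ => ν i j k)) {γ : ℝ} (hγ : IsThreshold ν γ) :
    PCConsistent μ X r τ T γ N G := by
  have := Measure.isProbabilityMeasure_map (μ := μ) (measurable_block (r := r) (τ := τ) hX 0).aemeasurable
  obtain ⟨ε, hε, hεγ, hmargin⟩ := exists_margin hγ
  let ι := {q : (Fin p × Fin τ) × (Fin p × Fin τ) × Finset (Fin p × Fin τ) //
    q.1 ≠ q.2.1 ∧ q.1 ∉ q.2.2 ∧ q.2.1 ∉ q.2.2}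
  have hlim : ∀ q : ι, TendstoInMeasure μ
      (fun n ω => T (N n) (fun t => block X r τ t ω) q.1.1 q.1.2.1 q.1.2.2) atTop
      fun _ => ν q.1.1 q.1.2.1 q.1.2.2 := fun q =>
    (hT _ _ _ q.2.1 q.2.2.1 q.2.2.2).comp hN
  have hout : ∀ n ω, (∀ q : ι, |T (N n) (fun t => block X r τ t ω) q.1.1 q.1.2.1 q.1.2.2 -
      ν q.1.1 q.1.2.1 q.1.2.2| < ε) →
      ∀ E, IsPCOutput (testAnswers X r τ T γ (N n) ω) E ↔ E = cpdag G := fun n ω h =>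
    isPCOutput_iff hG hfaithful (oracle_of_close hfaithful hν hεγ hmargin
      fun i j k hij hi hj => h ⟨(i, j, k), hij, hi, hj⟩)
  exact ⟨tendsto_measure_one hlim hε hout,
    tendsto_measure_one hlim hε fun n ω h => isTimeAwarePCOutput_iff (hout n ω h)⟩

end Consistency

end TimeAwarePC

end

theorem mainTheorem3 {Ω : Type*} [MeasurableSpace Ω] (μ : Measure Ω) [IsProbabilityMeasure μ]
    {p : ℕ} (τ r : ℕ) (hτ : 1 ≤ τ) (hr : 1 ≤ r)
    (X : ℕ → Ω → Fin p → ℝ) (hX : ∀ t, Measurable (X t))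
    (hstat : TimeAwarePC.StrictlyStationary X μ)
    (hmix : TimeAwarePC.RhoMixing μ X ∨ TimeAwarePC.StrongMixing μ X)
    (G : Fin p × Fin τ → Fin p × Fin τ → Prop) (hG : TimeAwarePC.IsDAG G)
    (hfaithful : TimeAwarePC.Faithful (μ.map (TimeAwarePC.block X r τ 0)) G)
    (N : ℕ → ℕ) (hN : Tendsto N atTop atTop) :
    -- partial correlation tests, stationary Gaussian process
    (IsGaussianProcess X μ →
      (TimeAwarePC.covMatrix (μ.map (TimeAwarePC.block X r τ 0))).det ≠ 0 →
      ∀ γ, TimeAwarePC.IsThreshold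
          (TimeAwarePC.popZ (μ.map (TimeAwarePC.block X r τ 0))) γ →
        TimeAwarePC.PCConsistent μ X r τ TimeAwarePC.sampleZ γ N G) ∧
    -- partial correlation tests, any process for which they characterize conditional independence
    (TimeAwarePC.IsDependenceMeasure (μ.map (TimeAwarePC.block X r τ 0))
        (TimeAwarePC.popZ (μ.map (TimeAwarePC.block X r τ 0))) →
      (TimeAwarePC.covMatrix (μ.map (TimeAwarePC.block X r τ 0))).det ≠ 0 →
      ∀ γ, TimeAwarePC.IsThreshold
          (TimeAwarePC.popZ (μ.map (TimeAwarePC.block X r τ 0))) γ →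
        TimeAwarePC.PCConsistent μ X r τ TimeAwarePC.sampleZ γ N G) ∧
    -- tests based on any consistently estimated measure of conditional dependence
    (∀ (ν : Fin p × Fin τ → Fin p × Fin τ → Finset (Fin p × Fin τ) → ℝ)
      (T : (m : ℕ) → (Fin m → Fin p × Fin τ → ℝ) →
        Fin p × Fin τ → Fin p × Fin τ → Finset (Fin p × Fin τ) → ℝ),
      TimeAwarePC.IsDependenceMeasure (μ.map (TimeAwarePC.block X r τ 0)) ν →
      (∀ i j k, i ≠ j → i ∉ k → j ∉ k →
        TendstoInMeasure μ (fun m ω => T m (fun t => TimeAwarePC.block X r τ t ω) i j k) atTop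
          (fun _ => ν i j k)) →
      ∀ γ, TimeAwarePC.IsThreshold ν γ →
        TimeAwarePC.PCConsistent μ X r τ T γ N G) := by
  have := Measure.isProbabilityMeasure_map (μ := μ)
    (TimeAwarePC.measurable_block (r := r) (τ := τ) hX 0).aemeasurable
  refine ⟨fun hgauss hdet γ hγ => ?_, fun hν hdet γ hγ => ?_, fun ν T hν hT γ hγ => ?_⟩
  · exact TimeAwarePC.pcConsistent_of_tendstoInMeasure hX hG hfaithful hN
      (TimeAwarePC.isDependenceMeasure_popZ
        (TimeAwarePC.IsGaussianProcess.hasGaussianLaw_block hgauss) hdet)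
      (fun i j k hij hi hj =>
        TimeAwarePC.tendstoInMeasure_sampleZ hX hstat hmix hr hdet hij hi hj) hγ
  · exact TimeAwarePC.pcConsistent_of_tendstoInMeasure hX hG hfaithful hN hν
      (fun i j k hij hi hj =>
        TimeAwarePC.tendstoInMeasure_sampleZ hX hstat hmix hr hdet hij hi hj) hγ
  · exact TimeAwarePC.pcConsistent_of_tendstoInMeasure hX hG hfaithful hN hν hT hγ
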